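/- **Language.** Consider two-sorted intuitionistic predicate logic with sorts $\iota$ (numbers) and $\kappa$ (classes), function symbols $0, S, \mathrm{Pred}, +, \times$ and program symbols $F_0,\dots,F_k$ on numbers, predicate symbols $=$, $N$, $\mathrm{Null}$ on numbers and $\epsilon$ between numbers and classes, and a function symbol $f_{x,\vec y,A}$ of result sort $\kappa$ for each comprehension instance, i.e. for each proposition $A$ without such symbols whose free variables are among $x,\vec y$. In the *impredicative* version $A$ is arbitrary; in the *predicative* version $A$ contains neither $\epsilon$ nor class variables. The statement holds for both versions. **Congruence.** $HA_2$ consists of the term rules $\mathrm{Pred}(0)\to 0$, $\mathrm{Pred}(S(x))\to x$, $0+y\to y$, $S(x)+y\to S(x+y)$, $0\times y\to 0$, $S(x)\times y\to x\times y+y$. $HA$ consists of $HA_2$ and the proposition rules $$x\,\epsilon\,f_{x,\vec y,A}(\vec y)\to A,\qquad y=z\to\forall X\,(y\,\epsilon\,X\Rightarrow z\,\epsilon\,X),\qquad \mathrm{Null}(0)\to\top,\qquad \mathrm{Null}(S(x))\to\bot,$$ $$N(n)\to\forall X\,\bigl(0\,\epsilon\,X\Rightarrow\forall y\,(N(y)\Rightarrow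 y\,\epsilon\,X\Rightarrow S(y)\,\epsilon\,X)\Rightarrow n\,\epsilon\,X\bigr).$$ For a set $\mathcal E$ of equations between terms of sort $\iota$, $\equiv_{HA\cup\mathcal E}$ (resp. $\equiv_{HA_2\cup\mathcal E}$) is the least congruence on terms and propositions containing all substitution instances of the rules of $HA$ (resp. $HA_2$) and of the equations of $\mathcal E$. Proofs are proof-terms of natural deduction modulo $\equiv_{HA\cup\mathcal E}$; they carry terms at quantifier eliminations $(\pi\,t)$ and at existential introductions $\langle t,\pi\rangle$, and reduce by elimination of cuts ($\triangleright$). Write $\underline n=S^n(0)$, and let $\rho_n$ be the Parigot numerals $\rho_0=\lambda X\lambda\alpha\lambda\beta\,\alpha$, $\rho_{n+1}=\lambda X\lambda\alpha\lambda\beta\,(\beta\,\underline n\,\rho_n\,(\rho_n\,X\,\alpha\,\beta))$, which are proofs of $N(\underline n)$. **Hypotheses.** Let $F_0$ have arity $n$, and let $\mathcal E$ be such that $0\not\equiv_{HA_2\cup\mathcal E}S(t)$ for every term $t$. Let $f$ be a (possibly partial) function from $\mathbb N^n$ to $\mathbb N$ specified by $\mathcal E$ through $F_0$: for all $p_1,\dots,p_n,q$,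 the proposition $\underline q=F_0(\underline p_1,\dots,\underline p_n)$ is provable in pure predicate logic from the universally closed equations of $\mathcal E$ and the axioms of equality if and only if $f(p_1,\dots,p_n)$ is defined and equal to $q$. (Every computable $f$ can be so specified.) Let $\pi$ be a proof, without hypotheses, modulo $\equiv_{HA\cup\mathcal E}$, of $$\forall x_1\,(N(x_1)\Rightarrow\cdots\Rightarrow\forall x_n\,(N(x_n)\Rightarrow\exists y\,(N(y)\wedge y=F_0(x_1,\dots,x_n)))\cdots).$$ **Conclusion.** For all $p_1,\dots,p_n\in\mathbb N$ there are a number $q$, a term $t$ and proof-terms $\sigma,\tau$ such that: 1. the proof $(\pi\,\underline p_1\,\rho_{p_1}\cdots\underline p_n\,\rho_{p_n})$ is strongly normalizing and its (unique) normal form is $\langle t,\langle\sigma,\tau\rangle\rangle$, where $\sigma$ is a proof of $N(t)$ and $\tau$ a proof of $t=F_0(\underline p_1,\dots,\underline p_n)$ modulo $\equiv_{HA\cup\mathcal E}$; 2. $t\equiv_{HA\cup\mathcal E}\underline q$, and $\sigma$ is the normal form of $\rho_q$, up to replacement of terms occurring in the proof-term by congruent terms; 3. $\underline q=F_0(\underline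 p_1,\dots,\underline p_n)$ is provable modulo $\equiv_{HA\cup\mathcal E}$; 4. $q=f(p_1,\dots,p_n)$ whenever $f(p_1,\dots,p_n)$ is defined (hence always, if $f$ is total); 5. with $\pi'=\lambda x_1\lambda\alpha_1\cdots\lambda x_n\lambda\alpha_n\;\delta_\exists\bigl((\pi\,x_1\,\alpha_1\cdots x_n\,\alpha_n),\,y\beta\,\langle y,\mathrm{fst}(\beta)\rangle\bigr)$, the proof $(\pi'\,\underline p_1\,\rho_{p_1}\cdots\underline p_n\,\rho_{p_n})$ is strongly normalizing with (unique) normal form $\langle t,\sigma\rangle$. Moreover $\pi'$ is a proof of $\forall x_1\,(N(x_1)\Rightarrow\cdots\Rightarrow\forall x_n\,(N(x_n)\Rightarrow\exists y\,N(y))\cdots)$ modulo $\equiv_{HA\cup\mathcal E}$; so it is a program that maps $p_1,\dots,p_n$ to $f(p_1,\dots,p_n)$. -/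

import Mathlib

namespace DeductionModulo

/-! ## Languages

Two sorts: `ι` (numbers) and `κ` (classes of numbers). Variables are de Bruijn indices, with one
independent family of indices for each sort (and a third one for proof variables). -/

/-- The program symbols `F₀, …, F_k` with their arities. -/
structure Sig where
  k : ℕ
  arity : Fin (k + 1) → ℕ

/-- A family of function symbols of result sort `κ`; `arI s` and `arK s` are the numbers of
arguments of sort `ι` and of sort `κ`. -/
structure ClassSig where
  Sym : Type
  arI : Sym → ℕ
  arK : Sym → ℕ

/-- No function symbol of sort `κ`. -/
def ClassSig.none : ClassSig := ⟨Empty, fun _ => 0, fun _ => 0⟩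

/-- Terms of sort `ι`. -/
inductive Tm (Ω : Sig) : Type
  | var (n : ℕ)
  | zero
  | succ (t : Tm Ω)
  | pred (t : Tm Ω)
  | add (t u : Tm Ω)
  | mul (t u : Tm Ω)
  | fn (i : Fin (Ω.k + 1)) (args : Fin (Ω.arity i) → Tm Ω)

/-- Terms of sort `κ`. -/
inductive Cl (Ω : Sig) (K : ClassSig) : Type
  | var (n : ℕ)
  | sk (s : K.Sym) (args : Fin (K.arI s) → Tm Ω) (cargs : Fin (K.arK s) → Cl Ω K)

/-- Propositions. `allI`, `exI` bind a variable of sort `ι`; `allK`, `exK` one of sort `κ`. -/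
inductive Fm (Ω : Sig) (K : ClassSig) : Type
  | eq (t u : Tm Ω)
  | nat (t : Tm Ω)
  | null (t : Tm Ω)
  | mem (t : Tm Ω) (c : Cl Ω K)
  | top
  | bot
  | and (A B : Fm Ω K)
  | or (A B : Fm Ω K)
  | imp (A B : Fm Ω K)
  | allI (A : Fm Ω K)
  | exI (A : Fm Ω K)
  | allK (A : Fm Ω K)
  | exK (A : Fm Ω K)

/-! ## Substitution -/

/-- `t` with the variables replaced according to `σ`. -/
def Tm.subst {Ω : Sig} (σ : ℕ → Tm Ω) : Tm Ω → Tm Ω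
  | .var n => σ n
  | .zero => .zero
  | .succ t => .succ (t.subst σ)
  | .pred t => .pred (t.subst σ)
  | .add t u => .add (t.subst σ) (u.subst σ)
  | .mul t u => .mul (t.subst σ) (u.subst σ)
  | .fn i args => .fn i (fun j => (args j).subst σ)

/-- A simultaneous substitution for the variables of both sorts. -/
structure Sub (Ω : Sig) (K : ClassSig) where
  tm : ℕ → Tm Ω
  cl : ℕ → Cl Ω K

def Cl.subst {Ω : Sig} {K : ClassSig} (s : Sub Ω K) : Cl Ω K → Cl Ω K
  | .var n => s.cl n
  | .sk c args cargs => .sk c (fun j => (args j).subst s.tm) (fun j => (cargs j).subst s)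

namespace Sub

variable {Ω : Sig} {K : ClassSig}

/-- Weakening by `d` fresh variables of sort `ι`. -/
def shiftI (d : ℕ) : Sub Ω K := ⟨fun n => .var (n + d), fun n => .var n⟩

/-- Weakening by one fresh variable of sort `κ`. -/
def shiftK : Sub Ω K := ⟨fun n => .var n, fun n => .var (n + 1)⟩

/-- The substitution `s` under a binder of sort `ι`. -/
def liftI (s : Sub Ω K) : Sub Ω K where
  tm n := match n with
    | 0 => .var 0
    | n + 1 => (s.tm n).subst (fun i => .var (i + 1))
  cl n := (s.cl n).subst (shiftI 1)

/-- The substitution `s` under a binder of sort `κ`. -/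
def liftK (s : Sub Ω K) : Sub Ω K where
  tm := s.tm
  cl n := match n with
    | 0 => .var 0
    | n + 1 => (s.cl n).subst shiftK

/-- `(t/x)` for the innermost variable `x` of sort `ι`. -/
def instI (t : Tm Ω) : Sub Ω K where
  tm n := match n with
    | 0 => t
    | n + 1 => .var n
  cl n := .var n

/-- `(c/X)` for the innermost variable `X` of sort `κ`. -/
def instK (c : Cl Ω K) : Sub Ω K where
  tm n := .var n
  cl n := match n with
    | 0 => c
    | n + 1 => .var n

end Sub

/-- Capture-avoiding substitution in propositions. -/
def Fm.subst {Ω : Sig} {K : ClassSig} (s : Sub Ω K) : Fm Ω K → Fm Ω K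
  | .eq t u => .eq (t.subst s.tm) (u.subst s.tm)
  | .nat t => .nat (t.subst s.tm)
  | .null t => .null (t.subst s.tm)
  | .mem t c => .mem (t.subst s.tm) (c.subst s)
  | .top => .top
  | .bot => .bot
  | .and A B => .and (A.subst s) (B.subst s)
  | .or A B => .or (A.subst s) (B.subst s)
  | .imp A B => .imp (A.subst s) (B.subst s)
  | .allI A => .allI (A.subst s.liftI)
  | .exI A => .exI (A.subst s.liftI)
  | .allK A => .allK (A.subst s.liftK)
  | .exK A => .exK (A.subst s.liftK)

/-! ## Comprehension and the Skolem symbols -/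

/-- All variables of `t` are among the first `p` ones. -/
def Tm.Below {Ω : Sig} (p : ℕ) : Tm Ω → Prop
  | .var n => n < p
  | .zero => True
  | .succ t => t.Below p
  | .pred t => t.Below p
  | .add t u => t.Below p ∧ u.Below p
  | .mul t u => t.Below p ∧ u.Below p
  | .fn _ args => ∀ j, (args j).Below p

def Cl.Below {Ω : Sig} {K : ClassSig} (p m : ℕ) : Cl Ω K → Prop
  | .var n => n < m
  | .sk _ args cargs => (∀ j, (args j).Below p) ∧ ∀ j, (cargs j).Below p m

/-- The free variables of `A` are among the first `p` of sort `ι` and the first `m` of sort `κ`. -/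
def Fm.Below {Ω : Sig} {K : ClassSig} : ℕ → ℕ → Fm Ω K → Prop
  | p, _, .eq t u => t.Below p ∧ u.Below p
  | p, _, .nat t => t.Below p
  | p, _, .null t => t.Below p
  | p, m, .mem t c => t.Below p ∧ c.Below p m
  | _, _, .top => True
  | _, _, .bot => True
  | p, m, .and A B => A.Below p m ∧ B.Below p m
  | p, m, .or A B => A.Below p m ∧ B.Below p m
  | p, m, .imp A B => A.Below p m ∧ B.Below p m
  | p, m, .allI A => A.Below (p + 1) m
  | p, m, .exI A => A.Below (p + 1) m
  | p, m, .allK A => A.Below p (m + 1)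
  | p, m, .exK A => A.Below p (m + 1)

/-- `A` contains neither membership nor a quantifier over classes. -/
def Fm.Arithmetical {Ω : Sig} {K : ClassSig} : Fm Ω K → Prop
  | .eq _ _ => True
  | .nat _ => True
  | .null _ => True
  | .mem _ _ => False
  | .top => True
  | .bot => True
  | .and A B => A.Arithmetical ∧ B.Arithmetical
  | .or A B => A.Arithmetical ∧ B.Arithmetical
  | .imp A B => A.Arithmetical ∧ B.Arithmetical
  | .allI A => A.Arithmetical
  | .exI A => A.Arithmetical
  | .allK _ => False
  | .exK _ => False

/-- The two versions of arithmetic: comprehension for propositions without classes only, or for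
all propositions. -/
inductive Comprehension
  | predicative
  | impredicative

/-- A Skolem symbol `f_{x, y₁, …, y_p, Y₁, …, Y_m, A}`, where `A` is a proposition without Skolem
symbols whose free variables are among `x, y₁, …, y_p` (of sort `ι`; the indices `0, 1, …, p`) and
`Y₁, …, Y_m` (of sort `κ`; the indices `0, …, m - 1`). In the predicative case `m = 0`. -/
structure Skolem (Ω : Sig) (𝔠 : Comprehension) where
  p : ℕ
  m : ℕ
  body : Fm Ω ClassSig.none
  below : body.Below (p + 1) m
  admitted : 𝔠 = .predicative → m = 0 ∧ body.Arithmetical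

/-- The function symbols of sort `κ` of arithmetic. -/
def skolemSig (Ω : Sig) (𝔠 : Comprehension) : ClassSig := ⟨Skolem Ω 𝔠, Skolem.p, Skolem.m⟩

/-- The inclusion of the class terms without Skolem symbols, i.e. of the variables. -/
def Cl.embed {Ω : Sig} {K : ClassSig} : Cl Ω ClassSig.none → Cl Ω K
  | .var n => .var n
  | .sk s _ _ => Empty.elim s

/-- The inclusion of the propositions without Skolem symbols. -/
def Fm.embed {Ω : Sig} {K : ClassSig} : Fm Ω ClassSig.none → Fm Ω K
  | .eq t u => .eq t u
  | .nat t => .nat t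
  | .null t => .null t
  | .mem t c => .mem t c.embed
  | .top => .top
  | .bot => .bot
  | .and A B => .and A.embed B.embed
  | .or A B => .or A.embed B.embed
  | .imp A B => .imp A.embed B.embed
  | .allI A => .allI A.embed
  | .exI A => .exI A.embed
  | .allK A => .allK A.embed
  | .exK A => .exK A.embed

/-- Class terms and propositions of arithmetic. -/
abbrev ACl (Ω : Sig) (𝔠 : Comprehension) := Cl Ω (skolemSig Ω 𝔠)
abbrev AFm (Ω : Sig) (𝔠 : Comprehension) := Fm Ω (skolemSig Ω 𝔠)

/-! ## Congruences -/

/-- The rules of `HA` that rewrite terms to terms, as pairs (left side, right side). -/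
def HA2 (Ω : Sig) : Set (Tm Ω × Tm Ω) :=
  { (.pred .zero, .zero),
    (.pred (.succ (.var 0)), .var 0),
    (.add .zero (.var 0), .var 0),
    (.add (.succ (.var 0)) (.var 1), .succ (.add (.var 0) (.var 1))),
    (.mul .zero (.var 0), .zero),
    (.mul (.succ (.var 0)) (.var 1), .add (.mul (.var 0) (.var 1)) (.var 1)) }

/-- The rules of `HA` that rewrite atomic propositions to propositions. -/
inductive HA1 {Ω : Sig} {𝔠 : Comprehension} : AFm Ω 𝔠 → AFm Ω 𝔠 → Prop
  | mem (s : Skolem Ω 𝔠) :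
      HA1 (.mem (.var 0)
            (Cl.sk (K := skolemSig Ω 𝔠) s
              (fun i : Fin s.p => .var ((i : ℕ) + 1)) (fun j : Fin s.m => .var (j : ℕ))))
          s.body.embed
  | eq :
      HA1 (.eq (.var 0) (.var 1)) (.allK (.imp (.mem (.var 0) (.var 0)) (.mem (.var 1) (.var 0))))
  | nat :
      HA1 (.nat (.var 0))
        (.allK (.imp (.mem .zero (.var 0))
          (.imp
            (.allI (.imp (.nat (.var 0))
              (.imp (.mem (.var 0) (.var 0)) (.mem (.succ (.var 0)) (.var 0)))))
            (.mem (.var 0) (.var 0)))))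
  | nullZero : HA1 (.null .zero) .top
  | nullSucc : HA1 (.null (.succ (.var 0))) .bot

/-- The congruence on terms of sort `ι` defined by a set `R` of rules and equational axioms. -/
inductive TmEq {Ω : Sig} (R : Set (Tm Ω × Tm Ω)) : Tm Ω → Tm Ω → Prop
  | ax {l r : Tm Ω} (h : (l, r) ∈ R) (σ : ℕ → Tm Ω) : TmEq R (l.subst σ) (r.subst σ)
  | refl (t : Tm Ω) : TmEq R t t
  | symm {t u : Tm Ω} : TmEq R t u → TmEq R u t
  | trans {t u v : Tm Ω} : TmEq R t u → TmEq R u v → TmEq R t v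
  | succ {t t' : Tm Ω} : TmEq R t t' → TmEq R (.succ t) (.succ t')
  | pred {t t' : Tm Ω} : TmEq R t t' → TmEq R (.pred t) (.pred t')
  | add {t t' u u' : Tm Ω} : TmEq R t t' → TmEq R u u' → TmEq R (.add t u) (.add t' u')
  | mul {t t' u u' : Tm Ω} : TmEq R t t' → TmEq R u u' → TmEq R (.mul t u) (.mul t' u')
  | fn (i : Fin (Ω.k + 1)) {a a' : Fin (Ω.arity i) → Tm Ω} :
      (∀ j, TmEq R (a j) (a' j)) → TmEq R (.fn i a) (.fn i a')

/-- The congruence on terms of sort `κ` defined by a set `R` of rules and equational axioms between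
terms of sort `ι`. -/
inductive ClEq {Ω : Sig} {K : ClassSig} (R : Set (Tm Ω × Tm Ω)) : Cl Ω K → Cl Ω K → Prop
  | refl (c : Cl Ω K) : ClEq R c c
  | symm {c d : Cl Ω K} : ClEq R c d → ClEq R d c
  | trans {c d e : Cl Ω K} : ClEq R c d → ClEq R d e → ClEq R c e
  | sk (s : K.Sym) {a a' : Fin (K.arI s) → Tm Ω} {b b' : Fin (K.arK s) → Cl Ω K} :
      (∀ j, TmEq R (a j) (a' j)) → (∀ j, ClEq R (b j) (b' j)) → ClEq R (.sk s a b) (.sk s a' b')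

/-- The congruence `≡_{HA ∪ E}` on propositions. (On terms it is `TmEq (HA2 Ω ∪ E)` and
`ClEq (HA2 Ω ∪ E)`.) -/
inductive FmEq {Ω : Sig} {𝔠 : Comprehension} (E : Set (Tm Ω × Tm Ω)) : AFm Ω 𝔠 → AFm Ω 𝔠 → Prop
  | rule {l r : AFm Ω 𝔠} (h : HA1 l r) (s : Sub Ω (skolemSig Ω 𝔠)) : FmEq E (l.subst s) (r.subst s)
  | refl (A : AFm Ω 𝔠) : FmEq E A A
  | symm {A B : AFm Ω 𝔠} : FmEq E A B → FmEq E B A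
  | trans {A B C : AFm Ω 𝔠} : FmEq E A B → FmEq E B C → FmEq E A C
  | eq {t t' u u' : Tm Ω} : TmEq (HA2 Ω ∪ E) t t' → TmEq (HA2 Ω ∪ E) u u' →
      FmEq E (.eq t u) (.eq t' u')
  | nat {t t' : Tm Ω} : TmEq (HA2 Ω ∪ E) t t' → FmEq E (.nat t) (.nat t')
  | null {t t' : Tm Ω} : TmEq (HA2 Ω ∪ E) t t' → FmEq E (.null t) (.null t')
  | mem {t t' : Tm Ω} {c c' : ACl Ω 𝔠} : TmEq (HA2 Ω ∪ E) t t' → ClEq (HA2 Ω ∪ E) c c' →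
      FmEq E (.mem t c) (.mem t' c')
  | and {A A' B B' : AFm Ω 𝔠} : FmEq E A A' → FmEq E B B' → FmEq E (.and A B) (.and A' B')
  | or {A A' B B' : AFm Ω 𝔠} : FmEq E A A' → FmEq E B B' → FmEq E (.or A B) (.or A' B')
  | imp {A A' B B' : AFm Ω 𝔠} : FmEq E A A' → FmEq E B B' → FmEq E (.imp A B) (.imp A' B')
  | allI {A A' : AFm Ω 𝔠} : FmEq E A A' → FmEq E (.allI A) (.allI A')
  | exI {A A' : AFm Ω 𝔠} : FmEq E A A' → FmEq E (.exI A) (.exI A')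
  | allK {A A' : AFm Ω 𝔠} : FmEq E A A' → FmEq E (.allK A) (.allK A')
  | exK {A A' : AFm Ω 𝔠} : FmEq E A A' → FmEq E (.exK A) (.exK A')

/-! ## Proof-terms -/

/-- Proof-terms. `lam` and the second and third arguments of `case` bind a proof variable; `lamI`,
`lamK` bind a variable of sort `ι`, `κ`; the second argument of `unpackI`, `unpackK` (the proof-term
`δ_∃`) binds a variable of sort `ι`, `κ` and a proof variable. -/
inductive Pf (Ω : Sig) (K : ClassSig) : Type
  | var (n : ℕ)
  | triv
  | botE (a : Pf Ω K)
  | pair (a b : Pf Ω K)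
  | fst (a : Pf Ω K)
  | snd (a : Pf Ω K)
  | inl (a : Pf Ω K)
  | inr (a : Pf Ω K)
  | case (a b c : Pf Ω K)
  | lam (a : Pf Ω K)
  | app (a b : Pf Ω K)
  | lamI (a : Pf Ω K)
  | appI (a : Pf Ω K) (t : Tm Ω)
  | lamK (a : Pf Ω K)
  | appK (a : Pf Ω K) (c : Cl Ω K)
  | packI (t : Tm Ω) (a : Pf Ω K)
  | unpackI (a b : Pf Ω K)
  | packK (c : Cl Ω K) (a : Pf Ω K)
  | unpackK (a b : Pf Ω K)

namespace Pf

variable {Ω : Sig} {K : ClassSig}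

/-- Substitution of terms in a proof-term. -/
def tsubst : Sub Ω K → Pf Ω K → Pf Ω K
  | _, .var n => .var n
  | _, .triv => .triv
  | s, .botE a => .botE (a.tsubst s)
  | s, .pair a b => .pair (a.tsubst s) (b.tsubst s)
  | s, .fst a => .fst (a.tsubst s)
  | s, .snd a => .snd (a.tsubst s)
  | s, .inl a => .inl (a.tsubst s)
  | s, .inr a => .inr (a.tsubst s)
  | s, .case a b c => .case (a.tsubst s) (b.tsubst s) (c.tsubst s)
  | s, .lam a => .lam (a.tsubst s)
  | s, .app a b => .app (a.tsubst s) (b.tsubst s)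
  | s, .lamI a => .lamI (a.tsubst s.liftI)
  | s, .appI a t => .appI (a.tsubst s) (t.subst s.tm)
  | s, .lamK a => .lamK (a.tsubst s.liftK)
  | s, .appK a c => .appK (a.tsubst s) (c.subst s)
  | s, .packI t a => .packI (t.subst s.tm) (a.tsubst s)
  | s, .unpackI a b => .unpackI (a.tsubst s) (b.tsubst s.liftI)
  | s, .packK c a => .packK (c.subst s) (a.tsubst s)
  | s, .unpackK a b => .unpackK (a.tsubst s) (b.tsubst s.liftK)

/-- The renaming `ξ` under a binder of a proof variable. -/
def liftRen (ξ : ℕ → ℕ) : ℕ → ℕ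
  | 0 => 0
  | n + 1 => ξ n + 1

/-- Renaming of proof variables. -/
def rename : (ℕ → ℕ) → Pf Ω K → Pf Ω K
  | ξ, .var n => .var (ξ n)
  | _, .triv => .triv
  | ξ, .botE a => .botE (a.rename ξ)
  | ξ, .pair a b => .pair (a.rename ξ) (b.rename ξ)
  | ξ, .fst a => .fst (a.rename ξ)
  | ξ, .snd a => .snd (a.rename ξ)
  | ξ, .inl a => .inl (a.rename ξ)
  | ξ, .inr a => .inr (a.rename ξ)
  | ξ, .case a b c => .case (a.rename ξ) (b.rename (liftRen ξ)) (c.rename (liftRen ξ))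
  | ξ, .lam a => .lam (a.rename (liftRen ξ))
  | ξ, .app a b => .app (a.rename ξ) (b.rename ξ)
  | ξ, .lamI a => .lamI (a.rename ξ)
  | ξ, .appI a t => .appI (a.rename ξ) t
  | ξ, .lamK a => .lamK (a.rename ξ)
  | ξ, .appK a c => .appK (a.rename ξ) c
  | ξ, .packI t a => .packI t (a.rename ξ)
  | ξ, .unpackI a b => .unpackI (a.rename ξ) (b.rename (liftRen ξ))
  | ξ, .packK c a => .packK c (a.rename ξ)
  | ξ, .unpackK a b => .unpackK (a.rename ξ) (b.rename (liftRen ξ))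

/-- The substitution `θ` of proofs for proof variables under a binder of a proof variable. -/
def lift (θ : ℕ → Pf Ω K) : ℕ → Pf Ω K
  | 0 => .var 0
  | n + 1 => (θ n).rename (· + 1)

/-- The substitution `θ` under a binder of a variable of sort `ι`. -/
def liftI (θ : ℕ → Pf Ω K) (n : ℕ) : Pf Ω K := (θ n).tsubst (Sub.shiftI 1)

/-- The substitution `θ` under a binder of a variable of sort `κ`. -/
def liftK (θ : ℕ → Pf Ω K) (n : ℕ) : Pf Ω K := (θ n).tsubst Sub.shiftK

/-- Simultaneous substitution of proofs for proof variables. -/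
def subst : (ℕ → Pf Ω K) → Pf Ω K → Pf Ω K
  | θ, .var n => θ n
  | _, .triv => .triv
  | θ, .botE a => .botE (a.subst θ)
  | θ, .pair a b => .pair (a.subst θ) (b.subst θ)
  | θ, .fst a => .fst (a.subst θ)
  | θ, .snd a => .snd (a.subst θ)
  | θ, .inl a => .inl (a.subst θ)
  | θ, .inr a => .inr (a.subst θ)
  | θ, .case a b c => .case (a.subst θ) (b.subst (lift θ)) (c.subst (lift θ))
  | θ, .lam a => .lam (a.subst (lift θ))
  | θ, .app a b => .app (a.subst θ) (b.subst θ)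
  | θ, .lamI a => .lamI (a.subst (liftI θ))
  | θ, .appI a t => .appI (a.subst θ) t
  | θ, .lamK a => .lamK (a.subst (liftK θ))
  | θ, .appK a c => .appK (a.subst θ) c
  | θ, .packI t a => .packI t (a.subst θ)
  | θ, .unpackI a b => .unpackI (a.subst θ) (b.subst (lift (liftI θ)))
  | θ, .packK c a => .packK c (a.subst θ)
  | θ, .unpackK a b => .unpackK (a.subst θ) (b.subst (lift (liftK θ)))

/-- `(b/α)a` for the innermost proof variable `α` of `a`. -/
def inst (b a : Pf Ω K) : Pf Ω K :=
  a.subst (fun n => match n with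
    | 0 => b
    | n + 1 => .var n)

/-- One step of proof reduction, at any place of the proof-term. -/
inductive Red : Pf Ω K → Pf Ω K → Prop
  | fstPair (a b : Pf Ω K) : Red (.fst (.pair a b)) a
  | sndPair (a b : Pf Ω K) : Red (.snd (.pair a b)) b
  | caseInl (a b c : Pf Ω K) : Red (.case (.inl a) b c) (inst a b)
  | caseInr (a b c : Pf Ω K) : Red (.case (.inr a) b c) (inst a c)
  | beta (a b : Pf Ω K) : Red (.app (.lam a) b) (inst b a)
  | betaI (a : Pf Ω K) (t : Tm Ω) : Red (.appI (.lamI a) t) (a.tsubst (Sub.instI t))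
  | betaK (a : Pf Ω K) (c : Cl Ω K) : Red (.appK (.lamK a) c) (a.tsubst (Sub.instK c))
  | unpackPackI (t : Tm Ω) (a b : Pf Ω K) :
      Red (.unpackI (.packI t a) b) (inst a (b.tsubst (Sub.instI t)))
  | unpackPackK (c : Cl Ω K) (a b : Pf Ω K) :
      Red (.unpackK (.packK c a) b) (inst a (b.tsubst (Sub.instK c)))
  | botE {a a' : Pf Ω K} : Red a a' → Red (.botE a) (.botE a')
  | pairL {a a' b : Pf Ω K} : Red a a' → Red (.pair a b) (.pair a' b)
  | pairR {a b b' : Pf Ω K} : Red b b' → Red (.pair a b) (.pair a b')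
  | fst {a a' : Pf Ω K} : Red a a' → Red (.fst a) (.fst a')
  | snd {a a' : Pf Ω K} : Red a a' → Red (.snd a) (.snd a')
  | inl {a a' : Pf Ω K} : Red a a' → Red (.inl a) (.inl a')
  | inr {a a' : Pf Ω K} : Red a a' → Red (.inr a) (.inr a')
  | case₁ {a a' b c : Pf Ω K} : Red a a' → Red (.case a b c) (.case a' b c)
  | case₂ {a b b' c : Pf Ω K} : Red b b' → Red (.case a b c) (.case a b' c)
  | case₃ {a b c c' : Pf Ω K} : Red c c' → Red (.case a b c) (.case a b c')
  | lam {a a' : Pf Ω K} : Red a a' → Red (.lam a) (.lam a')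
  | appL {a a' b : Pf Ω K} : Red a a' → Red (.app a b) (.app a' b)
  | appR {a b b' : Pf Ω K} : Red b b' → Red (.app a b) (.app a b')
  | lamI {a a' : Pf Ω K} : Red a a' → Red (.lamI a) (.lamI a')
  | appI {a a' : Pf Ω K} {t : Tm Ω} : Red a a' → Red (.appI a t) (.appI a' t)
  | lamK {a a' : Pf Ω K} : Red a a' → Red (.lamK a) (.lamK a')
  | appK {a a' : Pf Ω K} {c : Cl Ω K} : Red a a' → Red (.appK a c) (.appK a' c)
  | packI {t : Tm Ω} {a a' : Pf Ω K} : Red a a' → Red (.packI t a) (.packI t a')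
  | unpackIL {a a' b : Pf Ω K} : Red a a' → Red (.unpackI a b) (.unpackI a' b)
  | unpackIR {a b b' : Pf Ω K} : Red b b' → Red (.unpackI a b) (.unpackI a b')
  | packK {c : Cl Ω K} {a a' : Pf Ω K} : Red a a' → Red (.packK c a) (.packK c a')
  | unpackKL {a a' b : Pf Ω K} : Red a a' → Red (.unpackK a b) (.unpackK a' b)
  | unpackKR {a b b' : Pf Ω K} : Red b b' → Red (.unpackK a b) (.unpackK a b')

/-- No reduction step is possible. -/
def Normal (a : Pf Ω K) : Prop := ∀ b, ¬ Red a b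

/-- There is no infinite sequence of reduction steps from `a`. -/
def StronglyNormalizing (a : Pf Ω K) : Prop := Acc (fun x y => Red y x) a

/-- `b` is the normal form of `a`: `a` reduces to `b`, which is normal, and to no other normal
proof-term. -/
def IsNormalForm (a b : Pf Ω K) : Prop :=
  Relation.ReflTransGen Red a b ∧ Normal b ∧
    ∀ c, Relation.ReflTransGen Red a c → Normal c → c = b

/-- Two proof-terms differ only by replacement of the terms that occur in them by terms congruent
modulo `R`. -/
inductive TermCongr (R : Set (Tm Ω × Tm Ω)) : Pf Ω K → Pf Ω K → Prop
  | var (n : ℕ) : TermCongr R (.var n) (.var n)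
  | triv : TermCongr R .triv .triv
  | botE {a a' : Pf Ω K} : TermCongr R a a' → TermCongr R (.botE a) (.botE a')
  | pair {a a' b b' : Pf Ω K} : TermCongr R a a' → TermCongr R b b' →
      TermCongr R (.pair a b) (.pair a' b')
  | fst {a a' : Pf Ω K} : TermCongr R a a' → TermCongr R (.fst a) (.fst a')
  | snd {a a' : Pf Ω K} : TermCongr R a a' → TermCongr R (.snd a) (.snd a')
  | inl {a a' : Pf Ω K} : TermCongr R a a' → TermCongr R (.inl a) (.inl a')
  | inr {a a' : Pf Ω K} : TermCongr R a a' → TermCongr R (.inr a) (.inr a')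
  | case {a a' b b' c c' : Pf Ω K} : TermCongr R a a' → TermCongr R b b' → TermCongr R c c' →
      TermCongr R (.case a b c) (.case a' b' c')
  | lam {a a' : Pf Ω K} : TermCongr R a a' → TermCongr R (.lam a) (.lam a')
  | app {a a' b b' : Pf Ω K} : TermCongr R a a' → TermCongr R b b' →
      TermCongr R (.app a b) (.app a' b')
  | lamI {a a' : Pf Ω K} : TermCongr R a a' → TermCongr R (.lamI a) (.lamI a')
  | appI {a a' : Pf Ω K} {t t' : Tm Ω} : TermCongr R a a' → TmEq R t t' →
      TermCongr R (.appI a t) (.appI a' t')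
  | lamK {a a' : Pf Ω K} : TermCongr R a a' → TermCongr R (.lamK a) (.lamK a')
  | appK {a a' : Pf Ω K} {c c' : Cl Ω K} : TermCongr R a a' → ClEq R c c' →
      TermCongr R (.appK a c) (.appK a' c')
  | packI {t t' : Tm Ω} {a a' : Pf Ω K} : TmEq R t t' → TermCongr R a a' →
      TermCongr R (.packI t a) (.packI t' a')
  | unpackI {a a' b b' : Pf Ω K} : TermCongr R a a' → TermCongr R b b' →
      TermCongr R (.unpackI a b) (.unpackI a' b')
  | packK {c c' : Cl Ω K} {a a' : Pf Ω K} : ClEq R c c' → TermCongr R a a' →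
      TermCongr R (.packK c a) (.packK c' a')
  | unpackK {a a' b b' : Pf Ω K} : TermCongr R a a' → TermCongr R b b' →
      TermCongr R (.unpackK a b) (.unpackK a' b')

end Pf

/-! ## Natural deduction modulo -/

/-- `Proves R Γ π C`: the proof-term `π` is a proof of `Γ ⊢ C` in intuitionistic natural deduction
modulo the relation `R`; the proof variable `n` stands for the hypothesis number `n` of `Γ`. The
side conditions `x ∉ FV(Γ)` and `x ∉ FV(Γ B)` are expressed by weakening `Γ` and `B`. -/
inductive Proves {Ω : Sig} {K : ClassSig} (R : Fm Ω K → Fm Ω K → Prop) :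
    List (Fm Ω K) → Pf Ω K → Fm Ω K → Prop
  | ax {Γ : List (Fm Ω K)} {n : ℕ} {A B : Fm Ω K} (h : Γ[n]? = some A) (e : R A B) :
      Proves R Γ (.var n) B
  | topI {Γ : List (Fm Ω K)} {A : Fm Ω K} (e : R A .top) : Proves R Γ .triv A
  | botE {Γ : List (Fm Ω K)} {A B : Fm Ω K} {a : Pf Ω K} (e : R B .bot) (h : Proves R Γ a B) :
      Proves R Γ (.botE a) A
  | andI {Γ : List (Fm Ω K)} {A B C : Fm Ω K} {a b : Pf Ω K} (e : R C (.and A B))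
      (h₁ : Proves R Γ a A) (h₂ : Proves R Γ b B) : Proves R Γ (.pair a b) C
  | andE₁ {Γ : List (Fm Ω K)} {A B C : Fm Ω K} {a : Pf Ω K} (e : R C (.and A B))
      (h : Proves R Γ a C) : Proves R Γ (.fst a) A
  | andE₂ {Γ : List (Fm Ω K)} {A B C : Fm Ω K} {a : Pf Ω K} (e : R C (.and A B))
      (h : Proves R Γ a C) : Proves R Γ (.snd a) B
  | orI₁ {Γ : List (Fm Ω K)} {A B C : Fm Ω K} {a : Pf Ω K} (e : R C (.or A B))
      (h : Proves R Γ a A) : Proves R Γ (.inl a) C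
  | orI₂ {Γ : List (Fm Ω K)} {A B C : Fm Ω K} {a : Pf Ω K} (e : R C (.or A B))
      (h : Proves R Γ a B) : Proves R Γ (.inr a) C
  | orE {Γ : List (Fm Ω K)} {A B C D : Fm Ω K} {a b c : Pf Ω K} (e : R D (.or A B))
      (h₁ : Proves R Γ a D) (h₂ : Proves R (A :: Γ) b C) (h₃ : Proves R (B :: Γ) c C) :
      Proves R Γ (.case a b c) C
  | impI {Γ : List (Fm Ω K)} {A B C : Fm Ω K} {a : Pf Ω K} (e : R C (.imp A B))
      (h : Proves R (A :: Γ) a B) : Proves R Γ (.lam a) C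
  | impE {Γ : List (Fm Ω K)} {A B C : Fm Ω K} {a b : Pf Ω K} (e : R C (.imp A B))
      (h₁ : Proves R Γ a C) (h₂ : Proves R Γ b A) : Proves R Γ (.app a b) B
  | allI {Γ : List (Fm Ω K)} {A B : Fm Ω K} {a : Pf Ω K} (e : R B (.allI A))
      (h : Proves R (Γ.map (Fm.subst (Sub.shiftI 1))) a A) : Proves R Γ (.lamI a) B
  | allE {Γ : List (Fm Ω K)} {A B C : Fm Ω K} {a : Pf Ω K} {t : Tm Ω} (e : R B (.allI A))
      (e' : R C (A.subst (Sub.instI t))) (h : Proves R Γ a B) : Proves R Γ (.appI a t) C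
  | exI {Γ : List (Fm Ω K)} {A B C : Fm Ω K} {a : Pf Ω K} {t : Tm Ω} (e : R B (.exI A))
      (e' : R C (A.subst (Sub.instI t))) (h : Proves R Γ a C) : Proves R Γ (.packI t a) B
  | exE {Γ : List (Fm Ω K)} {A B C : Fm Ω K} {a b : Pf Ω K} (e : R C (.exI A))
      (h₁ : Proves R Γ a C)
      (h₂ : Proves R (A :: Γ.map (Fm.subst (Sub.shiftI 1))) b (B.subst (Sub.shiftI 1))) :
      Proves R Γ (.unpackI a b) B
  | allKI {Γ : List (Fm Ω K)} {A B : Fm Ω K} {a : Pf Ω K} (e : R B (.allK A))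
      (h : Proves R (Γ.map (Fm.subst Sub.shiftK)) a A) : Proves R Γ (.lamK a) B
  | allKE {Γ : List (Fm Ω K)} {A B C : Fm Ω K} {a : Pf Ω K} {c : Cl Ω K} (e : R B (.allK A))
      (e' : R C (A.subst (Sub.instK c))) (h : Proves R Γ a B) : Proves R Γ (.appK a c) C
  | exKI {Γ : List (Fm Ω K)} {A B C : Fm Ω K} {a : Pf Ω K} {c : Cl Ω K} (e : R B (.exK A))
      (e' : R C (A.subst (Sub.instK c))) (h : Proves R Γ a C) : Proves R Γ (.packK c a) B
  | exKE {Γ : List (Fm Ω K)} {A B C : Fm Ω K} {a b : Pf Ω K} (e : R C (.exK A))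
      (h₁ : Proves R Γ a C)
      (h₂ : Proves R (A :: Γ.map (Fm.subst Sub.shiftK)) b (B.subst Sub.shiftK)) :
      Proves R Γ (.unpackK a b) B

/-! ## Numerals -/

/-- The term `Sⁿ(0)`. -/
def num {Ω : Sig} : ℕ → Tm Ω
  | 0 => .zero
  | n + 1 => .succ (num n)

/-- The Parigot numerals `ρ_0 = λX λα λβ α` and
`ρ_{n+1} = λX λα λβ (β n ρ_n (ρ_n X α β))`; they are closed. -/
def parigot {Ω : Sig} {K : ClassSig} : ℕ → Pf Ω K
  | 0 => .lamK (.lam (.lam (.var 1)))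
  | n + 1 => .lamK (.lam (.lam
      (.app (.app (.appI (.var 0) (num n)) (parigot n))
        (.app (.app (.appK (parigot n) (.var 0)) (.var 1)) (.var 0)))))

/-- `(π p₁ ρ_{p₁} ⋯ p_n ρ_{p_n})`. -/
def applyNums {Ω : Sig} {K : ClassSig} {n : ℕ} (π : Pf Ω K) (p : Fin n → ℕ) : Pf Ω K :=
  (List.ofFn p).foldl (fun a i => .app (.appI a (num i)) (parigot i)) π

/-! ## Specifications -/

/-- `∀x₁ (N(x₁) ⇒ ⋯ ⇒ ∀x_n (N(x_n) ⇒ A))`; in `A`, the index of `x_i` is `n - i`. -/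
def forallNat {Ω : Sig} {K : ClassSig} : ℕ → Fm Ω K → Fm Ω K
  | 0, A => A
  | n + 1, A => .allI (.imp (.nat (.var 0)) (forallNat n A))

/-- `∀x₁ (N(x₁) ⇒ ⋯ ⇒ ∀x_n (N(x_n) ⇒ ∃y (N(y) ∧ y = F₀(x₁, …, x_n))))`. -/
def programSpec (Ω : Sig) (K : ClassSig) : Fm Ω K :=
  forallNat (Ω.arity 0)
    (.exI (.and (.nat (.var 0))
      (.eq (.var 0) (.fn 0 (fun i => .var (Ω.arity 0 - (i : ℕ)))))))

/-- `∀x₁ (N(x₁) ⇒ ⋯ ⇒ ∀x_n (N(x_n) ⇒ ∃y N(y)))`. -/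
def programType {Ω : Sig} {K : ClassSig} (n : ℕ) : Fm Ω K :=
  forallNat n (.exI (.nat (.var 0)))

/-- `λx₁ λα₁ ⋯ λx_n λα_n δ_∃((π x₁ α₁ ⋯ x_n α_n), yβ ⟨y, fst(β)⟩)`. -/
def extract {Ω : Sig} {K : ClassSig} (n : ℕ) (π : Pf Ω K) : Pf Ω K :=
  (fun a => .lamI (.lam a))^[n]
    (.unpackI
      ((List.range n).reverse.foldl (fun a i => .app (.appI a (.var i)) (.var i))
        ((π.tsubst (Sub.shiftI n)).rename (· + n)))
      (.packI (.var 0) (.fst (.var 0))))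

/-- The axioms `∀x₁ ⋯ ∀x_n (l = r)` (all variables of `l`, `r` among `x₁, …, x_n`), for the
equations `(l, r)` in `E`. -/
inductive EquationAxiom {Ω : Sig} {K : ClassSig} (E : Set (Tm Ω × Tm Ω)) : Fm Ω K → Prop
  | mk {l r : Tm Ω} (h : (l, r) ∈ E) (n : ℕ) (hl : l.Below n) (hr : r.Below n) :
      EquationAxiom E (Fm.allI^[n] (.eq l r))

/-- The axioms of equality: equality is an equivalence relation compatible with the function
symbols. -/
inductive EqualityAxiom {Ω : Sig} {K : ClassSig} : Fm Ω K → Prop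
  | refl : EqualityAxiom (Fm.allI^[1] (.eq (.var 0) (.var 0)))
  | symm : EqualityAxiom (Fm.allI^[2] (.imp (.eq (.var 0) (.var 1)) (.eq (.var 1) (.var 0))))
  | trans : EqualityAxiom (Fm.allI^[3]
      (.imp (.eq (.var 0) (.var 1)) (.imp (.eq (.var 1) (.var 2)) (.eq (.var 0) (.var 2)))))
  | succ : EqualityAxiom (Fm.allI^[2]
      (.imp (.eq (.var 0) (.var 1)) (.eq (.succ (.var 0)) (.succ (.var 1)))))
  | pred : EqualityAxiom (Fm.allI^[2]
      (.imp (.eq (.var 0) (.var 1)) (.eq (.pred (.var 0)) (.pred (.var 1)))))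
  | add : EqualityAxiom (Fm.allI^[4]
      (.imp (.eq (.var 0) (.var 1)) (.imp (.eq (.var 2) (.var 3))
        (.eq (.add (.var 0) (.var 2)) (.add (.var 1) (.var 3))))))
  | mul : EqualityAxiom (Fm.allI^[4]
      (.imp (.eq (.var 0) (.var 1)) (.imp (.eq (.var 2) (.var 3))
        (.eq (.mul (.var 0) (.var 2)) (.mul (.var 1) (.var 3))))))
  | fn (i : Fin (Ω.k + 1)) : EqualityAxiom (Fm.allI^[Ω.arity i + Ω.arity i]
      ((List.ofFn (fun j : Fin (Ω.arity i) =>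
          Fm.eq (K := K) (Tm.var (j : ℕ)) (Tm.var (Ω.arity i + (j : ℕ))))).foldr Fm.imp
        (.eq (.fn i (fun j => .var (j : ℕ))) (.fn i (fun j => .var (Ω.arity i + (j : ℕ)))))))

/-- The set `E` of equations specifies the partial function `f` through the symbol `F₀`: the
proposition `q = F₀(p₁, …, p_n)` is provable, in predicate logic (natural deduction with no
congruence), from the axioms of `E` and the axioms of equality if and only if
`q = f(p₁, …, p_n)`. -/
def Specifies {Ω : Sig} (K : ClassSig) (E : Set (Tm Ω × Tm Ω))
    (f : (Fin (Ω.arity 0) → ℕ) →. ℕ) : Prop :=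
  ∀ (p : Fin (Ω.arity 0) → ℕ) (q : ℕ),
    (∃ (Γ : List (Fm Ω K)) (π : Pf Ω K),
      (∀ A ∈ Γ, EquationAxiom E A ∨ EqualityAxiom A) ∧
      Proves Eq Γ π (.eq (num q) (.fn 0 (fun i => num (p i))))) ↔ q ∈ f p

end DeductionModulo

open DeductionModulo

namespace DeductionModulo

/-! ## Algebra of substitutions -/

variable {Ω : Sig} {K : ClassSig}

/-! The theorem rests on three properties of natural deduction modulo this congruence.

Strong normalization. Propositions are interpreted by reducibility candidates, over a model whose
numbers are the terms modulo the congruence and whose classes are the functions from numbers to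
candidates. Equality is read as Leibniz equality; `Null`, ⊤ and ⊥ all denote the set of strongly
normalizing proof-terms; a Skolem symbol denotes what its body defines, without circularity because
bodies contain no Skolem symbols; `N` is a least fixed point, available because `N` occurs
positively in its own unfolding and candidates form a complete lattice. Congruent propositions then
have the same candidate (`FmEq.cand_eq`), and a proof lies in the candidate of what it proves
(`Proves.mem_cand`). Local confluence and Newman's lemma make normal forms unique.

Subject reduction. A cut can be contracted only if congruence of, say, two conjunctions implies
congruence of their components. As `E` is arbitrary, no confluent rewriting system is at hand.
Instead, `hd` unfolds a proposition until its outermost symbol is stable, and `FmEq.head` shows that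
congruent propositions have unfoldings with the same outermost symbol and congruent components. That
0 is congruent to no successor keeps ⊤ and ⊥ apart here, since both are unfoldings of instances of
`Null`.

Shape of normal proofs. When every hypothesis is t ε X or an induction step, a normal proof ends
with an introduction or is a hypothesis applied to arguments (`Proves.intro_or_spine`). Hence a
closed normal proof of the existential statement is ⟨t, ⟨σ, τ⟩⟩. A closed normal proof of t = u can
only be λX λα α, which forces t ≡ u (`Proves.tmEq_of_eq`). A closed normal proof of N(t) is the
normal form of a Parigot numeral ρ_q with t ≡ q, up to congruence of the terms in it
(`Proves.termCongr_of_nat`).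

If f(p) = r, soundness of predicate logic for the term model gives r ≡ F₀(p) (`Specifies.tmEq`). So
q ≡ t ≡ F₀(p) ≡ r, and congruent numerals are equal (`num_inj`). The extracted program reduces to
the opening of the normal proof above, which discards τ. -/

theorem Tm.subst_subst (σ τ : ℕ → Tm Ω) (t : Tm Ω) :
    (t.subst σ).subst τ = t.subst (fun n => (σ n).subst τ) := by
  induction t <;> simp_all [Tm.subst]

theorem Tm.subst_var (t : Tm Ω) : t.subst .var = t := by
  induction t <;> simp_all [Tm.subst]

namespace Sub

theorem ext {s s' : Sub Ω K} (h : ∀ n, s.tm n = s'.tm n) (h' : ∀ n, s.cl n = s'.cl n) :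
    s = s' := by
  cases s; cases s'; simp only [mk.injEq]; exact ⟨funext h, funext h'⟩

/-- The identity substitution. -/
protected def id : Sub Ω K := ⟨.var, .var⟩

/-- The substitution `s` followed by `s'`. -/
def comp (s s' : Sub Ω K) : Sub Ω K :=
  ⟨fun n => (s.tm n).subst s'.tm, fun n => (s.cl n).subst s'⟩

end Sub

theorem Cl.subst_subst (s s' : Sub Ω K) (c : Cl Ω K) :
    (c.subst s).subst s' = c.subst (s.comp s') := by
  induction c <;> simp_all [Cl.subst, Sub.comp, Tm.subst_subst]

theorem Cl.subst_id (c : Cl Ω K) : c.subst Sub.id = c := by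
  induction c <;> simp_all [Cl.subst, Sub.id, Tm.subst_var]

namespace Sub

theorem shiftI_comp_liftI (s : Sub Ω K) : (shiftI 1).comp s.liftI = s.comp (shiftI 1) :=
  ext (fun _ => rfl) (fun _ => rfl)

theorem shiftK_comp_liftK (s : Sub Ω K) : shiftK.comp s.liftK = s.comp shiftK :=
  ext (fun _ => (Tm.subst_var _).symm) (fun _ => rfl)

theorem liftI_comp (s s' : Sub Ω K) : (s.comp s').liftI = s.liftI.comp s'.liftI := by
  refine ext (fun n => ?_) (fun n => ?_)
  · cases n with
    | zero => rfl
    | succ n =>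
      exact (Tm.subst_subst _ _ _).trans
        (Tm.subst_subst (fun i => .var (i + 1)) s'.liftI.tm (s.tm n)).symm
  · exact (Cl.subst_subst _ _ _).trans ((congrArg (Cl.subst · (s.cl n))
      (shiftI_comp_liftI s').symm).trans (Cl.subst_subst _ _ _).symm)

theorem liftK_comp (s s' : Sub Ω K) : (s.comp s').liftK = s.liftK.comp s'.liftK := by
  refine ext (fun _ => rfl) (fun n => ?_)
  cases n with
  | zero => rfl
  | succ n =>
    exact (Cl.subst_subst _ _ _).trans ((congrArg (Cl.subst · (s.cl n))
      (shiftK_comp_liftK s').symm).trans (Cl.subst_subst _ _ _).symm)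

theorem liftI_id : (Sub.id : Sub Ω K).liftI = Sub.id :=
  ext (fun n => by cases n <;> rfl) (fun _ => rfl)

theorem liftK_id : (Sub.id : Sub Ω K).liftK = Sub.id :=
  ext (fun _ => rfl) (fun n => by cases n <;> rfl)

theorem shiftI_comp_instI (t : Tm Ω) : (shiftI 1).comp (instI t) = (Sub.id : Sub Ω K) :=
  ext (fun _ => rfl) (fun _ => rfl)

theorem shiftK_comp_instK (c : Cl Ω K) : shiftK.comp (instK c) = Sub.id :=
  ext (fun _ => rfl) (fun _ => rfl)

/-- Extension of a substitution by a value for the innermost variable of sort `ι`. -/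
def consI (t : Tm Ω) (s : Sub Ω K) : Sub Ω K where
  tm n := match n with
    | 0 => t
    | n + 1 => s.tm n
  cl := s.cl

/-- Extension of a substitution by a value for the innermost variable of sort `κ`. -/
def consK (c : Cl Ω K) (s : Sub Ω K) : Sub Ω K where
  tm := s.tm
  cl n := match n with
    | 0 => c
    | n + 1 => s.cl n

/-- Lifting weakens every value of `s` and instantiation undoes the weakening, so only the new value
t remains to be recorded. -/
theorem liftI_comp_instI (s : Sub Ω K) (t : Tm Ω) : s.liftI.comp (instI t) = consI t s := by
  refine ext (fun n => ?_) (fun n => ?_)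
  · cases n with
    | zero => rfl
    | succ n => exact (Tm.subst_subst _ _ _).trans (Tm.subst_var _)
  · exact (Cl.subst_subst _ _ _).trans (by rw [shiftI_comp_instI]; exact Cl.subst_id _)

theorem liftK_comp_instK (s : Sub Ω K) (c : Cl Ω K) : s.liftK.comp (instK c) = consK c s := by
  refine ext (fun _ => Tm.subst_var _) (fun n => ?_)
  cases n with
  | zero => rfl
  | succ n =>
    exact (Cl.subst_subst _ _ _).trans (by rw [shiftK_comp_instK]; exact Cl.subst_id _)

/-- The substitution lemma A(t/x)s = (As)(ts/x), as an identity between substitutions. It makes cuts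
and quantifier rules stable under substitution of terms. -/
theorem instI_comp (t : Tm Ω) (s : Sub Ω K) :
    (instI t).comp s = s.liftI.comp (instI (t.subst s.tm)) := by
  rw [liftI_comp_instI]
  exact ext (fun n => by cases n <;> rfl) (fun _ => rfl)

theorem instK_comp (c : Cl Ω K) (s : Sub Ω K) :
    (instK c).comp s = s.liftK.comp (instK (c.subst s)) := by
  rw [liftK_comp_instK]
  exact ext (fun _ => rfl) (fun n => by cases n <;> rfl)

end Sub

theorem Fm.subst_subst (s s' : Sub Ω K) (A : Fm Ω K) :
    (A.subst s).subst s' = A.subst (s.comp s') := by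
  induction A generalizing s s' <;>
    simp_all [Fm.subst, Tm.subst_subst, Cl.subst_subst, Sub.liftI_comp, Sub.liftK_comp] <;>
    simp [Sub.comp]

theorem Fm.subst_id (A : Fm Ω K) : A.subst Sub.id = A := by
  induction A <;> simp_all [Fm.subst, Cl.subst_id, Sub.liftI_id, Sub.liftK_id] <;>
    simp [Sub.id, Tm.subst_var]

namespace Pf

theorem tsubst_tsubst (s s' : Sub Ω K) (a : Pf Ω K) :
    (a.tsubst s).tsubst s' = a.tsubst (s.comp s') := by
  induction a generalizing s s' <;>
    simp_all [tsubst, Tm.subst_subst, Cl.subst_subst, Sub.liftI_comp, Sub.liftK_comp] <;>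
    simp [Sub.comp]

theorem tsubst_id (a : Pf Ω K) : a.tsubst Sub.id = a := by
  induction a <;> simp_all [tsubst, Cl.subst_id, Sub.liftI_id, Sub.liftK_id] <;>
    simp [Sub.id, Tm.subst_var]

theorem rename_tsubst (ξ : ℕ → ℕ) (s : Sub Ω K) (a : Pf Ω K) :
    (a.rename ξ).tsubst s = (a.tsubst s).rename ξ := by
  induction a generalizing s ξ <;> simp_all [tsubst, rename]

theorem lift_var : lift (fun n => (.var n : Pf Ω K)) = .var := by
  funext n; cases n <;> rfl

theorem lift_comp_liftRen (θ : ℕ → Pf Ω K) (ξ : ℕ → ℕ) :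
    (fun n => lift θ (liftRen ξ n)) = lift (fun n => θ (ξ n)) := by
  funext n; cases n <;> rfl

/-- Renaming cannot be defined from substitution, because lifting a substitution already renames.
Once the two are identified, the laws of renaming follow from those of substitution. -/
theorem rename_eq_subst (ξ : ℕ → ℕ) (a : Pf Ω K) :
    a.rename ξ = a.subst (fun n => .var (ξ n)) := by
  have h (ξ : ℕ → ℕ) : lift (fun n => (.var (ξ n) : Pf Ω K)) = fun n => .var (liftRen ξ n) := by
    funext n; cases n <;> rfl
  have h₁ (ξ : ℕ → ℕ) : liftI (fun n => (.var (ξ n) : Pf Ω K)) = fun n => .var (ξ n) := rfl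
  have h₂ (ξ : ℕ → ℕ) : liftK (fun n => (.var (ξ n) : Pf Ω K)) = fun n => .var (ξ n) := rfl
  induction a generalizing ξ <;> simp_all [subst, rename]

theorem subst_var (a : Pf Ω K) : a.subst .var = a := by
  have h₁ : liftI (.var : ℕ → Pf Ω K) = .var := rfl
  have h₂ : liftK (.var : ℕ → Pf Ω K) = .var := rfl
  have h : lift (.var : ℕ → Pf Ω K) = .var := lift_var
  induction a <;> simp_all [subst]

theorem subst_rename (ξ : ℕ → ℕ) (θ : ℕ → Pf Ω K) (a : Pf Ω K) :
    (a.rename ξ).subst θ = a.subst (fun n => θ (ξ n)) := by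
  have h₁ (θ : ℕ → Pf Ω K) (ξ : ℕ → ℕ) :
    (fun n => liftI θ (ξ n)) = liftI (fun n => θ (ξ n)) := rfl
  have h₂ (θ : ℕ → Pf Ω K) (ξ : ℕ → ℕ) :
    (fun n => liftK θ (ξ n)) = liftK (fun n => θ (ξ n)) := rfl
  induction a generalizing ξ θ <;> simp_all [subst, rename, lift_comp_liftRen]

theorem rename_rename (ξ ζ : ℕ → ℕ) (a : Pf Ω K) :
    (a.rename ξ).rename ζ = a.rename (fun n => ζ (ξ n)) := by
  rw [rename_eq_subst ζ, subst_rename, ← rename_eq_subst]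

theorem rename_subst (ξ : ℕ → ℕ) (θ : ℕ → Pf Ω K) (a : Pf Ω K) :
    (a.subst θ).rename ξ = a.subst (fun n => (θ n).rename ξ) := by
  have h (θ : ℕ → Pf Ω K) (ξ : ℕ → ℕ) :
      (fun n => (lift θ n).rename (liftRen ξ)) = lift (fun n => (θ n).rename ξ) := by
    funext n
    cases n with
    | zero => rfl
    | succ n => simp only [lift, rename_rename]; rfl
  have h₁ (θ : ℕ → Pf Ω K) (ξ : ℕ → ℕ) :
      (fun n => (liftI θ n).rename ξ) = liftI (fun n => (θ n).rename ξ) := by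
    funext n; simp [liftI, rename_tsubst]
  have h₂ (θ : ℕ → Pf Ω K) (ξ : ℕ → ℕ) :
      (fun n => (liftK θ n).rename ξ) = liftK (fun n => (θ n).rename ξ) := by
    funext n; simp [liftK, rename_tsubst]
  induction a generalizing ξ θ <;> simp_all [subst, rename]

theorem lift_tsubst (θ : ℕ → Pf Ω K) (s : Sub Ω K) :
    lift (fun n => (θ n).tsubst s) = fun n => (lift θ n).tsubst s := by
  funext n
  cases n with
  | zero => rfl
  | succ n => simp only [lift, rename_tsubst]

theorem liftI_tsubst (θ : ℕ → Pf Ω K) (s : Sub Ω K) :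
    liftI (fun n => (θ n).tsubst s) = fun n => (liftI θ n).tsubst s.liftI := by
  funext n; simp only [liftI, tsubst_tsubst, Sub.shiftI_comp_liftI]

theorem liftK_tsubst (θ : ℕ → Pf Ω K) (s : Sub Ω K) :
    liftK (fun n => (θ n).tsubst s) = fun n => (liftK θ n).tsubst s.liftK := by
  funext n; simp only [liftK, tsubst_tsubst, Sub.shiftK_comp_liftK]

theorem subst_tsubst (θ : ℕ → Pf Ω K) (s : Sub Ω K) (a : Pf Ω K) :
    (a.subst θ).tsubst s = (a.tsubst s).subst (fun n => (θ n).tsubst s) := by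
  induction a generalizing θ s <;>
    simp_all [subst, tsubst, lift_tsubst, liftI_tsubst, liftK_tsubst]

theorem lift_subst (θ θ' : ℕ → Pf Ω K) :
    lift (fun n => (θ n).subst θ') = fun n => (lift θ n).subst (lift θ') := by
  funext n
  cases n with
  | zero => rfl
  | succ n => simp only [lift, rename_subst, subst_rename]

theorem liftI_subst (θ θ' : ℕ → Pf Ω K) :
    liftI (fun n => (θ n).subst θ') = fun n => (liftI θ n).subst (liftI θ') := by
  funext n; simp only [liftI, subst_tsubst]; rfl

theorem liftK_subst (θ θ' : ℕ → Pf Ω K) :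
    liftK (fun n => (θ n).subst θ') = fun n => (liftK θ n).subst (liftK θ') := by
  funext n; simp only [liftK, subst_tsubst]; rfl

theorem subst_subst (θ θ' : ℕ → Pf Ω K) (a : Pf Ω K) :
    (a.subst θ).subst θ' = a.subst (fun n => (θ n).subst θ') := by
  induction a generalizing θ θ' <;> simp_all [subst, lift_subst, liftI_subst, liftK_subst]

/-- Extension of a substitution by a value for the innermost proof variable. -/
def cons (b : Pf Ω K) (θ : ℕ → Pf Ω K) : ℕ → Pf Ω K
  | 0 => b
  | n + 1 => θ n

theorem inst_eq (b a : Pf Ω K) : inst b a = a.subst (cons b .var) := by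
  unfold inst; congr 1

/-- The form in which a contracted cut meets an induction hypothesis: substituting under the binder
and then filling the bound variable is one extended substitution. -/
theorem inst_subst_lift (b : Pf Ω K) (θ : ℕ → Pf Ω K) (a : Pf Ω K) :
    inst b (a.subst (lift θ)) = a.subst (cons b θ) := by
  rw [inst_eq, subst_subst]
  congr 1; funext n
  cases n with
  | zero => rfl
  | succ n => simp only [lift, subst_rename, cons]; exact subst_var _

theorem inst_subst (θ : ℕ → Pf Ω K) (b a : Pf Ω K) :
    (inst b a).subst θ = inst (b.subst θ) (a.subst (lift θ)) := by
  rw [inst_subst_lift, inst_eq, subst_subst]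
  congr 1; funext n; cases n <;> rfl

theorem inst_tsubst (s : Sub Ω K) (b a : Pf Ω K) :
    (inst b a).tsubst s = inst (b.tsubst s) (a.tsubst s) := by
  rw [inst_eq, inst_eq, subst_tsubst]
  congr 1; funext n; cases n <;> rfl

/-- Under the binder the values of θ are weakened, hence do not mention the instantiated variable,
and the two substitutions commute. -/
theorem subst_liftI_tsubst_instI (θ : ℕ → Pf Ω K) (t : Tm Ω) (a : Pf Ω K) :
    (a.subst (liftI θ)).tsubst (Sub.instI t) = (a.tsubst (Sub.instI t)).subst θ := by
  rw [subst_tsubst]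
  congr 1; funext n
  simp only [liftI, tsubst_tsubst, Sub.shiftI_comp_instI, tsubst_id]

theorem subst_liftK_tsubst_instK (θ : ℕ → Pf Ω K) (c : Cl Ω K) (a : Pf Ω K) :
    (a.subst (liftK θ)).tsubst (Sub.instK c) = (a.tsubst (Sub.instK c)).subst θ := by
  rw [subst_tsubst]
  congr 1; funext n
  simp only [liftK, tsubst_tsubst, Sub.shiftK_comp_instK, tsubst_id]

end Pf

/-! ## Reduction -/

namespace Pf

variable {Ω : Sig} {K : ClassSig}

theorem Red.tsubst {a b : Pf Ω K} (h : Red a b) (s : Sub Ω K) : Red (a.tsubst s) (b.tsubst s) := by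
  induction h generalizing s with
  | betaI a t =>
    rw [tsubst_tsubst, Sub.instI_comp, ← tsubst_tsubst]; exact .betaI _ _
  | betaK a c =>
    rw [tsubst_tsubst, Sub.instK_comp, ← tsubst_tsubst]; exact .betaK _ _
  | unpackPackI t a b =>
    rw [inst_tsubst, tsubst_tsubst, Sub.instI_comp, ← tsubst_tsubst]; exact .unpackPackI _ _ _
  | unpackPackK c a b =>
    rw [inst_tsubst, tsubst_tsubst, Sub.instK_comp, ← tsubst_tsubst]; exact .unpackPackK _ _ _
  | caseInl a b c => rw [inst_tsubst]; exact .caseInl _ _ _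
  | caseInr a b c => rw [inst_tsubst]; exact .caseInr _ _ _
  | beta a b => rw [inst_tsubst]; exact .beta _ _
  | _ => simp only [Pf.tsubst]; constructor <;> solve_by_elim

theorem Red.subst {a b : Pf Ω K} (h : Red a b) (θ : ℕ → Pf Ω K) : Red (a.subst θ) (b.subst θ) := by
  induction h generalizing θ with
  | betaI a t => rw [← subst_liftI_tsubst_instI]; exact .betaI _ _
  | betaK a c => rw [← subst_liftK_tsubst_instK]; exact .betaK _ _
  | unpackPackI t a b =>
    rw [inst_subst, ← subst_liftI_tsubst_instI]
    -- The two variables bound here belong to independent families of indices, so the order of the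
    -- liftings is immaterial.
    have h : liftI (lift θ) = lift (liftI θ) := by
      funext n; cases n <;> simp [liftI, lift, Pf.tsubst, rename_tsubst]
    rw [h]; exact .unpackPackI _ _ _
  | unpackPackK c a b =>
    rw [inst_subst, ← subst_liftK_tsubst_instK]
    have h : liftK (lift θ) = lift (liftK θ) := by
      funext n; cases n <;> simp [liftK, lift, Pf.tsubst, rename_tsubst]
    rw [h]; exact .unpackPackK _ _ _
  | caseInl a b c => rw [inst_subst]; exact .caseInl _ _ _
  | caseInr a b c => rw [inst_subst]; exact .caseInr _ _ _
  | beta a b => rw [inst_subst]; exact .beta _ _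
  | _ => simp only [Pf.subst]; constructor <;> solve_by_elim

/-- Reduction in any number of steps. -/
abbrev Reds : Pf Ω K → Pf Ω K → Prop := Relation.ReflTransGen Red

namespace Reds

open Relation ReflTransGen

theorem map {a b : Pf Ω K} (F : Pf Ω K → Pf Ω K) (hF : ∀ {x y}, Red x y → Red (F x) (F y))
    (h : Reds a b) : Reds (F a) (F b) := h.lift F fun _ _ => hF

theorem map₂ {a a' b b' : Pf Ω K} (F : Pf Ω K → Pf Ω K → Pf Ω K)
    (h₁ : ∀ {x x' y}, Red x x' → Red (F x y) (F x' y))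
    (h₂ : ∀ {x y y'}, Red y y' → Red (F x y) (F x y'))
    (h : Reds a a') (h' : Reds b b') : Reds (F a b) (F a' b') :=
  (h.map (F · b) h₁).trans (h'.map (F a') h₂)

theorem tsubst {a b : Pf Ω K} (h : Reds a b) (s : Sub Ω K) : Reds (a.tsubst s) (b.tsubst s) :=
  h.map (Pf.tsubst s) fun h => h.tsubst s

theorem subst {a b : Pf Ω K} (h : Reds a b) (θ : ℕ → Pf Ω K) : Reds (a.subst θ) (b.subst θ) :=
  h.map (Pf.subst θ) fun h => h.subst θ

theorem rename {a b : Pf Ω K} (h : Reds a b) (ξ : ℕ → ℕ) : Reds (a.rename ξ) (b.rename ξ) := by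
  simpa only [rename_eq_subst] using h.subst _

theorem lift {θ θ' : ℕ → Pf Ω K} (h : ∀ n, Reds (θ n) (θ' n)) (n : ℕ) :
    Reds (lift θ n) (lift θ' n) := by
  cases n with
  | zero => exact .refl
  | succ n => exact (h n).rename _

/-- Several steps, or none, may be needed: a variable can have any number of occurrences in `a`.
This is why confluence is only proved locally. -/
theorem subst_arg {θ θ' : ℕ → Pf Ω K} (h : ∀ n, Reds (θ n) (θ' n)) (a : Pf Ω K) :
    Reds (a.subst θ) (a.subst θ') := by
  induction a generalizing θ θ' with
  | var n => exact h n
  | triv => exact .refl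
  | botE a iha => exact (iha h).map .botE .botE
  | pair a b iha ihb => exact map₂ .pair .pairL .pairR (iha h) (ihb h)
  | fst a iha => exact (iha h).map .fst .fst
  | snd a iha => exact (iha h).map .snd .snd
  | inl a iha => exact (iha h).map .inl .inl
  | inr a iha => exact (iha h).map .inr .inr
  | case a b c iha ihb ihc =>
    exact (map₂ (fun x y => .case x y _) .case₁ .case₂ (iha h) (ihb (lift h))).trans
      ((ihc (lift h)).map (.case _ _) .case₃)
  | lam a iha => exact (iha (lift h)).map .lam .lam
  | app a b iha ihb => exact map₂ .app .appL .appR (iha h) (ihb h)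
  | lamI a iha => exact (iha fun n => (h n).tsubst _).map .lamI .lamI
  | appI a t iha => exact (iha h).map (.appI · t) .appI
  | lamK a iha => exact (iha fun n => (h n).tsubst _).map .lamK .lamK
  | appK a c iha => exact (iha h).map (.appK · c) .appK
  | packI t a iha => exact (iha h).map (.packI t) .packI
  | unpackI a b iha ihb =>
    exact map₂ .unpackI .unpackIL .unpackIR (iha h) (ihb (lift fun n => (h n).tsubst _))
  | packK c a iha => exact (iha h).map (.packK c) .packK
  | unpackK a b iha ihb =>
    exact map₂ .unpackK .unpackKL .unpackKR (iha h) (ihb (lift fun n => (h n).tsubst _))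

theorem inst {a a' b b' : Pf Ω K} (h : Reds a a') (h' : Reds b b') :
    Reds (inst a b) (inst a' b') := by
  rw [inst_eq, inst_eq]
  refine (h'.subst _).trans (subst_arg (fun n => ?_) _)
  cases n with
  | zero => exact h
  | succ n => exact .refl

end Reds

/-! ### Local confluence -/

open Relation

/-- `a` and `b` have a common reduct. -/
def Joinable (a b : Pf Ω K) : Prop := ∃ d, Reds a d ∧ Reds b d

namespace Joinable

theorem refl (a : Pf Ω K) : Joinable a a := ⟨a, .refl, .refl⟩

theorem symm {a b : Pf Ω K} : Joinable a b → Joinable b a := fun ⟨d, h, h'⟩ => ⟨d, h', h⟩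

theorem map {a b : Pf Ω K} (F : Pf Ω K → Pf Ω K) (hF : ∀ {x y}, Red x y → Red (F x) (F y)) :
    Joinable a b → Joinable (F a) (F b) := fun ⟨d, h, h'⟩ => ⟨F d, h.map F hF, h'.map F hF⟩

theorem of_red {a b d : Pf Ω K} (h : Red a d) (h' : Red b d) : Joinable a b :=
  ⟨d, .single h, .single h'⟩

theorem of_reds {a b d : Pf Ω K} (h : Reds a d) (h' : Red b d) : Joinable a b :=
  ⟨d, h, .single h'⟩

/-- This lemma and the following ones treat the critical pairs: a contracted cut against any other
step from the same cut. A step inside the cut is reproduced, erased or duplicated in the contractum,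
and the cut can still be contracted after it. -/
theorem fstPair {a b d : Pf Ω K} (h : Red (.fst (.pair a b)) d) : Joinable a d := by
  cases h with
  | fstPair => exact .refl _
  | fst h => cases h with
    | pairL h => exact .of_red h (.fstPair _ _)
    | pairR h => exact .of_reds .refl (.fstPair _ _)

theorem sndPair {a b d : Pf Ω K} (h : Red (.snd (.pair a b)) d) : Joinable b d := by
  cases h with
  | sndPair => exact .refl _
  | snd h => cases h with
    | pairL h => exact .of_reds .refl (.sndPair _ _)
    | pairR h => exact .of_red h (.sndPair _ _)

theorem caseInl {a b c d : Pf Ω K} (h : Red (.case (.inl a) b c) d) :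
    Joinable (inst a b) d := by
  cases h with
  | caseInl => exact .refl _
  | case₁ h => cases h with
    | inl h => exact .of_reds (.inst (.single h) .refl) (.caseInl _ _ _)
  | case₂ h => exact .of_reds (.inst .refl (.single h)) (.caseInl _ _ _)
  | case₃ h => exact .of_reds .refl (.caseInl _ _ _)

theorem caseInr {a b c d : Pf Ω K} (h : Red (.case (.inr a) b c) d) :
    Joinable (inst a c) d := by
  cases h with
  | caseInr => exact .refl _
  | case₁ h => cases h with
    | inr h => exact .of_reds (.inst (.single h) .refl) (.caseInr _ _ _)
  | case₂ h => exact .of_reds .refl (.caseInr _ _ _)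
  | case₃ h => exact .of_reds (.inst .refl (.single h)) (.caseInr _ _ _)

theorem beta {a b d : Pf Ω K} (h : Red (.app (.lam a) b) d) : Joinable (inst b a) d := by
  cases h with
  | beta => exact .refl _
  | appL h => cases h with
    | lam h => exact .of_reds (.inst .refl (.single h)) (.beta _ _)
  | appR h => exact .of_reds (.inst (.single h) .refl) (.beta _ _)

theorem betaI {a d : Pf Ω K} {t : Tm Ω} (h : Red (.appI (.lamI a) t) d) :
    Joinable (a.tsubst (Sub.instI t)) d := by
  cases h with
  | betaI => exact .refl _
  | appI h => cases h with
    | lamI h => exact .of_red (h.tsubst _) (.betaI _ _)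

theorem betaK {a d : Pf Ω K} {c : Cl Ω K} (h : Red (.appK (.lamK a) c) d) :
    Joinable (a.tsubst (Sub.instK c)) d := by
  cases h with
  | betaK => exact .refl _
  | appK h => cases h with
    | lamK h => exact .of_red (h.tsubst _) (.betaK _ _)

theorem unpackPackI {t : Tm Ω} {a b d : Pf Ω K} (h : Red (.unpackI (.packI t a) b) d) :
    Joinable (inst a (b.tsubst (Sub.instI t))) d := by
  cases h with
  | unpackPackI => exact .refl _
  | unpackIL h => cases h with
    | packI h => exact .of_reds (.inst (.single h) .refl) (.unpackPackI _ _ _)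
  | unpackIR h => exact .of_reds (.inst .refl (.single (h.tsubst _))) (.unpackPackI _ _ _)

theorem unpackPackK {c : Cl Ω K} {a b d : Pf Ω K} (h : Red (.unpackK (.packK c a) b) d) :
    Joinable (inst a (b.tsubst (Sub.instK c))) d := by
  cases h with
  | unpackPackK => exact .refl _
  | unpackKL h => cases h with
    | packK h => exact .of_reds (.inst (.single h) .refl) (.unpackPackK _ _ _)
  | unpackKR h => exact .of_reds (.inst .refl (.single (h.tsubst _))) (.unpackPackK _ _ _)

end Joinable

/-- Reduction is locally confluent. -/
theorem Red.joinable {a b c : Pf Ω K} (h : Red a b) (h' : Red a c) : Joinable b c := by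
  induction h generalizing c with
  | fstPair => exact .fstPair h'
  | sndPair => exact .sndPair h'
  | caseInl => exact .caseInl h'
  | caseInr => exact .caseInr h'
  | beta => exact .beta h'
  | betaI => exact .betaI h'
  | betaK => exact .betaK h'
  | unpackPackI => exact .unpackPackI h'
  | unpackPackK => exact .unpackPackK h'
  | botE h ih => cases h' with
    | botE h' => exact (ih h').map .botE .botE
  | pairL h ih => cases h' with
    | pairL h' => exact (ih h').map (.pair · _) .pairL
    | pairR h' => exact .of_red (.pairR h') (.pairL h)
  | pairR h ih => cases h' with
    | pairL h' => exact .of_red (.pairL h') (.pairR h)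
    | pairR h' => exact (ih h').map (.pair _) .pairR
  | fst h ih => cases h' with
    | fst h' => exact (ih h').map .fst .fst
    -- The same critical pair, with the roles of the two steps exchanged; likewise for the other
    -- cuts below.
    | fstPair => exact (Joinable.fstPair (.fst h)).symm
  | snd h ih => cases h' with
    | snd h' => exact (ih h').map .snd .snd
    | sndPair => exact (Joinable.sndPair (.snd h)).symm
  | inl h ih => cases h' with
    | inl h' => exact (ih h').map .inl .inl
  | inr h ih => cases h' with
    | inr h' => exact (ih h').map .inr .inr
  | case₁ h ih => cases h' with
    | case₁ h' => exact (ih h').map (.case · _ _) .case₁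
    | case₂ h' => exact .of_red (.case₂ h') (.case₁ h)
    | case₃ h' => exact .of_red (.case₃ h') (.case₁ h)
    | caseInl => exact (Joinable.caseInl (.case₁ h)).symm
    | caseInr => exact (Joinable.caseInr (.case₁ h)).symm
  | case₂ h ih => cases h' with
    | case₁ h' => exact .of_red (.case₁ h') (.case₂ h)
    | case₂ h' => exact (ih h').map (.case _ · _) .case₂
    | case₃ h' => exact .of_red (.case₃ h') (.case₂ h)
    | caseInl => exact (Joinable.caseInl (.case₂ h)).symm
    | caseInr => exact (Joinable.caseInr (.case₂ h)).symm
  | case₃ h ih => cases h' with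
    | case₁ h' => exact .of_red (.case₁ h') (.case₃ h)
    | case₂ h' => exact .of_red (.case₂ h') (.case₃ h)
    | case₃ h' => exact (ih h').map (.case _ _) .case₃
    | caseInl => exact (Joinable.caseInl (.case₃ h)).symm
    | caseInr => exact (Joinable.caseInr (.case₃ h)).symm
  | lam h ih => cases h' with
    | lam h' => exact (ih h').map .lam .lam
  | appL h ih => cases h' with
    | appL h' => exact (ih h').map (.app · _) .appL
    | appR h' => exact .of_red (.appR h') (.appL h)
    | beta => exact (Joinable.beta (.appL h)).symm
  | appR h ih => cases h' with
    | appL h' => exact .of_red (.appL h') (.appR h)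
    | appR h' => exact (ih h').map (.app _) .appR
    | beta => exact (Joinable.beta (.appR h)).symm
  | lamI h ih => cases h' with
    | lamI h' => exact (ih h').map .lamI .lamI
  | appI h ih => cases h' with
    | appI h' => exact (ih h').map (.appI · _) .appI
    | betaI => exact (Joinable.betaI (.appI h)).symm
  | lamK h ih => cases h' with
    | lamK h' => exact (ih h').map .lamK .lamK
  | appK h ih => cases h' with
    | appK h' => exact (ih h').map (.appK · _) .appK
    | betaK => exact (Joinable.betaK (.appK h)).symm
  | packI h ih => cases h' with
    | packI h' => exact (ih h').map (.packI _) .packI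
  | unpackIL h ih => cases h' with
    | unpackIL h' => exact (ih h').map (.unpackI · _) .unpackIL
    | unpackIR h' => exact .of_red (.unpackIR h') (.unpackIL h)
    | unpackPackI => exact (Joinable.unpackPackI (.unpackIL h)).symm
  | unpackIR h ih => cases h' with
    | unpackIL h' => exact .of_red (.unpackIL h') (.unpackIR h)
    | unpackIR h' => exact (ih h').map (.unpackI _) .unpackIR
    | unpackPackI => exact (Joinable.unpackPackI (.unpackIR h)).symm
  | packK h ih => cases h' with
    | packK h' => exact (ih h').map (.packK _) .packK
  | unpackKL h ih => cases h' with
    | unpackKL h' => exact (ih h').map (.unpackK · _) .unpackKL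
    | unpackKR h' => exact .of_red (.unpackKR h') (.unpackKL h)
    | unpackPackK => exact (Joinable.unpackPackK (.unpackKL h)).symm
  | unpackKR h ih => cases h' with
    | unpackKL h' => exact .of_red (.unpackKL h') (.unpackKR h)
    | unpackKR h' => exact (ih h').map (.unpackK _) .unpackKR
    | unpackPackK => exact (Joinable.unpackPackK (.unpackKR h)).symm

/-! ### Existence and uniqueness of normal forms -/

theorem StronglyNormalizing.red {a b : Pf Ω K} (h : a.StronglyNormalizing) (hab : Red a b) :
    b.StronglyNormalizing := Acc.inv h hab

theorem StronglyNormalizing.reds {a b : Pf Ω K} (h : a.StronglyNormalizing) (hab : Reds a b) :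
    b.StronglyNormalizing := by
  induction hab with
  | refl => exact h
  | tail _ h' ih => exact ih.red h'

theorem StronglyNormalizing.exists_normal {a : Pf Ω K} (h : a.StronglyNormalizing) :
    ∃ b, Reds a b ∧ Normal b := by
  induction h with
  | intro a _ ih =>
    by_cases hn : Normal a
    · exact ⟨a, .refl, hn⟩
    · simp only [Normal, not_forall, not_not] at hn
      obtain ⟨b, hb⟩ := hn
      obtain ⟨c, hc, hcn⟩ := ih b hb
      exact ⟨c, .head hb hc, hcn⟩

/-- A strongly normalizing proof-term has at most one normal form (Newman's lemma). -/
theorem StronglyNormalizing.normal_unique {a : Pf Ω K} (h : a.StronglyNormalizing) {b c : Pf Ω K}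
    (hb : Reds a b) (hbn : Normal b) (hc : Reds a c) (hcn : Normal c) : b = c := by
  induction h generalizing b c with
  | intro a ha ih =>
    rcases hb.cases_head with rfl | ⟨b₁, h₁, h₁b⟩
    · rcases hc.cases_head with rfl | ⟨c₁, h₂, _⟩
      · rfl
      · exact absurd h₂ (hbn _)
    · rcases hc.cases_head with rfl | ⟨c₁, h₂, h₂c⟩
      · exact absurd h₁ (hcn _)
      -- The two first steps have a common reduct d; a normal form e of d is identified with b by
      -- the induction hypothesis at b₁ and with c by the one at c₁.
      · obtain ⟨d, hd₁, hd₂⟩ := h₁.joinable h₂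
        obtain ⟨e, he, hen⟩ := ((show StronglyNormalizing b₁ from ha _ h₁).reds hd₁).exists_normal
        exact (ih _ h₁ h₁b hbn (hd₁.trans he) hen).trans
          (ih _ h₂ (hd₂.trans he) hen h₂c hcn)

theorem StronglyNormalizing.isNormalForm {a b : Pf Ω K} (h : a.StronglyNormalizing)
    (hb : Reds a b) (hbn : Normal b) : a.IsNormalForm b :=
  ⟨hb, hbn, fun _ hc hcn => h.normal_unique hc hcn hb hbn⟩

end Pf

/-! ## Reducibility candidates -/

open Pf

variable {Ω : Sig} {K : ClassSig}

/-- The last rule of the proof-term is an introduction rule. -/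
def Pf.IsIntro : Pf Ω K → Prop
  | .triv | .pair _ _ | .inl _ | .inr _ | .lam _ | .lamI _ | .lamK _ | .packI _ _ | .packK _ _ =>
    True
  | _ => False

namespace Pf.StronglyNormalizing

/-- An infinite reduction from `a` would be carried step by step to one from `F a`. Applied to
substitutions, this removes any instantiation used to test reducibility. -/
theorem of_map (F : Pf Ω K → Pf Ω K) (hF : ∀ {x y}, Red x y → Red (F x) (F y)) {a : Pf Ω K}
    (h : (F a).StronglyNormalizing) : a.StronglyNormalizing := by
  generalize hb : F a = b at h
  induction h generalizing a with
  | intro b _ ih => exact ⟨_, fun c hc => ih (F c) (hb ▸ hF hc) rfl⟩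

theorem of_subst {θ : ℕ → Pf Ω K} {a : Pf Ω K} (h : (a.subst θ).StronglyNormalizing) :
    a.StronglyNormalizing := h.of_map (Pf.subst θ) fun h => h.subst θ

theorem of_tsubst {s : Sub Ω K} {a : Pf Ω K} (h : (a.tsubst s).StronglyNormalizing) :
    a.StronglyNormalizing := h.of_map (Pf.tsubst s) fun h => h.tsubst s

/-- The converse transfer, for a constructor that creates no cut of its own: all reductions take
place in the argument. -/
theorem map (F : Pf Ω K → Pf Ω K) (hF : ∀ x z, Red (F x) z → ∃ y, z = F y ∧ Red x y)
    {a : Pf Ω K} (h : a.StronglyNormalizing) : (F a).StronglyNormalizing := by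
  induction h with
  | intro a _ ih =>
    refine ⟨_, fun c hc => ?_⟩
    obtain ⟨y, rfl, hy⟩ := hF _ _ hc
    exact ih y hy

end Pf.StronglyNormalizing

/-- A reducibility candidate. -/
structure Cand (Ω : Sig) (K : ClassSig) where
  carrier : Set (Pf Ω K)
  sn : ∀ {a}, a ∈ carrier → a.StronglyNormalizing
  red : ∀ {a b}, a ∈ carrier → Red a b → b ∈ carrier
  neutral : ∀ {a}, ¬ a.IsIntro → (∀ b, Red a b → b ∈ carrier) → a ∈ carrier

namespace Cand

instance : SetLike (Cand Ω K) (Pf Ω K) where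
  coe := carrier
  coe_injective A B h := by cases A; cases B; congr

instance : PartialOrder (Cand Ω K) := PartialOrder.ofSetLike (Cand Ω K) (Pf Ω K)

theorem mem_of_reds {A : Cand Ω K} {a b : Pf Ω K} (h : a ∈ A) (hab : Reds a b) : b ∈ A := by
  induction hab with
  | refl => exact h
  | tail _ h' ih => exact A.red ih h'

theorem var_mem (A : Cand Ω K) (n : ℕ) : .var n ∈ A :=
  A.neutral (fun h => h) fun _ h => nomatch h

/-- The strongly normalizing proof-terms whose reducts that are introductions satisfy `P`. -/
def ofIntro (P : Pf Ω K → Prop) : Cand Ω K where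
  carrier := {a | a.StronglyNormalizing ∧ ∀ b, Reds a b → b.IsIntro → P b}
  sn h := h.1
  red h hab := ⟨h.1.red hab, fun c hc => h.2 c (.head hab hc)⟩
  neutral {a} hn h := ⟨⟨_, fun b hb => (h b hb).1⟩, fun b hb hi => by
    rcases hb.cases_head with rfl | ⟨c, hc, hcb⟩
    · exact absurd hi hn
    · exact (h c hc).2 b hcb hi⟩

/-- Reducibility of a unary introduction: its reducts are the same introduction applied to reducts
of the argument, so `P` has to be checked on those only. -/
theorem mem_ofIntro_map {P : Pf Ω K → Prop} (F : Pf Ω K → Pf Ω K)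
    (hF : ∀ x z, Red (F x) z → ∃ y, z = F y ∧ Red x y)
    {a : Pf Ω K} (h : a.StronglyNormalizing) (hP : ∀ b, Reds a b → P (F b)) :
    F a ∈ ofIntro P := by
  refine ⟨h.map F hF, fun b hb hi => ?_⟩
  have : ∃ y, b = F y ∧ Reds a y := by
    clear hP hi
    induction hb with
    | refl => exact ⟨a, rfl, .refl⟩
    | tail _ h' ih =>
      obtain ⟨y, rfl, hy⟩ := ih
      obtain ⟨z, rfl, hz⟩ := hF _ _ h'
      exact ⟨z, rfl, hy.tail hz⟩
  obtain ⟨y, rfl, hy⟩ := this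
  exact hP y hy

theorem of_mem_ofIntro {P : Pf Ω K → Prop} {a : Pf Ω K} (h : a ∈ ofIntro P) (hi : a.IsIntro) :
    P a := h.2 a .refl hi

instance : InfSet (Cand Ω K) where
  sInf S :=
    -- Strong normalization is stated separately for the sake of the empty family, whose infimum
    -- must still be a candidate.
    { carrier := {a | a.StronglyNormalizing ∧ ∀ A ∈ S, a ∈ A}
      sn := fun h => h.1
      red := fun h hab => ⟨h.1.red hab, fun A hA => A.red (h.2 A hA) hab⟩
      neutral := fun hn h => ⟨⟨_, fun b hb => (h b hb).1⟩,
        fun A hA => A.neutral hn fun b hb => (h b hb).2 A hA⟩ }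

theorem isGLB_sInf (S : Set (Cand Ω K)) : IsGLB S (sInf S) :=
  ⟨fun A hA a (ha : a ∈ sInf S) => ha.2 A hA,
    fun B hB a (ha : a ∈ B) => ⟨B.sn ha, fun _ hA => hB hA ha⟩⟩

instance : CompleteLattice (Cand Ω K) := completeLatticeOfInf _ isGLB_sInf

/-- The candidate of `⊤` and `⊥`. -/
def snCand : Cand Ω K := ofIntro fun _ => True

def and (A B : Cand Ω K) : Cand Ω K := ofIntro fun b => ∀ x y, b = .pair x y → x ∈ A ∧ y ∈ B

def or (A B : Cand Ω K) : Cand Ω K :=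
  ofIntro fun b => (∀ x, b = .inl x → x ∈ A) ∧ ∀ x, b = .inr x → x ∈ B

def imp (A B : Cand Ω K) : Cand Ω K :=
  ofIntro fun b => ∀ x, b = .lam x → ∀ d ∈ A, inst d x ∈ B

/-- The term t put into the proof-term and the value d that selects the candidate are quantified
independently, and in `exI` the witness term says nothing about d. Reduction never inspects the
terms carried by proofs, so no link between them is needed, and the terms need not be evaluated
during the reducibility argument. -/
def allI {D : Type} (F : D → Cand Ω K) : Cand Ω K :=
  ofIntro fun b => ∀ x, b = .lamI x → ∀ t d, x.tsubst (Sub.instI t) ∈ F d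

def allK {D : Type} (F : D → Cand Ω K) : Cand Ω K :=
  ofIntro fun b => ∀ x, b = .lamK x → ∀ c d, x.tsubst (Sub.instK c) ∈ F d

def exI {D : Type} (F : D → Cand Ω K) : Cand Ω K :=
  ofIntro fun b => ∀ t x, b = .packI t x → ∃ d, x ∈ F d

def exK {D : Type} (F : D → Cand Ω K) : Cand Ω K :=
  ofIntro fun b => ∀ c x, b = .packK c x → ∃ d, x ∈ F d

variable {A B C : Cand Ω K} {D : Type} {F : D → Cand Ω K} {a b c : Pf Ω K}

theorem triv_mem : .triv ∈ (snCand : Cand Ω K) :=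
  ⟨⟨_, fun _ h => nomatch h⟩, fun _ _ _ => True.intro⟩

theorem botE_mem (ha : a.StronglyNormalizing) : .botE a ∈ A := by
  induction ha with
  | intro a _ ih =>
    refine A.neutral (fun h => h) fun b hb => ?_
    cases hb with
    | botE h => exact ih _ h

theorem pair_mem (ha : a ∈ A) (hb : b ∈ B) : .pair a b ∈ and A B := by
  constructor
  · have hsa := A.sn ha
    have hsb := B.sn hb
    clear ha hb
    induction hsa generalizing b with
    | intro a _ iha =>
      induction hsb with
      | intro b hb ihb =>
        refine ⟨_, fun c hc => ?_⟩
        cases hc with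
        | pairL h => exact iha _ h ⟨_, hb⟩
        | pairR h => exact ihb _ h
  · intro c hc hi
    clear hi
    have : ∃ x y, c = .pair x y ∧ Reds a x ∧ Reds b y := by
      induction hc with
      | refl => exact ⟨a, b, rfl, .refl, .refl⟩
      | tail _ h' ih =>
        obtain ⟨x, y, rfl, hx, hy⟩ := ih
        cases h' with
        | pairL h => exact ⟨_, y, rfl, hx.tail h, hy⟩
        | pairR h => exact ⟨x, _, rfl, hx, hy.tail h⟩
    obtain ⟨x, y, rfl, hx, hy⟩ := this
    rintro x' y' ⟨⟩
    exact ⟨mem_of_reds ha hx, mem_of_reds hb hy⟩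

theorem fst_mem (ha : a ∈ and A B) : .fst a ∈ A := by
  have hs := (and A B).sn ha
  induction hs with
  | intro a _ ih =>
    refine A.neutral (fun h => h) fun b hb => ?_
    cases hb with
    | fstPair => exact (of_mem_ofIntro ha trivial _ _ rfl).1
    | fst h => exact ih _ h ((and A B).red ha h)

theorem snd_mem (ha : a ∈ and A B) : .snd a ∈ B := by
  have hs := (and A B).sn ha
  induction hs with
  | intro a _ ih =>
    refine B.neutral (fun h => h) fun b hb => ?_
    cases hb with
    | sndPair => exact (of_mem_ofIntro ha trivial _ _ rfl).2
    | snd h => exact ih _ h ((and A B).red ha h)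

theorem inl_mem (ha : a ∈ A) : .inl a ∈ or A B := by
  refine mem_ofIntro_map .inl (fun x z h => ?_) (A.sn ha) fun b hb => ⟨?_, fun _ h => nomatch h⟩
  · cases h with
    | inl h => exact ⟨_, rfl, h⟩
  · rintro _ ⟨⟩; exact mem_of_reds ha hb

theorem inr_mem (ha : a ∈ B) : .inr a ∈ or A B := by
  refine mem_ofIntro_map .inr (fun x z h => ?_) (B.sn ha) fun b hb =>
    ⟨(fun _ h => nomatch h), ?_⟩
  · cases h with
    | inr h => exact ⟨_, rfl, h⟩
  · rintro _ ⟨⟩; exact mem_of_reds ha hb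

/-- Variables belong to every candidate, so there is an instance to test, and strong normalization
is reflected by substitution. -/
theorem sn_of_inst_mem (h : ∀ d ∈ A, inst d a ∈ B) : a.StronglyNormalizing := by
  have := B.sn (h _ (A.var_mem 0))
  rw [inst_eq] at this
  exact this.of_subst

theorem inst_mem_of_red (h : ∀ d ∈ A, inst d a ∈ B) (hab : Red a b) : ∀ d ∈ A, inst d b ∈ B :=
  fun d hd => mem_of_reds (h d hd) (.inst .refl (.single hab))

/-- An elimination is not an introduction, so it suffices to place its one-step reducts in `C`.
Inner steps are handled by nested inductions on the strong normalization of the three parts, the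
assumptions on them being stable under reduction; the cuts are covered by the definition of the
candidate. The other eliminations follow this pattern. -/
theorem case_mem (ha : a ∈ or A B) (hb : ∀ d ∈ A, inst d b ∈ C) (hc : ∀ d ∈ B, inst d c ∈ C) :
    .case a b c ∈ C := by
  have hsa := (or A B).sn ha
  have hsb := sn_of_inst_mem hb
  have hsc := sn_of_inst_mem hc
  induction hsa generalizing b c with
  | intro a _ iha =>
    induction hsb generalizing c with
    | intro b hsb ihb =>
      induction hsc with
      | intro c hsc ihc =>
        refine C.neutral (fun h => h) fun e he => ?_
        cases he with
        | caseInl => exact hb _ ((of_mem_ofIntro ha trivial).1 _ rfl)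
        | caseInr => exact hc _ ((of_mem_ofIntro ha trivial).2 _ rfl)
        | case₁ h => exact iha _ h ((or A B).red ha h) hb hc ⟨_, hsb⟩ ⟨_, hsc⟩
        | case₂ h => exact ihb _ h (inst_mem_of_red hb h) hc ⟨_, hsc⟩
        | case₃ h => exact ihc _ h (inst_mem_of_red hc h)

theorem lam_mem (h : ∀ d ∈ A, inst d a ∈ B) : .lam a ∈ imp A B := by
  refine mem_ofIntro_map .lam (fun x z h => ?_) (sn_of_inst_mem h) fun b hb => ?_
  · cases h with
    | lam h => exact ⟨_, rfl, h⟩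
  · rintro _ ⟨⟩ d hd
    exact mem_of_reds (h d hd) (.inst .refl hb)

theorem app_mem (ha : a ∈ imp A B) (hb : b ∈ A) : .app a b ∈ B := by
  have hsa := (imp A B).sn ha
  have hsb := A.sn hb
  induction hsa generalizing b with
  | intro a _ iha =>
    induction hsb with
    | intro b hsb ihb =>
      refine B.neutral (fun h => h) fun e he => ?_
      cases he with
      | beta => exact of_mem_ofIntro ha trivial _ rfl _ hb
      | appL h => exact iha _ h ((imp A B).red ha h) hb ⟨_, hsb⟩
      | appR h => exact ihb _ h (A.red hb h)

theorem lamI_mem [hD : Nonempty D] (h : ∀ t d, a.tsubst (Sub.instI t) ∈ F d) :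
    .lamI a ∈ allI F := by
  refine mem_ofIntro_map .lamI (fun x z h => ?_) ?_ fun b hb => ?_
  · cases h with
    | lamI h => exact ⟨_, rfl, h⟩
  -- Any instance would do; this is what nonemptiness of the domain is for.
  · exact ((F _).sn (h .zero hD.some)).of_tsubst
  · rintro _ ⟨⟩ t d
    exact mem_of_reds (h t d) (hb.tsubst _)

theorem appI_mem (ha : a ∈ allI F) (t : Tm Ω) (d : D) : .appI a t ∈ F d := by
  have hs := (allI F).sn ha
  induction hs with
  | intro a _ ih =>
    refine (F d).neutral (fun h => h) fun b hb => ?_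
    cases hb with
    | betaI => exact of_mem_ofIntro ha trivial _ rfl _ _
    | appI h => exact ih _ h ((allI F).red ha h)

theorem lamK_mem [hD : Nonempty D] (h : ∀ c d, a.tsubst (Sub.instK c) ∈ F d) :
    .lamK a ∈ allK F := by
  refine mem_ofIntro_map .lamK (fun x z h => ?_) ?_ fun b hb => ?_
  · cases h with
    | lamK h => exact ⟨_, rfl, h⟩
  · exact ((F _).sn (h (.var 0) hD.some)).of_tsubst
  · rintro _ ⟨⟩ t d
    exact mem_of_reds (h t d) (hb.tsubst _)

theorem appK_mem (ha : a ∈ allK F) (t : Cl Ω K) (d : D) : .appK a t ∈ F d := by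
  have hs := (allK F).sn ha
  induction hs with
  | intro a _ ih =>
    refine (F d).neutral (fun h => h) fun b hb => ?_
    cases hb with
    | betaK => exact of_mem_ofIntro ha trivial _ rfl _ _
    | appK h => exact ih _ h ((allK F).red ha h)

theorem packI_mem {d : D} (t : Tm Ω) (ha : a ∈ F d) : .packI t a ∈ exI F := by
  refine mem_ofIntro_map (.packI t) (fun x z h => ?_) ((F d).sn ha) fun b hb => ?_
  · cases h with
    | packI h => exact ⟨_, rfl, h⟩
  · rintro _ _ ⟨⟩; exact ⟨d, mem_of_reds ha hb⟩

theorem unpackI_mem [hD : Nonempty D] (ha : a ∈ exI F)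
    (hb : ∀ t d, ∀ x ∈ F d, inst x (b.tsubst (Sub.instI t)) ∈ C) : .unpackI a b ∈ C := by
  have hsa := (exI F).sn ha
  have hsb := (sn_of_inst_mem (hb .zero hD.some)).of_tsubst
  induction hsa generalizing b with
  | intro a _ iha =>
    induction hsb with
    | intro b hsb ihb =>
      refine C.neutral (fun h => h) fun e he => ?_
      cases he with
      | unpackPackI =>
        obtain ⟨d, hd⟩ := of_mem_ofIntro ha trivial _ _ rfl
        exact hb _ d _ hd
      | unpackIL h => exact iha _ h ((exI F).red ha h) hb ⟨_, hsb⟩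
      | unpackIR h => exact ihb _ h fun t d => inst_mem_of_red (hb t d) (h.tsubst _)

theorem packK_mem {d : D} (t : Cl Ω K) (ha : a ∈ F d) : .packK t a ∈ exK F := by
  refine mem_ofIntro_map (.packK t) (fun x z h => ?_) ((F d).sn ha) fun b hb => ?_
  · cases h with
    | packK h => exact ⟨_, rfl, h⟩
  · rintro _ _ ⟨⟩; exact ⟨d, mem_of_reds ha hb⟩

theorem unpackK_mem [hD : Nonempty D] (ha : a ∈ exK F)
    (hb : ∀ t d, ∀ x ∈ F d, inst x (b.tsubst (Sub.instK t)) ∈ C) : .unpackK a b ∈ C := by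
  have hsa := (exK F).sn ha
  have hsb := (sn_of_inst_mem (hb (.var 0) hD.some)).of_tsubst
  induction hsa generalizing b with
  | intro a _ iha =>
    induction hsb with
    | intro b hsb ihb =>
      refine C.neutral (fun h => h) fun e he => ?_
      cases he with
      | unpackPackK =>
        obtain ⟨d, hd⟩ := of_mem_ofIntro ha trivial _ _ rfl
        exact hb _ d _ hd
      | unpackKL h => exact iha _ h ((exK F).red ha h) hb ⟨_, hsb⟩
      | unpackKR h => exact ihb _ h fun t d => inst_mem_of_red (hb t d) (h.tsubst _)

/-- Implication is antitone on the left and monotone on the right. -/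
theorem imp_mono {A A' B B' : Cand Ω K} (hA : A' ≤ A) (hB : B ≤ B') : imp A B ≤ imp A' B' :=
  fun a (h : a ∈ imp A B) => ⟨h.1, fun b hb hi x hx d hd => hB (h.2 b hb hi x hx d (hA hd))⟩

theorem allI_mono {F G : D → Cand Ω K} (h : ∀ d, F d ≤ G d) : allI F ≤ allI G :=
  fun a (ha : a ∈ allI F) => ⟨ha.1, fun b hb hi x hx t d => h d (ha.2 b hb hi x hx t d)⟩

theorem allK_mono {F G : D → Cand Ω K} (h : ∀ d, F d ≤ G d) : allK F ≤ allK G :=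
  fun a (ha : a ∈ allK F) => ⟨ha.1, fun b hb hi x hx t d => h d (ha.2 b hb hi x hx t d)⟩

end Cand

/-! ## Congruence and substitution -/

section Congruence

variable {Ω : Sig} {K : ClassSig} {𝔠 : Comprehension} {R E : Set (Tm Ω × Tm Ω)}

theorem TmEq.subst {t u : Tm Ω} (h : TmEq R t u) (σ : ℕ → Tm Ω) :
    TmEq R (t.subst σ) (u.subst σ) := by
  induction h with
  | ax h τ => rw [Tm.subst_subst, Tm.subst_subst]; exact .ax h _
  | refl t => exact .refl _
  | symm _ ih => exact ih.symm
  | trans _ _ ih ih' => exact ih.trans ih'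
  | succ _ ih => exact .succ ih
  | pred _ ih => exact .pred ih
  | add _ _ ih ih' => exact .add ih ih'
  | mul _ _ ih ih' => exact .mul ih ih'
  | fn i _ ih => exact .fn i ih

theorem TmEq.subst_arg {σ τ : ℕ → Tm Ω} (h : ∀ n, TmEq R (σ n) (τ n)) (t : Tm Ω) :
    TmEq R (t.subst σ) (t.subst τ) := by
  induction t with
  | var n => exact h n
  | zero => exact .refl _
  | succ _ ih => exact .succ ih
  | pred _ ih => exact .pred ih
  | add _ _ ih ih' => exact .add ih ih'
  | mul _ _ ih ih' => exact .mul ih ih'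
  | fn i _ ih => exact .fn i ih

theorem ClEq.subst {c d : Cl Ω K} (h : ClEq R c d) (s : Sub Ω K) :
    ClEq R (c.subst s) (d.subst s) := by
  induction h with
  | refl t => exact .refl _
  | symm _ ih => exact ih.symm
  | trans _ _ ih ih' => exact ih.trans ih'
  | sk c h _ ih => exact .sk c (fun j => (h j).subst _) ih

theorem ClEq.subst_arg {s s' : Sub Ω K} (h : ∀ n, TmEq R (s.tm n) (s'.tm n))
    (h' : ∀ n, ClEq R (s.cl n) (s'.cl n)) (c : Cl Ω K) : ClEq R (c.subst s) (c.subst s') := by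
  induction c with
  | var n => exact h' n
  | sk c a b ih => exact .sk c (fun j => .subst_arg h _) ih

theorem FmEq.subst {A B : AFm Ω 𝔠} (h : FmEq E A B) (s : Sub Ω (skolemSig Ω 𝔠)) :
    FmEq E (A.subst s) (B.subst s) := by
  induction h generalizing s with
  | rule h s' => rw [Fm.subst_subst, Fm.subst_subst]; exact .rule h _
  | refl => exact .refl _
  | symm _ ih => exact (ih s).symm
  | trans _ _ ih ih' => exact (ih s).trans (ih' s)
  | eq h h' => exact .eq (h.subst _) (h'.subst _)
  | nat h => exact .nat (h.subst _)
  | null h => exact .null (h.subst _)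
  | mem h h' => exact .mem (h.subst _) (h'.subst _)
  | and _ _ ih ih' => exact .and (ih s) (ih' s)
  | or _ _ ih ih' => exact .or (ih s) (ih' s)
  | imp _ _ ih ih' => exact .imp (ih s) (ih' s)
  | allI _ ih => exact .allI (ih _)
  | exI _ ih => exact .exI (ih _)
  | allK _ ih => exact .allK (ih _)
  | exK _ ih => exact .exK (ih _)

theorem FmEq.subst_arg {s s' : Sub Ω (skolemSig Ω 𝔠)}
    (h : ∀ n, TmEq (HA2 Ω ∪ E) (s.tm n) (s'.tm n))
    (h' : ∀ n, ClEq (HA2 Ω ∪ E) (s.cl n) (s'.cl n)) (A : AFm Ω 𝔠) :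
    FmEq E (A.subst s) (A.subst s') := by
  have hI {s s' : Sub Ω (skolemSig Ω 𝔠)} (h : ∀ n, TmEq (HA2 Ω ∪ E) (s.tm n) (s'.tm n)) (n : ℕ) :
      TmEq (HA2 Ω ∪ E) (s.liftI.tm n) (s'.liftI.tm n) := by
    cases n with
    | zero => exact .refl _
    | succ n => exact (h n).subst _
  have hI' {s s' : Sub Ω (skolemSig Ω 𝔠)} (h : ∀ n, ClEq (HA2 Ω ∪ E) (s.cl n) (s'.cl n)) (n : ℕ) :
      ClEq (HA2 Ω ∪ E) (s.liftI.cl n) (s'.liftI.cl n) := (h n).subst _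
  have hK {s s' : Sub Ω (skolemSig Ω 𝔠)} (h : ∀ n, TmEq (HA2 Ω ∪ E) (s.tm n) (s'.tm n)) (n : ℕ) :
      TmEq (HA2 Ω ∪ E) (s.liftK.tm n) (s'.liftK.tm n) := h n
  have hK' {s s' : Sub Ω (skolemSig Ω 𝔠)} (h : ∀ n, ClEq (HA2 Ω ∪ E) (s.cl n) (s'.cl n)) (n : ℕ) :
      ClEq (HA2 Ω ∪ E) (s.liftK.cl n) (s'.liftK.cl n) := by
    cases n with
    | zero => exact .refl _
    | succ n => exact (h n).subst _
  induction A generalizing s s' with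
  | eq t u => exact .eq (.subst_arg h _) (.subst_arg h _)
  | nat t => exact .nat (.subst_arg h _)
  | null t => exact .null (.subst_arg h _)
  | mem t c => exact .mem (.subst_arg h _) (.subst_arg h h' _)
  | top => exact .refl _
  | bot => exact .refl _
  | and A B ih ih' => exact .and (ih h h') (ih' h h')
  | or A B ih ih' => exact .or (ih h h') (ih' h h')
  | imp A B ih ih' => exact .imp (ih h h') (ih' h h')
  | allI A ih => exact .allI (ih (hI h) (hI' h'))
  | exI A ih => exact .exI (ih (hI h) (hI' h'))
  | allK A ih => exact .allK (ih (hK h) (hK' h'))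
  | exK A ih => exact .exK (ih (hK h) (hK' h'))

theorem Tm.subst_congr_of_below {σ τ : ℕ → Tm Ω} {p : ℕ} (h : ∀ n < p, σ n = τ n) {t : Tm Ω}
    (ht : t.Below p) : t.subst σ = t.subst τ := by
  induction t <;> simp_all [Tm.subst, Tm.Below]

theorem Cl.subst_congr_of_below {s s' : Sub Ω K} {p m : ℕ} (h : ∀ n < p, s.tm n = s'.tm n)
    (h' : ∀ n < m, s.cl n = s'.cl n) {c : Cl Ω K} (hc : c.Below p m) :
    c.subst s = c.subst s' := by
  induction c with
  | var n => exact h' n hc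
  | sk c a b ih =>
    simp only [Cl.subst, Cl.sk.injEq, heq_eq_eq, true_and]
    exact ⟨funext fun j => Tm.subst_congr_of_below h (hc.1 j), funext fun j => ih j (hc.2 j)⟩

end Congruence

/-! ## The term model -/

section Model

variable {Ω : Sig} {K : ClassSig} {R : Set (Tm Ω × Tm Ω)}

/-- The congruence on terms as a setoid. -/
def TmEq.setoid (R : Set (Tm Ω × Tm Ω)) : Setoid (Tm Ω) := ⟨TmEq R, .refl, .symm, .trans⟩

/-- The numbers of the model: the terms modulo the congruence. -/
abbrev Dom (R : Set (Tm Ω × Tm Ω)) : Type := Quotient (TmEq.setoid R)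

/-- The value of a term in the term model. -/
noncomputable def Tm.eval (ρ : ℕ → Dom R) (t : Tm Ω) : Dom R := ⟦t.subst fun n => (ρ n).out⟧

theorem Tm.eval_var (ρ : ℕ → Dom R) (n : ℕ) : (Tm.var n).eval ρ = ρ n := Quotient.out_eq _

/-- The chosen representatives of the values differ from the substituted terms only up to
congruence, which the quotient forgets. -/
theorem Tm.eval_subst (ρ : ℕ → Dom R) (σ : ℕ → Tm Ω) (t : Tm Ω) :
    (t.subst σ).eval ρ = t.eval fun n => (σ n).eval ρ := by
  unfold eval
  rw [subst_subst]
  exact Quotient.sound (TmEq.subst_arg (fun n =>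
    TmEq.symm (Quotient.exact (Quotient.out_eq ((σ n).eval ρ)))) t)

theorem Tm.eval_eq_of_tmEq {t u : Tm Ω} (h : TmEq R t u) (ρ : ℕ → Dom R) :
    t.eval ρ = u.eval ρ := Quotient.sound (h.subst _)

theorem Tm.eval_congr_of_below {ρ ρ' : ℕ → Dom R} {p : ℕ} (h : ∀ n < p, ρ n = ρ' n) {t : Tm Ω}
    (ht : t.Below p) : t.eval ρ = t.eval ρ' := by
  unfold eval
  rw [subst_congr_of_below (fun n hn => by rw [h n hn]) ht]

/-- A valuation of the variables: classes are families of candidates indexed by numbers. -/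
structure Val (K' : ClassSig) (R : Set (Tm Ω × Tm Ω)) where
  tm : ℕ → Dom R
  cl : ℕ → Dom R → Cand Ω K'

variable {K' : ClassSig}

namespace Val

theorem ext {v v' : Val K' R} (h : ∀ n, v.tm n = v'.tm n) (h' : ∀ n, v.cl n = v'.cl n) :
    v = v' := by
  cases v; cases v'; simp only [mk.injEq]; exact ⟨funext h, funext h'⟩

/-- Extension of a valuation to a new innermost variable of sort `ι`. -/
def consI (d : Dom R) (v : Val K' R) : Val K' R where
  tm n := match n with
    | 0 => d
    | n + 1 => v.tm n
  cl := v.cl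

/-- Extension of a valuation to a new innermost variable of sort `κ`. -/
def consK (X : Dom R → Cand Ω K') (v : Val K' R) : Val K' R where
  tm := v.tm
  cl n := match n with
    | 0 => X
    | n + 1 => v.cl n

end Val

/-- An interpretation of the function symbols of sort `κ`. -/
abbrev ClInterp (K K' : ClassSig) (R : Set (Tm Ω × Tm Ω)) : Type :=
  ∀ s : K.Sym, (Fin (K.arI s) → Dom R) → (Fin (K.arK s) → Dom R → Cand Ω K') → Dom R → Cand Ω K'

noncomputable def Cl.interp (I : ClInterp K K' R) (v : Val K' R) : Cl Ω K → Dom R → Cand Ω K'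
  | .var n => v.cl n
  | .sk s a b => I s (fun j => (a j).eval v.tm) fun j => (b j).interp I v

namespace Cand

/-- The candidate of an equation. -/
def eq (d e : Dom R) : Cand Ω K' := allK fun X : Dom R → Cand Ω K' => imp (X d) (X e)

/-- The value of the successor of a number. -/
noncomputable def succ (d : Dom R) : Dom R := (Tm.succ (.var 0)).eval fun _ => d

/-- The operator of which the interpretation of `N` is a fixed point. -/
noncomputable def natOp : (Dom R → Cand Ω K') →o (Dom R → Cand Ω K') where
  toFun N d := allK fun X : Dom R → Cand Ω K' => imp (X ⟦.zero⟧)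
    (imp (allI fun e : Dom R => imp (N e) (imp (X e) (X (succ e)))) (X d))
  -- `N` stands to the left of an implication that is itself to the left of an implication, hence
  -- positively.
  monotone' _ _ h _ := allK_mono fun _ => imp_mono le_rfl (imp_mono (allI_mono fun e =>
    imp_mono (h e) le_rfl) le_rfl)

/-- The interpretation of `N`. -/
noncomputable def nat : Dom R → Cand Ω K' := OrderHom.lfp natOp

theorem nat_eq (d : Dom R) : (nat d : Cand Ω K') = natOp nat d :=
  congrFun (OrderHom.map_lfp natOp).symm d

end Cand

theorem Tm.eval_succ (ρ : ℕ → Dom R) (t : Tm Ω) :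
    (Tm.succ t).eval ρ = Cand.succ (t.eval ρ) :=
  Tm.eval_subst ρ (fun _ => t) (.succ (.var 0))

/-- The interpretation of a proposition as a candidate. -/
noncomputable def Fm.interp (I : ClInterp K K' R) : Val K' R → Fm Ω K → Cand Ω K'
  | v, .eq t u => Cand.eq (t.eval v.tm) (u.eval v.tm)
  | v, .nat t => Cand.nat (t.eval v.tm)
  | _, .null _ => Cand.snCand
  | v, .mem t c => c.interp I v (t.eval v.tm)
  | _, .top => Cand.snCand
  | _, .bot => Cand.snCand
  | v, .and A B => Cand.and (A.interp I v) (B.interp I v)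
  | v, .or A B => Cand.or (A.interp I v) (B.interp I v)
  | v, .imp A B => Cand.imp (A.interp I v) (B.interp I v)
  | v, .allI A => Cand.allI fun d => A.interp I (v.consI d)
  | v, .exI A => Cand.exI fun d => A.interp I (v.consI d)
  | v, .allK A => Cand.allK fun X => A.interp I (v.consK X)
  | v, .exK A => Cand.exK fun X => A.interp I (v.consK X)

/-- The valuation `v` composed with the substitution `s`. -/
noncomputable def Val.sub (I : ClInterp K K' R) (v : Val K' R) (s : Sub Ω K) : Val K' R :=
  ⟨fun n => (s.tm n).eval v.tm, fun n => (s.cl n).interp I v⟩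

variable (I : ClInterp K K' R)

theorem Cl.interp_subst (v : Val K' R) (s : Sub Ω K) (c : Cl Ω K) :
    (c.subst s).interp I v = c.interp I (v.sub I s) := by
  induction c <;> simp_all [Cl.subst, Cl.interp, Val.sub, Tm.eval_subst]

namespace Val

theorem consI_sub_shiftI (v : Val K' R) (d : Dom R) : (v.consI d).sub I (Sub.shiftI 1) = v :=
  ext (fun _ => Tm.eval_var _ _) (fun _ => rfl)

theorem consK_sub_shiftK (v : Val K' R) (X : Dom R → Cand Ω K') :
    (v.consK X).sub I Sub.shiftK = v :=
  ext (fun _ => Tm.eval_var _ _) (fun _ => rfl)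

theorem consI_sub_liftI (v : Val K' R) (d : Dom R) (s : Sub Ω K) :
    (v.consI d).sub I s.liftI = (v.sub I s).consI d := by
  refine ext (fun n => ?_) (fun n => ?_)
  · cases n with
    | zero => exact Tm.eval_var _ _
    | succ n =>
      refine (Tm.eval_subst _ _ _).trans ?_
      simp only [Tm.eval_var]; rfl
  · exact (Cl.interp_subst I _ _ _).trans (by rw [consI_sub_shiftI]; rfl)

theorem consK_sub_liftK (v : Val K' R) (X : Dom R → Cand Ω K') (s : Sub Ω K) :
    (v.consK X).sub I s.liftK = (v.sub I s).consK X := by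
  refine ext (fun n => rfl) (fun n => ?_)
  cases n with
  | zero => rfl
  | succ n => exact (Cl.interp_subst I _ _ _).trans (by rw [consK_sub_shiftK]; rfl)

theorem sub_instI (v : Val K' R) (t : Tm Ω) :
    v.sub I (Sub.instI t) = v.consI (t.eval v.tm) :=
  ext (fun n => by cases n with
    | zero => rfl
    | succ n => exact Tm.eval_var _ _) (fun _ => rfl)

theorem sub_instK (v : Val K' R) (c : Cl Ω K) :
    v.sub I (Sub.instK c) = v.consK (c.interp I v) :=
  ext (fun _ => Tm.eval_var _ _) (fun n => by cases n <;> rfl)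

end Val

theorem Fm.interp_subst (v : Val K' R) (s : Sub Ω K) (A : Fm Ω K) :
    (A.subst s).interp I v = A.interp I (v.sub I s) := by
  induction A generalizing v s <;>
    simp_all [Fm.subst, Fm.interp, Tm.eval_subst, Cl.interp_subst, Val.consI_sub_liftI,
      Val.consK_sub_liftK] <;>
    simp [Val.sub]

theorem Fm.interp_shiftI (v : Val K' R) (d : Dom R) (A : Fm Ω K) :
    (A.subst (Sub.shiftI 1)).interp I (v.consI d) = A.interp I v := by
  rw [interp_subst, Val.consI_sub_shiftI]

theorem Fm.interp_shiftK (v : Val K' R) (X : Dom R → Cand Ω K') (A : Fm Ω K) :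
    (A.subst Sub.shiftK).interp I (v.consK X) = A.interp I v := by
  rw [interp_subst, Val.consK_sub_shiftK]

theorem Fm.interp_instI (v : Val K' R) (t : Tm Ω) (A : Fm Ω K) :
    (A.subst (Sub.instI t)).interp I v = A.interp I (v.consI (t.eval v.tm)) := by
  rw [interp_subst, Val.sub_instI]

theorem Fm.interp_instK (v : Val K' R) (c : Cl Ω K) (A : Fm Ω K) :
    (A.subst (Sub.instK c)).interp I v = A.interp I (v.consK (c.interp I v)) := by
  rw [interp_subst, Val.sub_instK]

/-- The interpretation of the empty family of symbols. -/
def ClInterp.none : ClInterp ClassSig.none K' R := fun s => Empty.elim s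

/-- A comprehension body is interpreted in the language without Skolem symbols, whereas the rewrite
rule produces its embedding in the full language. The two values agree, whatever the interpretation
of the symbols. -/
theorem Fm.interp_embed (v : Val K' R) (A : Fm Ω ClassSig.none) :
    (A.embed : Fm Ω K).interp I v = A.interp ClInterp.none v := by
  have h (v : Val K' R) (c : Cl Ω ClassSig.none) :
      (c.embed : Cl Ω K).interp I v = c.interp ClInterp.none v := by
    cases c with
    | var n => rfl
    | sk s => exact Empty.elim s
  induction A generalizing v <;> simp_all [Fm.embed, Fm.interp]

theorem Fm.interp_congr_of_below {v v' : Val K' R} {p m : ℕ} (h : ∀ n < p, v.tm n = v'.tm n)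
    (h' : ∀ n < m, v.cl n = v'.cl n) {A : Fm Ω K} (hA : A.Below p m) :
    A.interp I v = A.interp I v' := by
  have hc (c : Cl Ω K) {v v' : Val K' R} {p m : ℕ} (h : ∀ n < p, v.tm n = v'.tm n)
      (h' : ∀ n < m, v.cl n = v'.cl n) (hc : c.Below p m) : c.interp I v = c.interp I v' := by
    induction c with
    | var n => exact h' n hc
    | sk s a b ih =>
      have h₁ : (fun j => (a j).eval v.tm) = fun j => (a j).eval v'.tm :=
        funext fun j => Tm.eval_congr_of_below h (hc.1 j)
      have h₂ : (fun j => (b j).interp I v) = fun j => (b j).interp I v' :=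
        funext fun j => ih j (hc.2 j)
      simp only [Cl.interp, h₁, h₂]
  have hI {v v' : Val K' R} {p : ℕ} (h : ∀ n < p, v.tm n = v'.tm n) (d : Dom R) :
      ∀ n < p + 1, (v.consI d).tm n = (v'.consI d).tm n := by
    intro n hn
    cases n with
    | zero => rfl
    | succ n => exact h n (by omega)
  have hK {v v' : Val K' R} {m : ℕ} (h : ∀ n < m, v.cl n = v'.cl n) (X) :
      ∀ n < m + 1, (v.consK X).cl n = (v'.consK X).cl n := by
    intro n hn
    cases n with
    | zero => rfl
    | succ n => exact h n (by omega)
  induction A generalizing v v' p m with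
  | eq t u => simp only [interp]; rw [t.eval_congr_of_below h hA.1, u.eval_congr_of_below h hA.2]
  | nat t => simp only [interp]; rw [t.eval_congr_of_below h hA]
  | null t => rfl
  | mem t c => simp only [interp]; rw [t.eval_congr_of_below h hA.1, hc c h h' hA.2]
  | top => rfl
  | bot => rfl
  | and A B ih ih' => simp only [interp]; rw [ih h h' hA.1, ih' h h' hA.2]
  | or A B ih ih' => simp only [interp]; rw [ih h h' hA.1, ih' h h' hA.2]
  | imp A B ih ih' => simp only [interp]; rw [ih h h' hA.1, ih' h h' hA.2]
  | allI A ih => exact congrArg Cand.allI (funext fun d => ih (hI h d) h' hA)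
  | exI A ih => exact congrArg Cand.exI (funext fun d => ih (hI h d) h' hA)
  | allK A ih => exact congrArg Cand.allK (funext fun d => ih h (hK h' d) hA)
  | exK A ih => exact congrArg Cand.exK (funext fun d => ih h (hK h' d) hA)

end Model

/-! ## Soundness of the interpretation -/

section Soundness

variable {Ω : Sig} {𝔠 : Comprehension} {E : Set (Tm Ω × Tm Ω)}

/-- The interpretation of the Skolem symbols. -/
noncomputable def ClInterp.skolem (R : Set (Tm Ω × Tm Ω)) :
    ClInterp (skolemSig Ω 𝔠) (skolemSig Ω 𝔠) R := fun (s : Skolem Ω 𝔠) a b d =>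
  -- The values given to indices beyond the parameters are arbitrary, since `s.below` confines the
  -- free variables of the body.
  s.body.interp ClInterp.none
    { tm := fun n => match n with
        | 0 => d
        | n + 1 => if h : n < s.p then a ⟨n, h⟩ else d
      cl := fun n => if h : n < s.m then b ⟨n, h⟩ else fun _ => Cand.snCand }

/-- The interpretation of a proposition of arithmetic. -/
noncomputable abbrev Fm.cand (v : Val (skolemSig Ω 𝔠) (HA2 Ω ∪ E)) (A : AFm Ω 𝔠) :
    Cand Ω (skolemSig Ω 𝔠) := A.interp (ClInterp.skolem _) v

theorem ClEq.interp_eq {c d : ACl Ω 𝔠} (h : ClEq (HA2 Ω ∪ E) c d)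
    (v : Val (skolemSig Ω 𝔠) (HA2 Ω ∪ E)) :
    c.interp (ClInterp.skolem _) v = d.interp (ClInterp.skolem _) v := by
  induction h with
  | refl => rfl
  | symm _ ih => exact ih.symm
  | trans _ _ ih ih' => exact ih.trans ih'
  | sk s h _ ih =>
    simp only [Cl.interp]
    congr 1
    · exact funext fun j => Tm.eval_eq_of_tmEq (h j) _
    · exact funext ih

/-- Comprehension holds by the choice of `ClInterp.skolem`, the rule of `N` by the fixed point
equation, and the rules of `Null` because ⊤, ⊥ and `Null` share one candidate. Nothing here requires
that 0 differ from the successors. -/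
theorem HA1.cand_eq {l r : AFm Ω 𝔠} (h : HA1 l r) (v : Val (skolemSig Ω 𝔠) (HA2 Ω ∪ E)) :
    l.cand v = r.cand v := by
  cases h with
  | mem s =>
    rw [Fm.cand, Fm.cand, Fm.interp_embed]
    refine Fm.interp_congr_of_below _ (p := s.p + 1) (m := s.m) (fun n hn => ?_) (fun n hn => ?_)
      s.below
    · cases n with
      | zero => exact Tm.eval_var _ _
      | succ n =>
        simp only [Nat.add_lt_add_iff_right] at hn
        simp only [hn, dif_pos]; exact Tm.eval_var _ _
    · simp only [hn, dif_pos]; rfl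
  | eq =>
    simp only [Fm.cand, Fm.interp, Tm.eval_var, Cl.interp]; rfl
  | nat =>
    refine (Cand.nat_eq _).trans ?_
    simp only [Fm.cand, Fm.interp, Tm.eval_var, Cl.interp, Tm.eval_succ]; rfl
  | nullZero => rfl
  | nullSucc => rfl

/-- Congruent propositions have the same interpretation. -/
theorem FmEq.cand_eq {A B : AFm Ω 𝔠} (h : FmEq E A B) (v : Val (skolemSig Ω 𝔠) (HA2 Ω ∪ E)) :
    A.cand v = B.cand v := by
  unfold Fm.cand at *
  induction h generalizing v with
  | rule h s => rw [Fm.interp_subst, Fm.interp_subst]; exact h.cand_eq _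
  | refl => rfl
  | symm _ ih => exact (ih v).symm
  | trans _ _ ih ih' => exact (ih v).trans (ih' v)
  | eq h h' => simp only [Fm.interp, Tm.eval_eq_of_tmEq h, Tm.eval_eq_of_tmEq h']
  | nat h => simp only [Fm.interp, Tm.eval_eq_of_tmEq h]
  | null h => rfl
  | mem h h' => simp only [Fm.interp, Tm.eval_eq_of_tmEq h, h'.interp_eq]
  | and _ _ ih ih' => simp only [Fm.interp, ih, ih']
  | or _ _ ih ih' => simp only [Fm.interp, ih, ih']
  | imp _ _ ih ih' => simp only [Fm.interp, ih, ih']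
  | allI _ ih => simp only [Fm.interp, ih]
  | exI _ ih => simp only [Fm.interp, ih]
  | allK _ ih => simp only [Fm.interp, ih]
  | exK _ ih => simp only [Fm.interp, ih]

instance : Nonempty (Dom (HA2 Ω ∪ E)) := ⟨⟦.zero⟧⟩

open Pf

/-- Every proof belongs to the interpretation of the proposition that it proves. -/
theorem Proves.mem_cand {Γ : List (AFm Ω 𝔠)} {a : Pf Ω (skolemSig Ω 𝔠)} {A : AFm Ω 𝔠}
    (h : Proves (FmEq E) Γ a A) (v : Val (skolemSig Ω 𝔠) (HA2 Ω ∪ E)) (s : Sub Ω (skolemSig Ω 𝔠))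
    (θ : ℕ → Pf Ω (skolemSig Ω 𝔠))
    (hθ : ∀ n (B : AFm Ω 𝔠), Γ[n]? = some B → θ n ∈ B.cand v) : (a.tsubst s).subst θ ∈ A.cand v := by
  have cons {Γ : List (AFm Ω 𝔠)} {v : Val (skolemSig Ω 𝔠) (HA2 Ω ∪ E)} {θ : ℕ → Pf Ω _}
      {A : AFm Ω 𝔠} {d : Pf Ω _} (hd : d ∈ A.cand v) (hθ : ∀ n (B : AFm Ω 𝔠), Γ[n]? = some B → θ n ∈ B.cand v)
      (n) (B : AFm Ω 𝔠) (hB : (A :: Γ)[n]? = some B) : cons d θ n ∈ B.cand v := by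
    cases n with
    | zero => simp only [List.getElem?_cons_zero, Option.some.injEq] at hB; exact hB ▸ hd
    | succ n => exact hθ n B hB
  have shiftI {Γ : List (AFm Ω 𝔠)} {v : Val (skolemSig Ω 𝔠) (HA2 Ω ∪ E)} {θ : ℕ → Pf Ω _}
      (hθ : ∀ n (B : AFm Ω 𝔠), Γ[n]? = some B → θ n ∈ B.cand v) (d) (n) (B : AFm Ω 𝔠)
      (hB : (Γ.map (Fm.subst (Sub.shiftI 1)))[n]? = some B) : θ n ∈ B.cand (v.consI d) := by
    rw [List.getElem?_map, Option.map_eq_some_iff] at hB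
    obtain ⟨C, hC, rfl⟩ := hB
    rw [Fm.cand, Fm.interp_shiftI]; exact hθ n C hC
  have shiftK {Γ : List (AFm Ω 𝔠)} {v : Val (skolemSig Ω 𝔠) (HA2 Ω ∪ E)} {θ : ℕ → Pf Ω _}
      (hθ : ∀ n (B : AFm Ω 𝔠), Γ[n]? = some B → θ n ∈ B.cand v) (X) (n) (B : AFm Ω 𝔠)
      (hB : (Γ.map (Fm.subst Sub.shiftK))[n]? = some B) : θ n ∈ B.cand (v.consK X) := by
    rw [List.getElem?_map, Option.map_eq_some_iff] at hB
    obtain ⟨C, hC, rfl⟩ := hB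
    rw [Fm.cand, Fm.interp_shiftK]; exact hθ n C hC
  have liftI_lift (θ : ℕ → Pf Ω (skolemSig Ω 𝔠)) : lift (liftI θ) = liftI (lift θ) := by
    funext n; cases n <;> simp [liftI, lift, Pf.tsubst, rename_tsubst]
  have liftK_lift (θ : ℕ → Pf Ω (skolemSig Ω 𝔠)) : lift (liftK θ) = liftK (lift θ) := by
    funext n; cases n <;> simp [liftK, lift, Pf.tsubst, rename_tsubst]
  induction h generalizing v s θ with
  | ax h e => rw [← e.cand_eq]; exact hθ _ _ h
  | topI e => rw [e.cand_eq]; exact Cand.triv_mem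
  | botE e h ih => exact Cand.botE_mem (Cand.sn _ (ih v s θ hθ))
  | andI e h₁ h₂ ih₁ ih₂ => rw [e.cand_eq]; exact Cand.pair_mem (ih₁ v s θ hθ) (ih₂ v s θ hθ)
  | andE₁ e h ih => have := ih v s θ hθ; rw [e.cand_eq] at this; exact Cand.fst_mem this
  | andE₂ e h ih => have := ih v s θ hθ; rw [e.cand_eq] at this; exact Cand.snd_mem this
  | orI₁ e h ih => rw [e.cand_eq]; exact Cand.inl_mem (ih v s θ hθ)
  | orI₂ e h ih => rw [e.cand_eq]; exact Cand.inr_mem (ih v s θ hθ)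
  | orE e h₁ h₂ h₃ ih₁ ih₂ ih₃ =>
    have := ih₁ v s θ hθ
    rw [e.cand_eq] at this
    refine Cand.case_mem this (fun d hd => ?_) (fun d hd => ?_)
    · rw [inst_subst_lift]; exact ih₂ v s _ (cons hd hθ)
    · rw [inst_subst_lift]; exact ih₃ v s _ (cons hd hθ)
  | impI e h ih =>
    rw [e.cand_eq]
    refine Cand.lam_mem fun d hd => ?_
    rw [inst_subst_lift]; exact ih v s _ (cons hd hθ)
  | impE e h₁ h₂ ih₁ ih₂ =>
    have := ih₁ v s θ hθ
    rw [e.cand_eq] at this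
    exact Cand.app_mem this (ih₂ v s θ hθ)
  -- The term t enters the substitution `s` and the unrelated value d enters the valuation. This is
  -- why the statement quantifies over both separately.
  | allI e h ih =>
    rw [e.cand_eq]
    refine Cand.lamI_mem fun t d => ?_
    rw [subst_liftI_tsubst_instI, tsubst_tsubst]
    exact ih _ _ _ (shiftI hθ d)
  | allE e e' h ih =>
    have := ih v s θ hθ
    rw [e.cand_eq] at this
    rw [e'.cand_eq, Fm.cand, Fm.interp_instI]
    exact Cand.appI_mem this _ _
  | exI e e' h ih =>
    have := ih v s θ hθ
    rw [e'.cand_eq, Fm.cand, Fm.interp_instI] at this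
    rw [e.cand_eq]
    exact Cand.packI_mem (F := fun d => Fm.cand (v.consI d) _) _ this
  | exE e h₁ h₂ ih₁ ih₂ =>
    have := ih₁ v s θ hθ
    rw [e.cand_eq] at this
    refine Cand.unpackI_mem this fun t d x hx => ?_
    rw [liftI_lift, subst_liftI_tsubst_instI, tsubst_tsubst, inst_subst_lift]
    have := ih₂ (v.consI d) (s.liftI.comp (Sub.instI t)) _ (cons hx (shiftI hθ d))
    rwa [Fm.cand, Fm.interp_shiftI] at this
  | allKI e h ih =>
    rw [e.cand_eq]
    refine Cand.lamK_mem fun t d => ?_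
    rw [subst_liftK_tsubst_instK, tsubst_tsubst]
    exact ih _ _ _ (shiftK hθ d)
  | allKE e e' h ih =>
    have := ih v s θ hθ
    rw [e.cand_eq] at this
    rw [e'.cand_eq, Fm.cand, Fm.interp_instK]
    exact Cand.appK_mem this _ _
  | exKI e e' h ih =>
    have := ih v s θ hθ
    rw [e'.cand_eq, Fm.cand, Fm.interp_instK] at this
    rw [e.cand_eq]
    exact Cand.packK_mem (F := fun d => Fm.cand (v.consK d) _) _ this
  | exKE e h₁ h₂ ih₁ ih₂ =>
    have := ih₁ v s θ hθ
    rw [e.cand_eq] at this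
    refine Cand.unpackK_mem this fun t d x hx => ?_
    rw [liftK_lift, subst_liftK_tsubst_instK, tsubst_tsubst, inst_subst_lift]
    have := ih₂ (v.consK d) (s.liftK.comp (Sub.instK t)) _ (cons hx (shiftK hθ d))
    rwa [Fm.cand, Fm.interp_shiftK] at this

/-- Proofs are strongly normalizing. -/
theorem Proves.stronglyNormalizing {Γ : List (AFm Ω 𝔠)} {a : Pf Ω (skolemSig Ω 𝔠)} {A : AFm Ω 𝔠}
    (h : Proves (FmEq E) Γ a A) : a.StronglyNormalizing :=
  -- Any valuation serves, and the hypotheses are instantiated by variables, which every candidate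
  -- contains.
  (Cand.sn _ (h.mem_cand ⟨fun _ => ⟦.zero⟧, fun _ _ => Cand.snCand⟩ Sub.id .var
    fun _ _ _ => Cand.var_mem _ _)).of_subst.of_tsubst

end Soundness

/-! ## Inversion of the congruence on propositions -/

section Head

variable {Ω : Sig} {𝔠 : Comprehension} {E : Set (Tm Ω × Tm Ω)}

/-- No rule rewrites a class, so congruent classes differ only in the arguments of Skolem symbols,
and a variable is congruent to itself alone. -/
theorem ClEq.var_iff {K : ClassSig} {R : Set (Tm Ω × Tm Ω)} {c d : Cl Ω K} (h : ClEq R c d)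
    (n : ℕ) : c = .var n ↔ d = .var n := by
  induction h with
  | refl => rfl
  | symm _ ih => exact ih.symm
  | trans _ _ ih ih' => exact ih.trans ih'
  | sk => simp

/-- `A` and `B` have the same outermost symbol and congruent immediate components. -/
inductive Head (E : Set (Tm Ω × Tm Ω)) : AFm Ω 𝔠 → AFm Ω 𝔠 → Prop
  | eq {t t' u u' : Tm Ω} : TmEq (HA2 Ω ∪ E) t t' → TmEq (HA2 Ω ∪ E) u u' →
      Head E (.eq t u) (.eq t' u')
  | nat {t t' : Tm Ω} : TmEq (HA2 Ω ∪ E) t t' → Head E (.nat t) (.nat t')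
  | null {t t' : Tm Ω} : TmEq (HA2 Ω ∪ E) t t' → Head E (.null t) (.null t')
  | mem {t t' : Tm Ω} {c c' : ACl Ω 𝔠} : TmEq (HA2 Ω ∪ E) t t' → ClEq (HA2 Ω ∪ E) c c' →
      Head E (.mem t c) (.mem t' c')
  | top : Head E .top .top
  | bot : Head E .bot .bot
  | and {A A' B B' : AFm Ω 𝔠} : FmEq E A A' → FmEq E B B' → Head E (.and A B) (.and A' B')
  | or {A A' B B' : AFm Ω 𝔠} : FmEq E A A' → FmEq E B B' → Head E (.or A B) (.or A' B')
  | imp {A A' B B' : AFm Ω 𝔠} : FmEq E A A' → FmEq E B B' → Head E (.imp A B) (.imp A' B')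
  | allI {A A' : AFm Ω 𝔠} : FmEq E A A' → Head E (.allI A) (.allI A')
  | exI {A A' : AFm Ω 𝔠} : FmEq E A A' → Head E (.exI A) (.exI A')
  | allK {A A' : AFm Ω 𝔠} : FmEq E A A' → Head E (.allK A) (.allK A')
  | exK {A A' : AFm Ω 𝔠} : FmEq E A A' → Head E (.exK A) (.exK A')

namespace Head

theorem refl (A : AFm Ω 𝔠) : Head E A A := by
  cases A <;> constructor <;> exact .refl _

theorem symm {A B : AFm Ω 𝔠} (h : Head E A B) : Head E B A := by
  cases h <;> constructor <;> apply_rules [TmEq.symm, FmEq.symm, ClEq.symm]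

theorem trans {A B C : AFm Ω 𝔠} (h : Head E A B) (h' : Head E B C) : Head E A C := by
  cases h <;> cases h' <;> constructor <;>
    first | exact TmEq.trans ‹_› ‹_› | exact ClEq.trans ‹_› ‹_› | exact FmEq.trans ‹_› ‹_›

theorem subst_arg {s s' : Sub Ω (skolemSig Ω 𝔠)} (h : ∀ n, TmEq (HA2 Ω ∪ E) (s.tm n) (s'.tm n))
    (h' : ∀ n, ClEq (HA2 Ω ∪ E) (s.cl n) (s'.cl n)) (A : AFm Ω 𝔠) :
    Head E (A.subst s) (A.subst s') := by
  have H (A : AFm Ω 𝔠) := FmEq.subst_arg (E := E) h h' A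
  cases A with
  | eq t u => exact .eq (.subst_arg h _) (.subst_arg h _)
  | nat t => exact .nat (.subst_arg h _)
  | null t => exact .null (.subst_arg h _)
  | mem t c => exact .mem (.subst_arg h _) (.subst_arg h h' _)
  | top => exact .top
  | bot => exact .bot
  | and A B => exact .and (H A) (H B)
  | or A B => exact .or (H A) (H B)
  | imp A B => exact .imp (H A) (H B)
  | allI A => exact .allI (FmEq.subst_arg (fun n => by
      cases n with
      | zero => exact .refl _
      | succ n => exact (h n).subst _) (fun n => (h' n).subst _) A)
  | exI A => exact .exI (FmEq.subst_arg (fun n => by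
      cases n with
      | zero => exact .refl _
      | succ n => exact (h n).subst _) (fun n => (h' n).subst _) A)
  | allK A => exact .allK (FmEq.subst_arg (s := s.liftK) (s' := s'.liftK) h (fun n => by
      cases n with
      | zero => exact .refl _
      | succ n => exact (h' n).subst _) A)
  | exK A => exact .exK (FmEq.subst_arg (s := s.liftK) (s' := s'.liftK) h (fun n => by
      cases n with
      | zero => exact .refl _
      | succ n => exact (h' n).subst _) A)

end Head

/-- The definition of `t = u`. -/
def eqDef (t u : Tm Ω) : AFm Ω 𝔠 := .allK (.imp (.mem t (.var 0)) (.mem u (.var 0)))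

/-- `∀y (N(y) ⇒ y ε X ⇒ S(y) ε X)`, where `X` is the variable of sort `κ` number `j`. -/
def stepFm (j : ℕ) : AFm Ω 𝔠 :=
  .allI (.imp (.nat (.var 0)) (.imp (.mem (.var 0) (.var j)) (.mem (.succ (.var 0)) (.var j))))

/-- The definition of `N(t)`. -/
def natDef (t : Tm Ω) : AFm Ω 𝔠 :=
  .allK (.imp (.mem .zero (.var 0)) (.imp (stepFm 0) (.mem t (.var 0))))

theorem FmEq.eqDef (t u : Tm Ω) : FmEq (𝔠 := 𝔠) E (.eq t u) (eqDef t u) :=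
  .rule .eq ⟨fun n => match n with | 0 => t | _ => u, .var⟩

theorem FmEq.natDef (t : Tm Ω) : FmEq (𝔠 := 𝔠) E (.nat t) (natDef t) :=
  .rule .nat ⟨fun _ => t, .var⟩

open Classical in
/-- The unfolding of an atomic proposition that is not a membership. -/
noncomputable def hdAtom (E : Set (Tm Ω × Tm Ω)) : AFm Ω 𝔠 → AFm Ω 𝔠
  | .eq t u => eqDef t u
  | .nat t => natDef t
  | .null t =>
    -- The tests concern the congruence class of t rather than its syntax, so that congruent
    -- arguments of `Null` unfold alike.
    if TmEq (HA2 Ω ∪ E) t .zero then .top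
    else if ∃ u, TmEq (HA2 Ω ∪ E) t (.succ u) then .bot else .null t
  | A => A

/-- The substitution of the arguments of a Skolem symbol for its parameters. -/
def Skolem.sub (s : Skolem Ω 𝔠) (t : Tm Ω) (a : Fin s.p → Tm Ω) (b : Fin s.m → ACl Ω 𝔠) :
    Sub Ω (skolemSig Ω 𝔠) where
  tm n := match n with
    | 0 => t
    | n + 1 => if h : n < s.p then a ⟨n, h⟩ else t
  cl n := if h : n < s.m then b ⟨n, h⟩ else .var 0

/-- The unfolding of an instance of the body `B` of a Skolem symbol; `f` unfolds the memberships
in its arguments of sort `κ`. -/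
noncomputable def hdBody (E : Set (Tm Ω × Tm Ω)) {m : ℕ} (f : Fin m → Tm Ω → AFm Ω 𝔠)
    (s : Sub Ω (skolemSig Ω 𝔠)) : Fm Ω ClassSig.none → AFm Ω 𝔠
  -- The default is never reached: in a Skolem body the class variables have indices below m.
  | .mem u (.var j) => if h : j < m then f ⟨j, h⟩ (u.subst s.tm) else .top
  | B => hdAtom E (B.embed.subst s)

/-- The unfolding of `t ε c`. -/
noncomputable def hdMem (E : Set (Tm Ω × Tm Ω)) : ACl Ω 𝔠 → Tm Ω → AFm Ω 𝔠
  | .var n, t => .mem t (.var n)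
  -- A body can contain memberships only in class variables. When it is itself such a membership,
  -- unfolding continues in one of the arguments b, which is structurally smaller; otherwise it
  -- stops after `hdAtom`. So unfolding terminates even with impredicative comprehension.
  | .sk s a b, t =>
    hdBody E (m := Skolem.m s) (fun j => hdMem E (b j)) (Skolem.sub s t a b) (Skolem.body s)

/-- The unfolding of atomic propositions until a connective, a quantifier, a membership in a
variable or an irreducible instance of `Null` appears. -/
noncomputable def hd (E : Set (Tm Ω × Tm Ω)) : AFm Ω 𝔠 → AFm Ω 𝔠
  | .mem t c => hdMem E c t
  | A => hdAtom E A

theorem Head.hdAtom {A B : AFm Ω 𝔠} (h : Head E A B) : Head E (hdAtom E A) (hdAtom E B) := by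
  cases h with
  | eq h h' => exact .allK (.imp (.mem h (.refl _)) (.mem h' (.refl _)))
  | nat h => exact .allK (.imp (.refl _) (.imp (.refl _) (.mem h (.refl _))))
  | @null t t' h =>
    have h₁ : TmEq (HA2 Ω ∪ E) t .zero ↔ TmEq (HA2 Ω ∪ E) t' .zero := ⟨h.symm.trans, h.trans⟩
    have h₂ : (∃ u, TmEq (HA2 Ω ∪ E) t (.succ u)) ↔ ∃ u, TmEq (HA2 Ω ∪ E) t' (.succ u) :=
      exists_congr fun u => ⟨h.symm.trans, h.trans⟩
    by_cases h₃ : TmEq (HA2 Ω ∪ E) t' .zero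
    · simp only [DeductionModulo.hdAtom, if_pos h₃, if_pos (h₁.2 h₃)]; exact .top
    · by_cases h₄ : ∃ u, TmEq (HA2 Ω ∪ E) t' (.succ u)
      · simp only [DeductionModulo.hdAtom, if_neg h₃, if_neg (mt h₁.1 h₃), if_pos h₄,
          if_pos (h₂.2 h₄)]
        exact .bot
      · simp only [DeductionModulo.hdAtom, if_neg h₃, if_neg (mt h₁.1 h₃), if_neg h₄,
          if_neg (mt h₂.1 h₄)]
        exact .null h
  | mem h h' => exact .mem h h'
  | top => exact .top
  | bot => exact .bot
  | and h h' => exact .and h h'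
  | or h h' => exact .or h h'
  | imp h h' => exact .imp h h'
  | allI h => exact .allI h
  | exI h => exact .exI h
  | allK h => exact .allK h
  | exK h => exact .exK h

theorem Head.hdBody {m : ℕ} {f f' : Fin m → Tm Ω → AFm Ω 𝔠} {s s' : Sub Ω (skolemSig Ω 𝔠)}
    (hf : ∀ j t t', TmEq (HA2 Ω ∪ E) t t' → Head E (f j t) (f' j t'))
    (h : ∀ n, TmEq (HA2 Ω ∪ E) (s.tm n) (s'.tm n))
    (h' : ∀ n, ClEq (HA2 Ω ∪ E) (s.cl n) (s'.cl n)) (B : Fm Ω ClassSig.none) :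
    Head E (hdBody E f s B) (hdBody E f' s' B) := by
  have H := (Head.subst_arg (E := E) h h' B.embed).hdAtom
  cases B with
  | mem u c =>
    cases c with
    | var j =>
      simp only [DeductionModulo.hdBody]
      split_ifs
      · exact hf _ _ _ (.subst_arg h _)
      · exact .refl _
    | sk s => exact Empty.elim s
  | _ => exact H

theorem Skolem.sub_congr (s : Skolem Ω 𝔠) {t t' : Tm Ω} {a a' : Fin s.p → Tm Ω}
    {b b' : Fin s.m → ACl Ω 𝔠} (h : TmEq (HA2 Ω ∪ E) t t') (ha : ∀ j, TmEq (HA2 Ω ∪ E) (a j) (a' j))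
    (hb : ∀ j, ClEq (HA2 Ω ∪ E) (b j) (b' j)) :
    (∀ n, TmEq (HA2 Ω ∪ E) ((s.sub t a b).tm n) ((s.sub t' a' b').tm n)) ∧
    ∀ n, ClEq (HA2 Ω ∪ E) ((s.sub t a b).cl n) ((s.sub t' a' b').cl n) := by
  refine ⟨fun n => ?_, fun n => ?_⟩
  · cases n with
    | zero => exact h
    | succ n =>
      simp only [Skolem.sub]
      split_ifs
      exacts [ha _, h]
  · simp only [Skolem.sub]
    split_ifs
    exacts [hb _, .refl _]

/-- The reflexive case of the next lemma still has two different, congruent elements, hence this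
separate induction on the class. -/
theorem Head.hdMem_refl (c : ACl Ω 𝔠) {t t' : Tm Ω} (h : TmEq (HA2 Ω ∪ E) t t') :
    Head E (hdMem E c t) (hdMem E c t') := by
  induction c generalizing t t' with
  | var n => exact .mem h (.refl _)
  | sk s a b ih =>
    obtain ⟨h₁, h₂⟩ := Skolem.sub_congr s h (fun j => .refl (a j)) (fun j => .refl (b j))
    exact .hdBody (fun j t t' h => ih j h) h₁ h₂ _

/-- The elements t and t' vary in the induction, since symmetry exchanges them and transitivity
needs an intermediate pair. -/
theorem Head.hdMem {c d : ACl Ω 𝔠} (hcd : ClEq (HA2 Ω ∪ E) c d) {t t' : Tm Ω}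
    (h : TmEq (HA2 Ω ∪ E) t t') : Head E (hdMem E c t) (hdMem E d t') := by
  induction hcd generalizing t t' with
  | refl c => exact .hdMem_refl c h
  | symm _ ih => exact (ih h.symm).symm
  | trans _ _ ih ih' => exact (ih (.refl _)).trans (ih' h)
  | sk s ha hb ih =>
    obtain ⟨h₁, h₂⟩ := Skolem.sub_congr s h ha hb
    exact .hdBody (fun j t t' h => ih j h) h₁ h₂ _

theorem Fm.subst_congr_of_below {K : ClassSig} {s s' : Sub Ω K} {p m : ℕ}
    (h : ∀ n < p, s.tm n = s'.tm n) (h' : ∀ n < m, s.cl n = s'.cl n) {A : Fm Ω K}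
    (hA : A.Below p m) : A.subst s = A.subst s' := by
  have hI {s s' : Sub Ω K} {p : ℕ} (h : ∀ n < p, s.tm n = s'.tm n) :
      ∀ n < p + 1, s.liftI.tm n = s'.liftI.tm n := by
    intro n hn
    cases n with
    | zero => rfl
    | succ n => simp only [Sub.liftI]; rw [h n (by omega)]
  have hI' {s s' : Sub Ω K} {m : ℕ} (h : ∀ n < m, s.cl n = s'.cl n) :
      ∀ n < m, s.liftI.cl n = s'.liftI.cl n := by
    intro n hn; simp only [Sub.liftI]; rw [h n hn]
  have hK {s s' : Sub Ω K} {m : ℕ} (h : ∀ n < m, s.cl n = s'.cl n) :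
      ∀ n < m + 1, s.liftK.cl n = s'.liftK.cl n := by
    intro n hn
    cases n with
    | zero => rfl
    | succ n => simp only [Sub.liftK]; rw [h n (by omega)]
  induction A generalizing s s' p m with
  | eq t u => simp only [subst]; rw [t.subst_congr_of_below h hA.1, u.subst_congr_of_below h hA.2]
  | nat t => simp only [subst]; rw [t.subst_congr_of_below h hA]
  | null t => simp only [subst]; rw [t.subst_congr_of_below h hA]
  | mem t c =>
    simp only [subst]; rw [t.subst_congr_of_below h hA.1, c.subst_congr_of_below h h' hA.2]
  | top => rfl
  | bot => rfl
  | and A B ih ih' => simp only [subst]; rw [ih h h' hA.1, ih' h h' hA.2]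
  | or A B ih ih' => simp only [subst]; rw [ih h h' hA.1, ih' h h' hA.2]
  | imp A B ih ih' => simp only [subst]; rw [ih h h' hA.1, ih' h h' hA.2]
  | allI A ih => exact congrArg Fm.allI (ih (hI h) (hI' h') hA)
  | exI A ih => exact congrArg Fm.exI (ih (hI h) (hI' h') hA)
  | allK A ih => exact congrArg Fm.allK (ih h (hK h') hA)
  | exK A ih => exact congrArg Fm.exK (ih h (hK h') hA)

theorem Fm.Below.embed {K : ClassSig} {p m : ℕ} {A : Fm Ω ClassSig.none} (h : A.Below p m) :
    (A.embed : Fm Ω K).Below p m := by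
  induction A generalizing p m with
  | mem t c =>
    cases c with
    | var n => exact h
    | sk s => exact Empty.elim s
  | and A B ih ih' => exact ⟨ih h.1, ih' h.2⟩
  | or A B ih ih' => exact ⟨ih h.1, ih' h.2⟩
  | imp A B ih ih' => exact ⟨ih h.1, ih' h.2⟩
  | allI A ih => exact ih (p := p + 1) h
  | exI A ih => exact ih (p := p + 1) h
  | allK A ih => exact ih (m := m + 1) h
  | exK A ih => exact ih (m := m + 1) h
  | _ => exact h

/-- The unfolding of an instance of a comprehension rule. -/
theorem hdMem_sk (s : Skolem Ω 𝔠) (σ : Sub Ω (skolemSig Ω 𝔠)) :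
    hdMem E (Cl.sk (K := skolemSig Ω 𝔠) s (fun i : Fin s.p => σ.tm ((i : ℕ) + 1))
      (fun j : Fin s.m => σ.cl (j : ℕ))) (σ.tm 0) = hd E (s.body.embed.subst σ) := by
  have h₁ : ∀ n < s.p + 1, (s.sub (σ.tm 0) (fun i : Fin s.p => σ.tm ((i : ℕ) + 1))
      (fun j : Fin s.m => σ.cl (j : ℕ))).tm n = σ.tm n := by
    intro n hn
    cases n with
    | zero => rfl
    | succ n =>
      simp only [Nat.add_lt_add_iff_right] at hn
      simp only [Skolem.sub, hn, dif_pos]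
  have h₂ : ∀ n < s.m, (s.sub (σ.tm 0) (fun i : Fin s.p => σ.tm ((i : ℕ) + 1))
      (fun j : Fin s.m => σ.cl (j : ℕ))).cl n = σ.cl n := by
    intro n hn
    simp only [Skolem.sub, hn, dif_pos]
  have h₃ := congrArg (hdAtom E) (Fm.subst_congr_of_below h₁ h₂ (Fm.Below.embed s.below))
  have hb := s.below
  simp only [hdMem]
  -- Only a membership body needs care, as its unfolding goes on inside a class argument; for the
  -- other shapes both sides are `hdAtom` of the instantiated body.
  generalize s.body = B at h₃ hb ⊢
  cases B with
  | mem u c =>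
    cases c with
    | var j =>
      have hj : j < s.m := hb.2
      simp only [hdBody, hj, dif_pos]
      rw [Tm.subst_congr_of_below h₁ hb.1]
      rfl
    | sk s => exact Empty.elim s
  | _ => exact h₃

/-- Congruent propositions have unfoldings with the same outermost symbol. -/
theorem FmEq.head (hE : ∀ t : Tm Ω, ¬ TmEq (HA2 Ω ∪ E) Tm.zero (Tm.succ t)) {A B : AFm Ω 𝔠}
    (h : FmEq E A B) : Head E (hd E A) (hd E B) := by
  induction h with
  | @rule l r h s =>
    -- The two sides of a rule unfold to the very same proposition. The compatibility cases for
    -- connectives and quantifiers need no induction hypothesis, because `hd` is the identity there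
    -- and `Head` asks only for congruent components.
    suffices H : hd E (l.subst s) = hd E (r.subst s) by rw [H]; exact .refl _
    cases h with
    | mem s' => exact hdMem_sk s' s
    | eq => rfl
    | nat => rfl
    | nullZero => exact if_pos (TmEq.refl _)
    -- Here it matters that 0 is congruent to no successor: otherwise `Null` of a successor could
    -- unfold to ⊤.
    | nullSucc =>
      exact (if_neg fun h : TmEq _ _ _ => hE _ h.symm).trans (if_pos ⟨_, TmEq.refl _⟩)
  | refl => exact .refl _
  | symm _ ih => exact ih.symm
  | trans _ _ ih ih' => exact ih.trans ih'
  | eq h h' => exact (Head.eq h h').hdAtom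
  | nat h => exact (Head.nat h).hdAtom
  | null h => exact (Head.null h).hdAtom
  | mem h h' => exact .hdMem h' h
  | and h h' => exact .and h h'
  | or h h' => exact .or h h'
  | imp h h' => exact .imp h h'
  | allI h => exact .allI h
  | exI h => exact .exI h
  | allK h => exact .allK h
  | exK h => exact .exK h

end Head

open Pf

/-! ### Inversion of congruence and subject reduction -/

section Typing

variable {Ω : Sig} {𝔠 : Comprehension} {E : Set (Tm Ω × Tm Ω)}

/-- No successor is congruent to `0`. -/
abbrev ZeroNeSucc (E : Set (Tm Ω × Tm Ω)) : Prop :=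
  ∀ t : Tm Ω, ¬ TmEq (HA2 Ω ∪ E) Tm.zero (Tm.succ t)

namespace FmEq

theorem and_inv (hE : ZeroNeSucc E) {A A' B B' : AFm Ω 𝔠} (h : FmEq E (.and A B) (.and A' B')) :
    FmEq E A A' ∧ FmEq E B B' := by
  cases (show Head E (.and A B) (.and A' B') from h.head hE) with
  | and h h' => exact ⟨h, h'⟩

theorem or_inv (hE : ZeroNeSucc E) {A A' B B' : AFm Ω 𝔠} (h : FmEq E (.or A B) (.or A' B')) :
    FmEq E A A' ∧ FmEq E B B' := by
  cases (show Head E (.or A B) (.or A' B') from h.head hE) with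
  | or h h' => exact ⟨h, h'⟩

theorem imp_inv (hE : ZeroNeSucc E) {A A' B B' : AFm Ω 𝔠} (h : FmEq E (.imp A B) (.imp A' B')) :
    FmEq E A A' ∧ FmEq E B B' := by
  cases (show Head E (.imp A B) (.imp A' B') from h.head hE) with
  | imp h h' => exact ⟨h, h'⟩

theorem allI_inv (hE : ZeroNeSucc E) {A A' : AFm Ω 𝔠} (h : FmEq E (.allI A) (.allI A')) :
    FmEq E A A' := by
  cases (show Head E (.allI A) (.allI A') from h.head hE) with
  | allI h => exact h

theorem exI_inv (hE : ZeroNeSucc E) {A A' : AFm Ω 𝔠} (h : FmEq E (.exI A) (.exI A')) :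
    FmEq E A A' := by
  cases (show Head E (.exI A) (.exI A') from h.head hE) with
  | exI h => exact h

theorem allK_inv (hE : ZeroNeSucc E) {A A' : AFm Ω 𝔠} (h : FmEq E (.allK A) (.allK A')) :
    FmEq E A A' := by
  cases (show Head E (.allK A) (.allK A') from h.head hE) with
  | allK h => exact h

theorem exK_inv (hE : ZeroNeSucc E) {A A' : AFm Ω 𝔠} (h : FmEq E (.exK A) (.exK A')) :
    FmEq E A A' := by
  cases (show Head E (.exK A) (.exK A') from h.head hE) with
  | exK h => exact h

/-- Membership in a variable is its own unfolding, so congruence can only act on the element. -/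
theorem mem_var_inv (hE : ZeroNeSucc E) {t u : Tm Ω} {i j : ℕ}
    (h : FmEq (𝔠 := 𝔠) E (.mem t (.var i)) (.mem u (.var j))) :
    TmEq (HA2 Ω ∪ E) t u ∧ i = j := by
  cases (show Head (𝔠 := 𝔠) E (.mem t (.var i)) (.mem u (.var j)) from h.head hE) with
  | mem h h' =>
    have := (h'.var_iff i).1 rfl
    simp only [Cl.var.injEq] at this
    exact ⟨h, this.symm⟩

end FmEq

/-- The kinds of unfolded propositions. -/
inductive Tag
  | eq | nat | null | mem | top | bot | and | or | imp | allI | exI | allK | exK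

/-- The outermost symbol of a proposition. -/
def Fm.symb {K : ClassSig} : Fm Ω K → Tag
  | .eq _ _ => .eq
  | .nat _ => .nat
  | .null _ => .null
  | .mem _ _ => .mem
  | .top => .top
  | .bot => .bot
  | .and _ _ => .and
  | .or _ _ => .or
  | .imp _ _ => .imp
  | .allI _ => .allI
  | .exI _ => .exI
  | .allK _ => .allK
  | .exK _ => .exK

/-- The outermost symbol of the unfolding of a proposition. -/
noncomputable def Fm.tag (E : Set (Tm Ω × Tm Ω)) (A : AFm Ω 𝔠) : Tag := (hd E A).symb

theorem Head.symb_eq {A B : AFm Ω 𝔠} (h : Head E A B) : A.symb = B.symb := by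
  cases h <;> rfl

/-- The tag is an invariant of congruence; distinct tags refute a congruence in the analysis of
normal proofs. -/
theorem FmEq.tag_eq (hE : ZeroNeSucc E) {A B : AFm Ω 𝔠} (h : FmEq E A B) : A.tag E = B.tag E :=
  (h.head hE).symb_eq

/-! ## Substitution in derivations -/

theorem map_shiftI_instI {K : ClassSig} (Γ : List (Fm Ω K)) (t : Tm Ω) :
    (Γ.map (Fm.subst (Sub.shiftI 1))).map (Fm.subst (Sub.instI t)) = Γ := by
  rw [List.map_map]
  refine (List.map_congr_left fun A _ => ?_).trans (List.map_id Γ)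
  simp only [Function.comp_apply, Fm.subst_subst, Sub.shiftI_comp_instI, Fm.subst_id, id]

theorem map_shiftK_instK {K : ClassSig} (Γ : List (Fm Ω K)) (c : Cl Ω K) :
    (Γ.map (Fm.subst Sub.shiftK)).map (Fm.subst (Sub.instK c)) = Γ := by
  rw [List.map_map]
  refine (List.map_congr_left fun A _ => ?_).trans (List.map_id Γ)
  simp only [Function.comp_apply, Fm.subst_subst, Sub.shiftK_comp_instK, Fm.subst_id, id]

namespace Proves

/-- Introductions absorb the conversion in their own side condition. The eliminations of ∧ and ⇒
absorb it in the major premise, those of ∨ and ∃ pass it to the minor premises. Eliminations of ∀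
carry a second side condition, because a conversion of the instance A(t/x) need not come from a
conversion of A. -/
theorem conv {Γ : List (AFm Ω 𝔠)} {a : Pf Ω (skolemSig Ω 𝔠)} {A B : AFm Ω 𝔠}
    (h : Proves (FmEq E) Γ a A) (e : FmEq E A B) : Proves (FmEq E) Γ a B := by
  induction h generalizing B with
  | ax h e' => exact .ax h (e'.trans e)
  | topI e' => exact .topI (e.symm.trans e')
  | botE e' h => exact .botE e' h
  | andI e' h₁ h₂ => exact .andI (e.symm.trans e') h₁ h₂
  | andE₁ e' h => exact .andE₁ (e'.trans (.and e (.refl _))) h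
  | andE₂ e' h => exact .andE₂ (e'.trans (.and (.refl _) e)) h
  | orI₁ e' h => exact .orI₁ (e.symm.trans e') h
  | orI₂ e' h => exact .orI₂ (e.symm.trans e') h
  | orE e' h₁ _ _ _ ih₂ ih₃ => exact .orE e' h₁ (ih₂ e) (ih₃ e)
  | impI e' h => exact .impI (e.symm.trans e') h
  | impE e' h₁ h₂ => exact .impE (e'.trans (.imp (.refl _) e)) h₁ h₂
  | allI e' h => exact .allI (e.symm.trans e') h
  | allE e₁ e₂ h => exact .allE e₁ (e.symm.trans e₂) h
  | exI e₁ e₂ h => exact .exI (e.symm.trans e₁) e₂ h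
  | exE e' h₁ _ _ ih₂ => exact .exE e' h₁ (ih₂ (e.subst _))
  | allKI e' h => exact .allKI (e.symm.trans e') h
  | allKE e₁ e₂ h => exact .allKE e₁ (e.symm.trans e₂) h
  | exKI e₁ e₂ h => exact .exKI (e.symm.trans e₁) e₂ h
  | exKE e' h₁ _ _ ih₂ => exact .exKE e' h₁ (ih₂ (e.subst _))

theorem tsubst {Γ : List (AFm Ω 𝔠)} {a : Pf Ω (skolemSig Ω 𝔠)} {A : AFm Ω 𝔠}
    (h : Proves (FmEq E) Γ a A) (s : Sub Ω (skolemSig Ω 𝔠)) :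
    Proves (FmEq E) (Γ.map (Fm.subst s)) (a.tsubst s) (A.subst s) := by
  have hI (Γ : List (AFm Ω 𝔠)) (s : Sub Ω (skolemSig Ω 𝔠)) :
      (Γ.map (Fm.subst (Sub.shiftI 1))).map (Fm.subst s.liftI) =
        (Γ.map (Fm.subst s)).map (Fm.subst (Sub.shiftI 1)) := by
    simp only [List.map_map]
    exact List.map_congr_left fun A _ => by
      simp only [Function.comp_apply, Fm.subst_subst, Sub.shiftI_comp_liftI]
  have hK (Γ : List (AFm Ω 𝔠)) (s : Sub Ω (skolemSig Ω 𝔠)) :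
      (Γ.map (Fm.subst Sub.shiftK)).map (Fm.subst s.liftK) =
        (Γ.map (Fm.subst s)).map (Fm.subst Sub.shiftK) := by
    simp only [List.map_map]
    exact List.map_congr_left fun A _ => by
      simp only [Function.comp_apply, Fm.subst_subst, Sub.shiftK_comp_liftK]
  have iI {A C : AFm Ω 𝔠} {t : Tm Ω} (s) (e : FmEq E C (A.subst (Sub.instI t))) :
      FmEq E (C.subst s) ((A.subst s.liftI).subst (Sub.instI (t.subst s.tm))) := by
    rw [Fm.subst_subst, ← Sub.instI_comp, ← Fm.subst_subst]; exact e.subst s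
  have iK {A C : AFm Ω 𝔠} {c : ACl Ω 𝔠} (s) (e : FmEq E C (A.subst (Sub.instK c))) :
      FmEq E (C.subst s) ((A.subst s.liftK).subst (Sub.instK (c.subst s))) := by
    rw [Fm.subst_subst, ← Sub.instK_comp, ← Fm.subst_subst]; exact e.subst s
  induction h generalizing s with
  | ax h e => exact .ax (by rw [List.getElem?_map, h]; rfl) (e.subst s)
  | topI e => exact .topI (e.subst s)
  | botE e h ih => exact .botE (e.subst s) (ih s)
  | andI e h₁ h₂ ih₁ ih₂ => exact .andI (e.subst s) (ih₁ s) (ih₂ s)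
  | andE₁ e h ih => exact .andE₁ (e.subst s) (ih s)
  | andE₂ e h ih => exact .andE₂ (e.subst s) (ih s)
  | orI₁ e h ih => exact .orI₁ (e.subst s) (ih s)
  | orI₂ e h ih => exact .orI₂ (e.subst s) (ih s)
  | orE e h₁ _ _ ih₁ ih₂ ih₃ => exact .orE (e.subst s) (ih₁ s) (ih₂ s) (ih₃ s)
  | impI e h ih => exact .impI (e.subst s) (ih s)
  | impE e h₁ h₂ ih₁ ih₂ => exact .impE (e.subst s) (ih₁ s) (ih₂ s)
  | allI e h ih => exact .allI (e.subst s) (hI _ s ▸ ih s.liftI)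
  | allE e e' h ih => exact .allE (e.subst s) (iI s e') (ih s)
  | exI e e' h ih => exact .exI (e.subst s) (iI s e') (ih s)
  | exE e h₁ h₂ ih₁ ih₂ =>
    refine .exE (e.subst s) (ih₁ s) ?_
    have := ih₂ s.liftI
    rwa [List.map_cons, hI, Fm.subst_subst, Sub.shiftI_comp_liftI, ← Fm.subst_subst] at this
  | allKI e h ih => exact .allKI (e.subst s) (hK _ s ▸ ih s.liftK)
  | allKE e e' h ih => exact .allKE (e.subst s) (iK s e') (ih s)
  | exKI e e' h ih => exact .exKI (e.subst s) (iK s e') (ih s)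
  | exKE e h₁ h₂ ih₁ ih₂ =>
    refine .exKE (e.subst s) (ih₁ s) ?_
    have := ih₂ s.liftK
    rwa [List.map_cons, hK, Fm.subst_subst, Sub.shiftK_comp_liftK, ← Fm.subst_subst] at this

/-- Renaming of hypotheses. -/
theorem rename {Γ Δ : List (AFm Ω 𝔠)} {a : Pf Ω (skolemSig Ω 𝔠)} {A : AFm Ω 𝔠}
    (h : Proves (FmEq E) Γ a A) {ξ : ℕ → ℕ} (hξ : ∀ n B, Γ[n]? = some B → Δ[ξ n]? = some B) :
    Proves (FmEq E) Δ (a.rename ξ) A := by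
  have cons {Γ Δ : List (AFm Ω 𝔠)} {ξ : ℕ → ℕ} (A : AFm Ω 𝔠)
      (hξ : ∀ n B, Γ[n]? = some B → Δ[ξ n]? = some B) (n) (B : AFm Ω 𝔠)
      (h : (A :: Γ)[n]? = some B) : (A :: Δ)[liftRen ξ n]? = some B := by
    cases n with
    | zero => exact h
    | succ n => exact hξ n B h
  have map {Γ Δ : List (AFm Ω 𝔠)} {ξ : ℕ → ℕ} (f : AFm Ω 𝔠 → AFm Ω 𝔠)
      (hξ : ∀ n B, Γ[n]? = some B → Δ[ξ n]? = some B) (n) (B : AFm Ω 𝔠)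
      (h : (Γ.map f)[n]? = some B) : (Δ.map f)[ξ n]? = some B := by
    rw [List.getElem?_map, Option.map_eq_some_iff] at h ⊢
    obtain ⟨C, hC, rfl⟩ := h
    exact ⟨C, hξ n C hC, rfl⟩
  induction h generalizing Δ ξ with
  | ax h e => exact .ax (hξ _ _ h) e
  | topI e => exact .topI e
  | botE e h ih => exact .botE e (ih hξ)
  | andI e h₁ h₂ ih₁ ih₂ => exact .andI e (ih₁ hξ) (ih₂ hξ)
  | andE₁ e h ih => exact .andE₁ e (ih hξ)
  | andE₂ e h ih => exact .andE₂ e (ih hξ)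
  | orI₁ e h ih => exact .orI₁ e (ih hξ)
  | orI₂ e h ih => exact .orI₂ e (ih hξ)
  | orE e h₁ _ _ ih₁ ih₂ ih₃ => exact .orE e (ih₁ hξ) (ih₂ (cons _ hξ)) (ih₃ (cons _ hξ))
  | impI e h ih => exact .impI e (ih (cons _ hξ))
  | impE e h₁ h₂ ih₁ ih₂ => exact .impE e (ih₁ hξ) (ih₂ hξ)
  | allI e h ih => exact .allI e (ih (map _ hξ))
  | allE e e' h ih => exact .allE e e' (ih hξ)
  | exI e e' h ih => exact .exI e e' (ih hξ)
  | exE e h₁ h₂ ih₁ ih₂ => exact .exE e (ih₁ hξ) (ih₂ (cons _ (map _ hξ)))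
  | allKI e h ih => exact .allKI e (ih (map _ hξ))
  | allKE e e' h ih => exact .allKE e e' (ih hξ)
  | exKI e e' h ih => exact .exKI e e' (ih hξ)
  | exKE e h₁ h₂ ih₁ ih₂ => exact .exKE e (ih₁ hξ) (ih₂ (cons _ (map _ hξ)))

/-- Substitution of proofs for hypotheses. -/
theorem subst {Γ Δ : List (AFm Ω 𝔠)} {a : Pf Ω (skolemSig Ω 𝔠)} {A : AFm Ω 𝔠}
    (h : Proves (FmEq E) Γ a A) {θ : ℕ → Pf Ω (skolemSig Ω 𝔠)}
    (hθ : ∀ n B, Γ[n]? = some B → Proves (FmEq E) Δ (θ n) B) :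
    Proves (FmEq E) Δ (a.subst θ) A := by
  have cons {Γ Δ : List (AFm Ω 𝔠)} {θ : ℕ → Pf Ω (skolemSig Ω 𝔠)} (A : AFm Ω 𝔠)
      (hθ : ∀ n B, Γ[n]? = some B → Proves (FmEq E) Δ (θ n) B) (n) (B : AFm Ω 𝔠)
      (h : (A :: Γ)[n]? = some B) : Proves (FmEq E) (A :: Δ) (lift θ n) B := by
    cases n with
    | zero => exact .ax h (.refl _)
    | succ n => exact (hθ n B h).rename fun _ _ h => h
  have mapI {Γ Δ : List (AFm Ω 𝔠)} {θ : ℕ → Pf Ω (skolemSig Ω 𝔠)}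
      (hθ : ∀ n B, Γ[n]? = some B → Proves (FmEq E) Δ (θ n) B) (n) (B : AFm Ω 𝔠)
      (h : (Γ.map (Fm.subst (Sub.shiftI 1)))[n]? = some B) :
      Proves (FmEq E) (Δ.map (Fm.subst (Sub.shiftI 1))) (liftI θ n) B := by
    rw [List.getElem?_map, Option.map_eq_some_iff] at h
    obtain ⟨C, hC, rfl⟩ := h
    exact (hθ n C hC).tsubst _
  have mapK {Γ Δ : List (AFm Ω 𝔠)} {θ : ℕ → Pf Ω (skolemSig Ω 𝔠)}
      (hθ : ∀ n B, Γ[n]? = some B → Proves (FmEq E) Δ (θ n) B) (n) (B : AFm Ω 𝔠)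
      (h : (Γ.map (Fm.subst Sub.shiftK))[n]? = some B) :
      Proves (FmEq E) (Δ.map (Fm.subst Sub.shiftK)) (liftK θ n) B := by
    rw [List.getElem?_map, Option.map_eq_some_iff] at h
    obtain ⟨C, hC, rfl⟩ := h
    exact (hθ n C hC).tsubst _
  induction h generalizing Δ θ with
  | ax h e => exact (hθ _ _ h).conv e
  | topI e => exact .topI e
  | botE e h ih => exact .botE e (ih hθ)
  | andI e h₁ h₂ ih₁ ih₂ => exact .andI e (ih₁ hθ) (ih₂ hθ)
  | andE₁ e h ih => exact .andE₁ e (ih hθ)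
  | andE₂ e h ih => exact .andE₂ e (ih hθ)
  | orI₁ e h ih => exact .orI₁ e (ih hθ)
  | orI₂ e h ih => exact .orI₂ e (ih hθ)
  | orE e h₁ _ _ ih₁ ih₂ ih₃ => exact .orE e (ih₁ hθ) (ih₂ (cons _ hθ)) (ih₃ (cons _ hθ))
  | impI e h ih => exact .impI e (ih (cons _ hθ))
  | impE e h₁ h₂ ih₁ ih₂ => exact .impE e (ih₁ hθ) (ih₂ hθ)
  | allI e h ih => exact .allI e (ih (mapI hθ))
  | allE e e' h ih => exact .allE e e' (ih hθ)
  | exI e e' h ih => exact .exI e e' (ih hθ)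
  | exE e h₁ h₂ ih₁ ih₂ => exact .exE e (ih₁ hθ) (ih₂ (cons _ (mapI hθ)))
  | allKI e h ih => exact .allKI e (ih (mapK hθ))
  | allKE e e' h ih => exact .allKE e e' (ih hθ)
  | exKI e e' h ih => exact .exKI e e' (ih hθ)
  | exKE e h₁ h₂ ih₁ ih₂ => exact .exKE e (ih₁ hθ) (ih₂ (cons _ (mapK hθ)))

theorem inst {Γ : List (AFm Ω 𝔠)} {a b : Pf Ω (skolemSig Ω 𝔠)} {A B : AFm Ω 𝔠}
    (h : Proves (FmEq E) (A :: Γ) b B) (h' : Proves (FmEq E) Γ a A) :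
    Proves (FmEq E) Γ (inst a b) B := by
  rw [inst_eq]
  refine h.subst fun n C hC => ?_
  cases n with
  | zero =>
    simp only [List.getElem?_cons_zero, Option.some.injEq] at hC
    exact hC ▸ h'
  | succ n => exact .ax hC (.refl _)

theorem instI {Γ : List (AFm Ω 𝔠)} {a : Pf Ω (skolemSig Ω 𝔠)} {A : AFm Ω 𝔠}
    (h : Proves (FmEq E) (Γ.map (Fm.subst (Sub.shiftI 1))) a A) (t : Tm Ω) :
    Proves (FmEq E) Γ (a.tsubst (Sub.instI t)) (A.subst (Sub.instI t)) := by
  have := h.tsubst (Sub.instI t)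
  rwa [map_shiftI_instI] at this

theorem instK {Γ : List (AFm Ω 𝔠)} {a : Pf Ω (skolemSig Ω 𝔠)} {A : AFm Ω 𝔠}
    (h : Proves (FmEq E) (Γ.map (Fm.subst Sub.shiftK)) a A) (c : ACl Ω 𝔠) :
    Proves (FmEq E) Γ (a.tsubst (Sub.instK c)) (A.subst (Sub.instK c)) := by
  have := h.tsubst (Sub.instK c)
  rwa [map_shiftK_instK] at this

/-- Conversion of a hypothesis. -/
theorem conv_hyp {Γ : List (AFm Ω 𝔠)} {a : Pf Ω (skolemSig Ω 𝔠)} {A A' B : AFm Ω 𝔠}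
    (h : Proves (FmEq E) (A :: Γ) a B) (e : FmEq E A' A) : Proves (FmEq E) (A' :: Γ) a B := by
  have := h.subst (Δ := A' :: Γ) (θ := .var) fun n C hC => by
    cases n with
    | zero =>
      simp only [List.getElem?_cons_zero, Option.some.injEq] at hC
      exact .ax rfl (hC ▸ e)
    | succ n => exact .ax hC (.refl _)
  rwa [subst_var] at this

/-- Subject reduction. -/
theorem red (hE : ZeroNeSucc E) {a b : Pf Ω (skolemSig Ω 𝔠)} (hab : Red a b)
    {Γ : List (AFm Ω 𝔠)} {A : AFm Ω 𝔠} (h : Proves (FmEq E) Γ a A) : Proves (FmEq E) Γ b A := by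
  induction hab generalizing Γ A with
  -- The introduction and the elimination of a cut may refer to different, merely congruent
  -- propositions. Inversion makes their components congruent; every cut below uses it.
  | fstPair a b => cases h with
    | andE₁ e h => cases h with
      | andI e' h₁ h₂ => exact h₁.conv ((e'.symm.trans e).and_inv hE).1
  | sndPair a b => cases h with
    | andE₂ e h => cases h with
      | andI e' h₁ h₂ => exact h₂.conv ((e'.symm.trans e).and_inv hE).2
  | caseInl a b c => cases h with
    | orE e h₁ h₂ h₃ => cases h₁ with
      | orI₁ e' h => exact h₂.inst (h.conv ((e'.symm.trans e).or_inv hE).1)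
  | caseInr a b c => cases h with
    | orE e h₁ h₂ h₃ => cases h₁ with
      | orI₂ e' h => exact h₃.inst (h.conv ((e'.symm.trans e).or_inv hE).2)
  | beta a b => cases h with
    | impE e h₁ h₂ => cases h₁ with
      | impI e' h =>
        obtain ⟨e₁, e₂⟩ := (e'.symm.trans e).imp_inv hE
        exact (h.inst (h₂.conv e₁.symm)).conv e₂
  | betaI a t => cases h with
    | allE e e' h => cases h with
      | allI e₁ h =>
        exact (h.instI t).conv ((((e₁.symm.trans e).allI_inv hE).subst _).trans e'.symm)
  | betaK a c => cases h with
    | allKE e e' h => cases h with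
      | allKI e₁ h =>
        exact (h.instK c).conv ((((e₁.symm.trans e).allK_inv hE).subst _).trans e'.symm)
  | unpackPackI t a b => cases h with
    | exE e h₁ h₂ => cases h₁ with
      | exI e₁ e₂ h =>
        -- The eigenvariable is replaced by the witness. Context and conclusion were weakened by it,
        -- so they are restored.
        have h₃ := h₂.tsubst (Sub.instI t)
        rw [List.map_cons, map_shiftI_instI, Fm.subst_subst, Sub.shiftI_comp_instI,
          Fm.subst_id] at h₃
        exact h₃.inst (h.conv (e₂.trans (((e₁.symm.trans e).exI_inv hE).subst _)))
  | unpackPackK c a b => cases h with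
    | exKE e h₁ h₂ => cases h₁ with
      | exKI e₁ e₂ h =>
        have h₃ := h₂.tsubst (Sub.instK c)
        rw [List.map_cons, map_shiftK_instK, Fm.subst_subst, Sub.shiftK_comp_instK,
          Fm.subst_id] at h₃
        exact h₃.inst (h.conv (e₂.trans (((e₁.symm.trans e).exK_inv hE).subst _)))
  | botE _ ih => cases h with
    | botE e h => exact .botE e (ih h)
  | pairL _ ih => cases h with
    | andI e h₁ h₂ => exact .andI e (ih h₁) h₂
  | pairR _ ih => cases h with
    | andI e h₁ h₂ => exact .andI e h₁ (ih h₂)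
  | fst _ ih => cases h with
    | andE₁ e h => exact .andE₁ e (ih h)
  | snd _ ih => cases h with
    | andE₂ e h => exact .andE₂ e (ih h)
  | inl _ ih => cases h with
    | orI₁ e h => exact .orI₁ e (ih h)
  | inr _ ih => cases h with
    | orI₂ e h => exact .orI₂ e (ih h)
  | case₁ _ ih => cases h with
    | orE e h₁ h₂ h₃ => exact .orE e (ih h₁) h₂ h₃
  | case₂ _ ih => cases h with
    | orE e h₁ h₂ h₃ => exact .orE e h₁ (ih h₂) h₃
  | case₃ _ ih => cases h with
    | orE e h₁ h₂ h₃ => exact .orE e h₁ h₂ (ih h₃)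
  | lam _ ih => cases h with
    | impI e h => exact .impI e (ih h)
  | appL _ ih => cases h with
    | impE e h₁ h₂ => exact .impE e (ih h₁) h₂
  | appR _ ih => cases h with
    | impE e h₁ h₂ => exact .impE e h₁ (ih h₂)
  | lamI _ ih => cases h with
    | allI e h => exact .allI e (ih h)
  | appI _ ih => cases h with
    | allE e e' h => exact .allE e e' (ih h)
  | lamK _ ih => cases h with
    | allKI e h => exact .allKI e (ih h)
  | appK _ ih => cases h with
    | allKE e e' h => exact .allKE e e' (ih h)
  | packI _ ih => cases h with
    | exI e e' h => exact .exI e e' (ih h)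
  | unpackIL _ ih => cases h with
    | exE e h₁ h₂ => exact .exE e (ih h₁) h₂
  | unpackIR _ ih => cases h with
    | exE e h₁ h₂ => exact .exE e h₁ (ih h₂)
  | packK _ ih => cases h with
    | exKI e e' h => exact .exKI e e' (ih h)
  | unpackKL _ ih => cases h with
    | exKE e h₁ h₂ => exact .exKE e (ih h₁) h₂
  | unpackKR _ ih => cases h with
    | exKE e h₁ h₂ => exact .exKE e h₁ (ih h₂)

theorem reds (hE : ZeroNeSucc E) {a b : Pf Ω (skolemSig Ω 𝔠)} (hab : Reds a b)
    {Γ : List (AFm Ω 𝔠)} {A : AFm Ω 𝔠} (h : Proves (FmEq E) Γ a A) : Proves (FmEq E) Γ b A := by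
  induction hab with
  | refl => exact h
  | tail _ h' ih => exact ih.red hE h'

end Proves
end Typing

open Pf

/-! ## Normal proofs -/

section NormalProofs

variable {Ω : Sig} {𝔠 : Comprehension} {E : Set (Tm Ω × Tm Ω)}

/-- The outermost symbol of the propositions introduced by the last rule of a proof-term. -/
def Pf.introTag {K : ClassSig} : Pf Ω K → Option Tag
  | .triv => some .top
  | .pair _ _ => some .and
  | .inl _ => some .or
  | .inr _ => some .or
  | .lam _ => some .imp
  | .lamI _ => some .allI
  | .lamK _ => some .allK
  | .packI _ _ => some .exI
  | .packK _ _ => some .exK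
  | _ => none

/-- Hence a normal proof of t ε X, in the contexts considered below, must be a spine. -/
theorem Pf.introTag_ne_mem {K : ClassSig} (a : Pf Ω K) : a.introTag ≠ some .mem := by
  cases a <;> exact nofun

theorem Proves.introTag_eq (hE : ZeroNeSucc E) {Γ : List (AFm Ω 𝔠)} {a : Pf Ω (skolemSig Ω 𝔠)}
    {A : AFm Ω 𝔠} (h : Proves (FmEq E) Γ a A) (ha : a.introTag.isSome) :
    a.introTag = some (A.tag E) := by
  cases h with
  | topI e => rw [e.tag_eq hE]; rfl
  | andI e => rw [e.tag_eq hE]; rfl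
  | orI₁ e => rw [e.tag_eq hE]; rfl
  | orI₂ e => rw [e.tag_eq hE]; rfl
  | impI e => rw [e.tag_eq hE]; rfl
  | allI e => rw [e.tag_eq hE]; rfl
  | allKI e => rw [e.tag_eq hE]; rfl
  | exI e => rw [e.tag_eq hE]; rfl
  | exKI e => rw [e.tag_eq hE]; rfl
  | _ => exact absurd ha Bool.false_ne_true

/-- The hypotheses have the form `t ε X` or `∀y (N(y) ⇒ y ε X ⇒ S(y) ε X)`. -/
def GoodCtx (Γ : List (AFm Ω 𝔠)) : Prop :=
  ∀ B ∈ Γ, (∃ t j, B = .mem t (.var j)) ∨ ∃ j, B = stepFm j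

/-- The elimination proofs with a hypothesis of a context as head. -/
inductive Spine (E : Set (Tm Ω × Tm Ω)) (Γ : List (AFm Ω 𝔠)) :
    Pf Ω (skolemSig Ω 𝔠) → AFm Ω 𝔠 → Prop
  | var {n : ℕ} {A B : AFm Ω 𝔠} : Γ[n]? = some B → FmEq E B A → Spine E Γ (.var n) A
  | appI {n j : ℕ} {u : Tm Ω} {A : AFm Ω 𝔠} : Γ[n]? = some (stepFm j) →
      FmEq E A (.imp (.nat u) (.imp (.mem u (.var j)) (.mem (.succ u) (.var j)))) →
      Spine E Γ (.appI (.var n) u) A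
  | app {n j : ℕ} {u : Tm Ω} {A : AFm Ω 𝔠} {a : Pf Ω (skolemSig Ω 𝔠)} :
      Γ[n]? = some (stepFm j) → Proves (FmEq E) Γ a (.nat u) →
      FmEq E A (.imp (.mem u (.var j)) (.mem (.succ u) (.var j))) →
      Spine E Γ (.app (.appI (.var n) u) a) A
  | app₂ {n j : ℕ} {u : Tm Ω} {A : AFm Ω 𝔠} {a b : Pf Ω (skolemSig Ω 𝔠)} :
      Γ[n]? = some (stepFm j) → Proves (FmEq E) Γ a (.nat u) →
      Proves (FmEq E) Γ b (.mem u (.var j)) → FmEq E A (.mem (.succ u) (.var j)) →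
      Spine E Γ (.app (.app (.appI (.var n) u) a) b) A

theorem Spine.not_nil {a : Pf Ω (skolemSig Ω 𝔠)} {A : AFm Ω 𝔠} : ¬ Spine E [] a A := by
  rintro (h | h | h | h) <;> simp at h

theorem Pf.Normal.of_lam {K : ClassSig} {a : Pf Ω K} (h : (Pf.lam a).Normal) : a.Normal :=
  fun _ hb => h _ (.lam hb)

theorem Pf.Normal.of_lamK {K : ClassSig} {a : Pf Ω K} (h : (Pf.lamK a).Normal) : a.Normal :=
  fun _ hb => h _ (.lamK hb)

/-- The possible types of a hypothesis applied to arguments: never ⊥, a conjunction, a disjunction,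
an existential or a quantification over classes, so those eliminations cannot extend a spine. -/
theorem Spine.tag_eq (hE : ZeroNeSucc E) {Γ : List (AFm Ω 𝔠)} (hΓ : GoodCtx Γ)
    {a : Pf Ω (skolemSig Ω 𝔠)} {A : AFm Ω 𝔠} (h : Spine E Γ a A) :
    A.tag E = .mem ∨ A.tag E = .allI ∨ A.tag E = .imp := by
  cases h with
  | var h e =>
    rw [← e.tag_eq hE]
    rcases hΓ _ (List.mem_of_getElem? h) with ⟨t, j, rfl⟩ | ⟨j, rfl⟩
    exacts [.inl rfl, .inr (.inl rfl)]
  | appI h e => rw [e.tag_eq hE]; exact .inr (.inr rfl)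
  | app h h' e => rw [e.tag_eq hE]; exact .inr (.inr rfl)
  | app₂ h h' h'' e => rw [e.tag_eq hE]; exact .inl rfl

/-- A normal proof is an introduction or a spine. -/
theorem Proves.intro_or_spine (hE : ZeroNeSucc E) {Γ : List (AFm Ω 𝔠)} (hΓ : GoodCtx Γ)
    {a : Pf Ω (skolemSig Ω 𝔠)} {A : AFm Ω 𝔠} (h : Proves (FmEq E) Γ a A) (hn : a.Normal) :
    a.introTag.isSome ∨ Spine E Γ a A := by
  -- If the tag of a major premise is none of those a spine can have, the premise is an introduction
  -- with that tag. The matching elimination would then be a cut, contrary to normality; for ⊥ there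
  -- is no introduction at all.
  have key {a : Pf Ω (skolemSig Ω 𝔠)} {A B : AFm Ω 𝔠} (h : Proves (FmEq E) Γ a A)
      (ih : a.introTag.isSome ∨ Spine E Γ a A) (e : FmEq E A B) (h₁ : B.tag E ≠ .mem)
      (h₂ : B.tag E ≠ .allI) (h₃ : B.tag E ≠ .imp) : a.introTag = some (B.tag E) := by
    rw [← e.tag_eq hE] at *
    rcases ih with ih | ih
    · exact h.introTag_eq hE ih
    · rcases ih.tag_eq hE hΓ with h' | h' | h'
      exacts [absurd h' h₁, absurd h' h₂, absurd h' h₃]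
  induction h with
  | ax h e => exact .inr (.var h e)
  | topI | andI | orI₁ | orI₂ | impI | allI | exI | allKI | exKI => exact .inl rfl
  | botE e h ih =>
    have := key h (ih hΓ (fun b hb => hn _ (.botE hb)) key) e nofun nofun nofun
    rename_i a
    cases a <;> exact nomatch this
  | andE₁ e h ih =>
    have := key h (ih hΓ (fun b hb => hn _ (.fst hb)) key) e nofun nofun nofun
    rename_i a
    cases a with
    | pair => exact absurd (.fstPair _ _) (hn _)
    | _ => exact nomatch this
  | andE₂ e h ih =>
    have := key h (ih hΓ (fun b hb => hn _ (.snd hb)) key) e nofun nofun nofun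
    rename_i a
    cases a with
    | pair => exact absurd (.sndPair _ _) (hn _)
    | _ => exact nomatch this
  | orE e h _ _ ih =>
    have := key h (ih hΓ (fun b hb => hn _ (.case₁ hb)) key) e nofun nofun nofun
    rename_i a _ _ _ _ _ _
    cases a with
    | inl => exact absurd (.caseInl _ _ _) (hn _)
    | inr => exact absurd (.caseInr _ _ _) (hn _)
    | _ => exact nomatch this
  | exE e h _ ih =>
    have := key h (ih hΓ (fun b hb => hn _ (.unpackIL hb)) key) e nofun nofun nofun
    rename_i a _ _ _
    cases a with
    | packI => exact absurd (.unpackPackI _ _ _) (hn _)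
    | _ => exact nomatch this
  | allKE e e' h ih =>
    have := key h (ih hΓ (fun b hb => hn _ (.appK hb)) key) e nofun nofun nofun
    rename_i a _
    cases a with
    | lamK => exact absurd (.betaK _ _) (hn _)
    | _ => exact nomatch this
  | exKE e h _ ih =>
    have := key h (ih hΓ (fun b hb => hn _ (.unpackKL hb)) key) e nofun nofun nofun
    rename_i a _ _ _
    cases a with
    | packK => exact absurd (.unpackPackK _ _ _) (hn _)
    | _ => exact nomatch this
  | allE e e' h ih =>
    rename_i a t
    right
    rcases ih hΓ (fun b hb => hn _ (.appI hb)) key with hi | hs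
    · have := h.introTag_eq hE hi
      rw [e.tag_eq hE] at this
      cases a with
      | lamI => exact absurd (.betaI _ _) (hn _)
      | _ => exact nomatch this
    -- Only an unapplied induction step has the form ∀y; the other heads have the wrong tag.
    · cases hs with
      | var hv e₁ =>
        rcases hΓ _ (List.mem_of_getElem? hv) with ⟨t, j, rfl⟩ | ⟨j, rfl⟩
        · exact nomatch (e₁.trans e).tag_eq hE
        · exact .appI hv (e'.trans (((e₁.trans e).allI_inv hE).symm.subst _))
      | appI hv e₁ => exact nomatch (e₁.symm.trans e).tag_eq hE
      | app hv h' e₁ => exact nomatch (e₁.symm.trans e).tag_eq hE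
      | app₂ hv h' h'' e₁ => exact nomatch (e₁.symm.trans e).tag_eq hE
  | impE e h hb ih ihb =>
    rename_i a b
    right
    rcases ih hΓ (fun b hb => hn _ (.appL hb)) key with hi | hs
    · have := h.introTag_eq hE hi
      rw [e.tag_eq hE] at this
      cases a with
      | lam => exact absurd (.beta _ _) (hn _)
      | _ => exact nomatch this
    · cases hs with
      | var hv e₁ =>
        rcases hΓ _ (List.mem_of_getElem? hv) with ⟨t, j, rfl⟩ | ⟨j, rfl⟩
        · exact nomatch (e₁.trans e).tag_eq hE
        · exact nomatch (e₁.trans e).tag_eq hE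
      | appI hv e₁ =>
        obtain ⟨e₂, e₃⟩ := (e.symm.trans e₁).imp_inv hE
        exact .app hv (hb.conv e₂) e₃
      | app hv h' e₁ =>
        obtain ⟨e₂, e₃⟩ := (e.symm.trans e₁).imp_inv hE
        exact .app₂ hv h' (hb.conv e₂) e₃
      | app₂ hv h' h'' e₁ => exact nomatch (e₁.symm.trans e).tag_eq hE

/-- A normal closed proof of `t = u` exists only if `t` and `u` are congruent. -/
theorem Proves.tmEq_of_eq (hE : ZeroNeSucc E) {a : Pf Ω (skolemSig Ω 𝔠)} {t u : Tm Ω}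
    (h : Proves (FmEq (𝔠 := 𝔠) E) [] a (.eq t u)) (hn : a.Normal) : TmEq (HA2 Ω ∪ E) t u := by
  have hΓ : GoodCtx ([] : List (AFm Ω 𝔠)) := nofun
  have e₀ := FmEq.eqDef (E := E) (𝔠 := 𝔠) t u
  rcases h.intro_or_spine hE hΓ hn with hi | hs
  · have ha := h.introTag_eq hE hi
    cases h with
    | allKI e h₀ =>
      have h := h₀.conv ((e.symm.trans e₀).allK_inv hE)
      have hn := hn.of_lamK
      rcases h.intro_or_spine hE hΓ hn with hi | hs
      · have ha := h.introTag_eq hE hi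
        cases h with
        | impI e h₁ =>
          obtain ⟨e₁, e₂⟩ := (e.symm.trans (.refl _)).imp_inv hE
          have h := (h₁.conv e₂).conv_hyp e₁.symm
          have hn := hn.of_lam
          -- The proof is now λX λα a, with a normal proof of u ε X from t ε X alone. It can only be
          -- the hypothesis, so the two memberships are congruent.
          have hΓ : GoodCtx [(.mem t (.var 0) : AFm Ω 𝔠)] := fun B hB =>
            .inl ⟨t, 0, List.mem_singleton.1 hB⟩
          rcases h.intro_or_spine hE hΓ hn with hi | hs
          · have ha := h.introTag_eq hE hi
            exact (introTag_ne_mem _ ha).elim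
          · cases hs with
            | var hv e =>
              cases List.mem_singleton.1 (List.mem_of_getElem? hv)
              exact (e.mem_var_inv hE).1
            | appI hv e => exact nomatch e.tag_eq hE
            | app hv h e => exact nomatch e.tag_eq hE
            | app₂ hv h h' e => exact nomatch List.mem_singleton.1 (List.mem_of_getElem? hv)
        | _ => exact nomatch ha
      · exact hs.not_nil.elim
    | _ => exact nomatch ha
  · exact hs.not_nil.elim

/-- The rule for `Pred` provides a left inverse of the successor. -/
theorem TmEq.of_succ {t u : Tm Ω} (h : TmEq (HA2 Ω ∪ E) (.succ t) (.succ u)) :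
    TmEq (HA2 Ω ∪ E) t u := by
  have H (t : Tm Ω) : TmEq (HA2 Ω ∪ E) (.pred (.succ t)) t :=
    .ax (l := .pred (.succ (.var 0))) (r := .var 0) (.inl (by simp [HA2])) fun _ => t
  exact (H t).symm.trans ((TmEq.pred h).trans (H u))

/-- Successors are stripped by `TmEq.of_succ` until one numeral is 0, where the other must be 0 too.
-/
theorem num_inj (hE : ZeroNeSucc E) {m n : ℕ} (h : TmEq (HA2 Ω ∪ E) (num m) (num n)) : m = n := by
  induction m generalizing n with
  | zero =>
    cases n with
    | zero => rfl
    | succ n => exact absurd h (hE _)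
  | succ m ih =>
    cases n with
    | zero => exact absurd h.symm (hE _)
    | succ n => rw [ih h.of_succ]

namespace Pf.TermCongr

variable {K : ClassSig} {R : Set (Tm Ω × Tm Ω)}

theorem symm {a b : Pf Ω K} (h : TermCongr R a b) : TermCongr R b a := by
  induction h <;> constructor <;> first | assumption | exact TmEq.symm ‹_› | exact ClEq.symm ‹_›

theorem trans {a b c : Pf Ω K} (h : TermCongr R a b) (h' : TermCongr R b c) :
    TermCongr R a c := by
  induction h generalizing c <;> cases h' <;> constructor <;>
    first | exact TmEq.trans ‹_› ‹_› | exact ClEq.trans ‹_› ‹_› | solve_by_elim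

end Pf.TermCongr

/-- The body of the normal form of a Parigot numeral. -/
def numeralBody {K : ClassSig} : ℕ → Pf Ω K
  | 0 => .var 1
  | n + 1 => .app (.app (.appI (.var 0) (num n)) (.lamK (.lam (.lam (numeralBody n)))))
      (numeralBody n)

/-- The hypotheses available in the body of `k` nested numerals. -/
def numeralCtx : ℕ → List (AFm Ω 𝔠)
  | 0 => []
  | k + 1 => stepFm 0 :: .mem .zero (.var 0) :: (numeralCtx k).map (Fm.subst Sub.shiftK)

/-- Each enclosing numeral contributes its β, at an even index, and its α, at the next odd one; both
refer to the class variable j of that numeral, counted from the inside. -/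
theorem numeralCtx_getElem? {k n : ℕ} {B : AFm Ω 𝔠} (h : (numeralCtx k)[n]? = some B) :
    ∃ j, n = 2 * j ∧ B = stepFm j ∨ n = 2 * j + 1 ∧ B = .mem .zero (.var j) := by
  induction k generalizing n B with
  | zero => exact nomatch h
  | succ k ih =>
    match n with
    | 0 => exact ⟨0, .inl ⟨rfl, (Option.some.inj h).symm⟩⟩
    | 1 => exact ⟨0, .inr ⟨rfl, (Option.some.inj h).symm⟩⟩
    | n + 2 =>
      simp only [numeralCtx, List.getElem?_cons_succ, List.getElem?_map,
        Option.map_eq_some_iff] at h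
      obtain ⟨C, hC, rfl⟩ := h
      obtain ⟨j, ⟨rfl, rfl⟩ | ⟨rfl, rfl⟩⟩ := ih hC
      exacts [⟨j + 1, .inl ⟨by ring, rfl⟩⟩, ⟨j + 1, .inr ⟨by ring, rfl⟩⟩]

theorem goodCtx_numeralCtx (k : ℕ) : GoodCtx (numeralCtx k : List (AFm Ω 𝔠)) := by
  intro B hB
  obtain ⟨n, hn⟩ := List.mem_iff_getElem?.1 hB
  obtain ⟨j, ⟨rfl, h⟩ | ⟨rfl, h⟩⟩ := numeralCtx_getElem? hn
  exacts [.inr ⟨j, h⟩, .inl ⟨_, j, h⟩]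

/-- A normal proof of `N(t)` under `k` nested numerals is `λX λα λβ b`. -/
theorem Proves.exists_lam_of_nat (hE : ZeroNeSucc E) {k : ℕ} {a : Pf Ω (skolemSig Ω 𝔠)} {t : Tm Ω}
    (h : Proves (FmEq (𝔠 := 𝔠) E) (numeralCtx k) a (.nat t)) (hn : a.Normal) :
    ∃ b, a = .lamK (.lam (.lam b)) ∧ b.Normal ∧
      Proves (FmEq (𝔠 := 𝔠) E) (numeralCtx (k + 1)) b (.mem t (.var 0)) := by
  have hΓ := goodCtx_numeralCtx (Ω := Ω) (𝔠 := 𝔠) (k + 1)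
  have e₀ := FmEq.natDef (E := E) (𝔠 := 𝔠) t
  rcases h.intro_or_spine hE (goodCtx_numeralCtx k) hn with hi | hs
  · have ha := h.introTag_eq hE hi
    rw [e₀.tag_eq hE] at ha
    cases h with
    | allKI e h₀ =>
      have h := h₀.conv ((e.symm.trans e₀).allK_inv hE)
      have hn := hn.of_lamK
      rcases h.intro_or_spine hE (fun B hB => hΓ B (.tail _ (.tail _ hB))) hn with hi | hs
      · have ha := h.introTag_eq hE hi
        cases h with
        | impI e h₁ =>
          obtain ⟨e₁, e₂⟩ := (e.symm.trans (.refl _)).imp_inv hE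
          have h := (h₁.conv e₂).conv_hyp e₁.symm
          have hn := hn.of_lam
          rcases h.intro_or_spine hE (fun B hB => hΓ B (.tail _ hB)) hn with hi | hs
          · have ha := h.introTag_eq hE hi
            cases h with
            | impI e h₂ =>
              obtain ⟨e₁, e₂⟩ := (e.symm.trans (.refl _)).imp_inv hE
              exact ⟨_, rfl, hn.of_lam, (h₂.conv e₂).conv_hyp e₁.symm⟩
            | _ => exact nomatch ha
          -- A partially applied induction step is also an implication, but its premise is N(u), of
          -- tag ∀X, or u ε Y. The premise required here is the induction step itself, of tag ∀, so
          -- no η-short form occurs.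
          · cases hs with
            | var hv e =>
              rcases hΓ _ (.tail _ (List.mem_of_getElem? hv)) with ⟨_, _, rfl⟩ | ⟨_, rfl⟩ <;>
                exact nomatch e.tag_eq hE
            | appI hv e => exact nomatch (e.imp_inv hE).1.tag_eq hE
            | app hv h e => exact nomatch (e.imp_inv hE).1.tag_eq hE
            | app₂ hv h h' e => exact nomatch e.tag_eq hE
        | _ => exact nomatch ha
      -- The required implication has premise 0 ε X, which excludes N(u) as premise, and an
      -- implication as conclusion, which excludes S(u) ε Y.
      · cases hs with
        | var hv e =>
          rcases hΓ _ (.tail _ (.tail _ (List.mem_of_getElem? hv))) with ⟨_, _, rfl⟩ | ⟨_, rfl⟩ <;>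
            exact nomatch e.tag_eq hE
        | appI hv e => exact nomatch (e.imp_inv hE).1.tag_eq hE
        | app hv h e => exact nomatch (e.imp_inv hE).2.tag_eq hE
        | app₂ hv h h' e => exact nomatch e.tag_eq hE
    | _ => exact nomatch ha
  · have ha := hs.tag_eq hE (goodCtx_numeralCtx k)
    rw [e₀.tag_eq hE] at ha
    rcases ha with ha | ha | ha <;> exact nomatch ha

theorem stepFm_inj (hE : ZeroNeSucc E) {i j : ℕ} (h : FmEq (𝔠 := 𝔠) E (stepFm i) (stepFm j)) :
    i = j :=
  ((((h.allI_inv hE).imp_inv hE).2.imp_inv hE).1.mem_var_inv hE).2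

/-- A normal proof of `t ε X` in the body of a numeral is the body of the normal form of a
numeral. -/
theorem Proves.termCongr_numeralBody (hE : ZeroNeSucc E) {k : ℕ} {a : Pf Ω (skolemSig Ω 𝔠)}
    {t : Tm Ω} (h : Proves (FmEq (𝔠 := 𝔠) E) (numeralCtx (k + 1)) a (.mem t (.var 0)))
    (hn : a.Normal) :
    ∃ m, TmEq (HA2 Ω ∪ E) t (num m) ∧ a.TermCongr (HA2 Ω ∪ E) (numeralBody m) := by
  -- The depth k varies along with the proof: the argument of type N(u) is a numeral one level
  -- deeper.
  induction hN : sizeOf a using Nat.strong_induction_on generalizing a t k with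
  | _ N ih =>
    rcases h.intro_or_spine hE (goodCtx_numeralCtx _) hn with hi | hs
    · have ha := h.introTag_eq hE hi
      exact (introTag_ne_mem _ ha).elim
    · cases hs with
      | var hv e =>
        obtain ⟨j, ⟨rfl, rfl⟩ | ⟨rfl, rfl⟩⟩ := numeralCtx_getElem? hv
        · exact nomatch e.tag_eq hE
        · obtain ⟨e', rfl⟩ := e.mem_var_inv hE
          exact ⟨0, e'.symm, .var 1⟩
      | appI hv e => exact nomatch e.tag_eq hE
      | app hv h e => exact nomatch e.tag_eq hE
      | @app₂ n j u _ a b hv ha hb e =>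
        -- The class variable is the innermost one, so the head can only be the β of this level,
        -- although those of the enclosing numerals are in scope.
        obtain ⟨e', rfl⟩ := e.mem_var_inv hE
        obtain ⟨j, ⟨rfl, hj⟩ | ⟨rfl, hj⟩⟩ := numeralCtx_getElem? hv
        · have hj : FmEq (𝔠 := 𝔠) E (stepFm 0) (stepFm j) := hj ▸ .refl _
          obtain rfl := stepFm_inj hE hj
          obtain ⟨c, rfl, hcn, hc⟩ := ha.exists_lam_of_nat hE fun b hb => hn _ (.appL (.appR hb))
          obtain ⟨m, hm, hcm⟩ := ih (sizeOf c) (by subst hN; simp; omega) hc hcn rfl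
          obtain ⟨m', hm', hbm⟩ := ih (sizeOf b) (by subst hN; simp) hb
            (fun b hb => hn _ (.appR hb)) rfl
          -- The proof of N(u) and that of u ε X each yield a numeral; both are congruent to u, so
          -- they agree.
          obtain rfl := num_inj hE (hm.symm.trans hm')
          exact ⟨m + 1, e'.trans (.succ hm),
            .app (.app (.appI (.var 0) hm) (.lamK (.lam (.lam hcm)))) hbm⟩
        · exact nomatch hj

/-- A normal closed proof of `N(t)` is the normal form of a numeral, up to congruence. -/
theorem Proves.termCongr_of_nat (hE : ZeroNeSucc E) {a : Pf Ω (skolemSig Ω 𝔠)} {t : Tm Ω}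
    (h : Proves (FmEq (𝔠 := 𝔠) E) [] a (.nat t)) (hn : a.Normal) :
    ∃ m, TmEq (HA2 Ω ∪ E) t (num m) ∧
      a.TermCongr (HA2 Ω ∪ E) (.lamK (.lam (.lam (numeralBody m)))) := by
  obtain ⟨b, rfl, hbn, hb⟩ := h.exists_lam_of_nat (k := 0) hE hn
  obtain ⟨m, hm, hbm⟩ := hb.termCongr_numeralBody hE hbn
  exact ⟨m, hm, .lamK (.lam (.lam hbm))⟩

end NormalProofs

open Pf

/-! ## Numerals and programs -/

section Programs

variable {Ω : Sig} {K : ClassSig}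

theorem num_subst (σ : ℕ → Tm Ω) (n : ℕ) : (num n : Tm Ω).subst σ = num n := by
  induction n with
  | zero => rfl
  | succ n ih => simp only [num, Tm.subst, ih]

/-- The proof-term `⟨y, fst(β)⟩` in the scope of `yβ`. -/
def extractBody : Pf Ω K := .packI (.var 0) (.fst (.var 0))

theorem extract_zero (a : Pf Ω K) : extract 0 a = .unpackI a extractBody := by
  have h : (Sub.shiftI 0 : Sub Ω K) = Sub.id := rfl
  have h' : a.rename (fun n => n) = a := by rw [rename_eq_subst]; exact subst_var a
  simp [extract, extractBody, h, tsubst_id, h']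

/-- The application of a weakened proof to the last variables. -/
def appVars (a : Pf Ω K) : Pf Ω K :=
  .app (.appI ((a.tsubst (Sub.shiftI 1)).rename (· + 1)) (.var 0)) (.var 0)

/-- The definition weakens π once by n and applies it to all variables at the end. Here the
outermost pair of binders is split off, which allows induction. -/
theorem extract_succ (k : ℕ) (a : Pf Ω K) :
    extract (k + 1) a = .lamI (.lam (extract k (appVars a))) := by
  have h : (Sub.shiftI 1).comp (Sub.shiftI k) = (Sub.shiftI (k + 1) : Sub Ω K) :=
    Sub.ext (fun n => congrArg Tm.var (by omega)) fun _ => rfl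
  have h' : (fun n => n + 1 + k) = fun n => n + (k + 1) := by funext n; omega
  have h₀ (n : ℕ) : (Sub.shiftI k : Sub Ω K).tm n = .var (n + k) := rfl
  simp [extract, appVars, Function.iterate_succ_apply', List.range_succ, Pf.tsubst, Pf.rename,
    rename_tsubst, rename_rename, tsubst_tsubst, h, h', Tm.subst, h₀]

theorem extract_tsubst (k : ℕ) (a : Pf Ω K) (s : Sub Ω K) :
    (extract k a).tsubst s = extract k (a.tsubst s) := by
  induction k generalizing a s with
  | zero => simp only [extract_zero, Pf.tsubst]; rfl
  | succ k ih =>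
    simp only [extract_succ, Pf.tsubst, ih, appVars, rename_tsubst, tsubst_tsubst,
      Sub.shiftI_comp_liftI]
    rfl

theorem extract_subst (k : ℕ) (a : Pf Ω K) (θ : ℕ → Pf Ω K) :
    (extract k a).subst θ = extract k (a.subst θ) := by
  induction k generalizing a θ with
  | zero => simp only [extract_zero, Pf.subst]; rfl
  | succ k ih =>
    simp only [extract_succ, Pf.subst, ih, appVars, subst_rename, subst_tsubst, rename_subst]
    rfl

/-- The application of a proof to a numeral. -/
def appNum (a : Pf Ω K) (i : ℕ) : Pf Ω K := .app (.appI a (num i)) (parigot i)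

/-- Two β-steps, one for the number and one for its proof. Instantiation cancels the weakening of
`a` and turns `appVars` into `appNum`. -/
theorem appNum_extract_reds (k : ℕ) (a : Pf Ω K) (i : ℕ) :
    Reds (appNum (extract (k + 1) a) i) (extract k (appNum a i)) := by
  rw [extract_succ]
  refine .tail (.single (.appL (.betaI _ _))) ?_
  have h : Pf.inst (parigot i) ((extract k (appVars a)).tsubst (Sub.instI (num i))) =
      extract k (appNum a i) := by
    rw [extract_tsubst, inst_eq, extract_subst]
    simp only [appVars, appNum, Pf.tsubst, Pf.subst, rename_tsubst, tsubst_tsubst,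
      Sub.shiftI_comp_instI, tsubst_id, subst_rename, Pf.cons]
    rw [show (fun n => (Pf.var n : Pf Ω K)) = Pf.var from rfl, subst_var]
    rfl
  rw [← h]
  exact .beta _ _

theorem foldl_appNum_reds {a b : Pf Ω K} (h : Reds a b) (l : List ℕ) :
    Reds (l.foldl appNum a) (l.foldl appNum b) := by
  induction l generalizing a b with
  | nil => exact h
  | cons i l ih => exact ih (h.map (appNum · i) fun h => .appL (.appI h))

theorem foldl_appNum_extract_reds (l : List ℕ) (a : Pf Ω K) :
    Reds (l.foldl appNum (extract l.length a)) (.unpackI (l.foldl appNum a) extractBody) := by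
  induction l generalizing a with
  | nil => rw [List.length_nil, extract_zero]; exact .refl
  | cons i l ih => exact (foldl_appNum_reds (appNum_extract_reds _ _ _) l).trans (ih _)

theorem applyNums_extract_reds {n : ℕ} (a : Pf Ω K) (p : Fin n → ℕ) :
    Reds (applyNums (extract n a) p) (.unpackI (applyNums a p) extractBody) := by
  have := foldl_appNum_extract_reds (List.ofFn p) a
  rwa [List.length_ofFn] at this

variable {𝔠 : Comprehension} {E : Set (Tm Ω × Tm Ω)}

/-- The context is arbitrary because ρ_n is needed under its successor's binders. There it serves
twice: as a proof of N(n), and, unfolded and applied to the current X, as the recursive value. -/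
theorem proves_parigot (Γ : List (AFm Ω 𝔠)) (n : ℕ) :
    Proves (FmEq E) Γ (parigot n) (.nat (num n)) := by
  induction n generalizing Γ with
  | zero =>
    exact .allKI (.natDef _) (.impI (.refl _) (.impI (.refl _) (.ax rfl (.refl _))))
  | succ n ih =>
    refine .allKI (.natDef _) (.impI (.refl _) (.impI (.refl _) ?_))
    refine .impE (.refl _) (.impE (.refl _) (.allE (.refl _) (.refl _)
      (.ax (A := stepFm 0) rfl (.refl _))) (ih _)) ?_
    refine .impE (.refl _) (.impE (A := .mem .zero (.var 0)) (.refl _)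
      (.allKE (.natDef (num n)) ?_ (ih _)) (.ax rfl (.refl _)))
      (.ax (A := stepFm 0) rfl (.refl _))
    have h : (num n : Tm Ω).subst (Sub.instK (.var 0) : Sub Ω (skolemSig Ω 𝔠)).tm = num n :=
      num_subst _ _
    simp only [Fm.subst, h]
    exact .refl _

theorem proves_extract {k : ℕ} {Γ : List (AFm Ω 𝔠)} {a : Pf Ω (skolemSig Ω 𝔠)} {A : AFm Ω 𝔠}
    (h : Proves (FmEq E) Γ a (forallNat k (.exI (.and (.nat (.var 0)) A)))) :
    Proves (FmEq E) Γ (extract k a) (programType k) := by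
  induction k generalizing Γ a with
  | zero =>
    rw [extract_zero]
    exact .exE (.refl _) h (.exI (.refl _) (.refl _)
      (.andE₁ (.refl _) (.ax (A := .and (.nat (.var 0)) A) rfl (.refl _))))
  | succ k ih =>
    rw [extract_succ]
    refine .allI (.refl _) (.impI (.refl _) (ih ?_))
    refine .impE (A := .nat (.var 0)) (.refl _) (.allE (.refl _) ?_ ((h.tsubst _).rename
      fun n B hB => hB)) (.ax rfl (.refl _))
    -- Weakening by a variable and then instantiating with that same variable changes nothing.
    have : ((forallNat k (.exI (.and (.nat (.var 0)) A))).subst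
        (Sub.shiftI 1).liftI).subst (Sub.instI (.var 0)) =
          forallNat k (.exI (.and (.nat (.var 0)) A)) := by
      rw [Fm.subst_subst, Sub.liftI_comp_instI]
      conv_rhs => rw [← Fm.subst_id (forallNat k _)]
      congr 1
      exact Sub.ext (fun n => by cases n <;> rfl) fun _ => rfl
    simp only [Fm.subst, this]
    exact .refl _

/-- The pending substitution s accumulates the numerals already supplied, so that the remaining
quantifiers need not be substituted into explicitly. -/
theorem proves_foldl_appNum {l : List ℕ} {a : Pf Ω (skolemSig Ω 𝔠)} {A : AFm Ω 𝔠}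
    {Γ : List (AFm Ω 𝔠)} {s : Sub Ω (skolemSig Ω 𝔠)}
    (h : Proves (FmEq E) Γ a ((forallNat l.length A).subst s)) :
    Proves (FmEq E) Γ (l.foldl appNum a)
      (A.subst (l.foldl (fun s i => Sub.consI (num i) s) s)) := by
  induction l generalizing a s with
  | nil => exact h
  | cons i l ih =>
    refine ih (.impE (A := .nat (num i)) (.refl _) (.allE (.refl _) ?_ h) (proves_parigot _ _))
    simp only [Fm.subst, Fm.subst_subst, Sub.liftI_comp_instI]
    exact .refl _

/-- The substitution of the numerals `p` for the first variables. -/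
def numSub {n : ℕ} (p : Fin n → ℕ) : Sub Ω K :=
  (List.ofFn p).foldl (fun s i => Sub.consI (num i) s) Sub.id

theorem proves_applyNums {n : ℕ} {a : Pf Ω (skolemSig Ω 𝔠)} {A : AFm Ω 𝔠}
    {Γ : List (AFm Ω 𝔠)} (h : Proves (FmEq E) Γ a (forallNat n A)) (p : Fin n → ℕ) :
    Proves (FmEq E) Γ (applyNums a p) (A.subst (numSub p)) :=
  proves_foldl_appNum (by rwa [Fm.subst_id, List.length_ofFn])

/-- The last argument is pushed last and gets index 0, so argument i gets n - 1 - i. -/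
theorem numSub_tm {n : ℕ} (p : Fin n → ℕ) (i : Fin n) :
    (numSub p : Sub Ω K).tm (n - 1 - i) = num (p i) := by
  have H (m : List ℕ) (s : Sub Ω K) (j : ℕ) (hj : j < m.length) :
      (m.foldr (fun i s => Sub.consI (num i) s) s).tm j = num m[j] := by
    induction m generalizing j with
    | nil => exact absurd hj (Nat.not_lt_zero _)
    | cons i m ih =>
      cases j with
      | zero => rfl
      | succ j => exact ih j (Nat.lt_of_succ_lt_succ hj)
  rw [numSub, List.foldl_eq_foldr_reverse, H _ _ _ (by simp; omega)]
  congr 1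
  simp only [List.getElem_reverse, List.length_ofFn, List.getElem_ofFn]
  congr 1
  ext
  simp only
  omega

theorem proves_applyNums_of_programSpec {a : Pf Ω (skolemSig Ω 𝔠)}
    (h : Proves (FmEq E) [] a (programSpec Ω (skolemSig Ω 𝔠))) (p : Fin (Ω.arity 0) → ℕ) :
    Proves (FmEq (𝔠 := 𝔠) E) [] (applyNums a p) (.exI (.and (.nat (.var 0))
      (.eq (.var 0) (.fn 0 fun i => num (p i))))) := by
  have hp : (fun i : Fin (Ω.arity 0) => (numSub p : Sub Ω (skolemSig Ω 𝔠)).liftI.tm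
      (Ω.arity 0 - (i : ℕ))) = fun i => num (p i) := by
    funext i
    -- The binder of y accounts for the additional 1.
    rw [show Ω.arity 0 - (i : ℕ) = Ω.arity 0 - 1 - i + 1 by omega]
    simp only [Sub.liftI, numSub_tm, num_subst]
  have := proves_applyNums h p
  simp only [Fm.subst, Tm.subst, hp] at this
  exact this

end Programs

/-! ## Soundness of predicate logic for the term model -/

section Tarski

variable {Ω : Sig} {K : ClassSig} {R : Set (Tm Ω × Tm Ω)}

/-- Extension of an assignment to a new innermost variable. -/
def Tm.cons (d : Tm Ω) (ρ : ℕ → Tm Ω) : ℕ → Tm Ω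
  | 0 => d
  | n + 1 => ρ n

/-- Truth in the term model, where equality is the congruence and the other predicates are
empty. -/
def Fm.Holds (R : Set (Tm Ω × Tm Ω)) : (ℕ → Tm Ω) → Fm Ω K → Prop
  | ρ, .eq t u => TmEq R (t.subst ρ) (u.subst ρ)
  | _, .nat _ => False
  | _, .null _ => False
  | _, .mem _ _ => False
  | _, .top => True
  | _, .bot => False
  | ρ, .and A B => A.Holds R ρ ∧ B.Holds R ρ
  | ρ, .or A B => A.Holds R ρ ∨ B.Holds R ρ
  | ρ, .imp A B => A.Holds R ρ → B.Holds R ρ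
  | ρ, .allI A => ∀ d, A.Holds R (Tm.cons d ρ)
  | ρ, .exI A => ∃ d, A.Holds R (Tm.cons d ρ)
  | ρ, .allK A => A.Holds R ρ
  | ρ, .exK A => A.Holds R ρ

theorem Fm.holds_subst (ρ : ℕ → Tm Ω) (s : Sub Ω K) (A : Fm Ω K) :
    (A.subst s).Holds R ρ ↔ A.Holds R fun n => (s.tm n).subst ρ := by
  have h (ρ : ℕ → Tm Ω) (s : Sub Ω K) (d : Tm Ω) :
      (fun n => (s.liftI.tm n).subst (Tm.cons d ρ)) =
        Tm.cons d fun n => (s.tm n).subst ρ := by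
    funext n
    cases n with
    | zero => rfl
    | succ n => exact Tm.subst_subst _ _ _
  have hK (s : Sub Ω K) : s.liftK.tm = s.tm := rfl
  induction A generalizing ρ s <;> simp_all [Fm.subst, Fm.Holds, Tm.subst_subst]

theorem Fm.holds_shiftI (ρ : ℕ → Tm Ω) (d : Tm Ω) (A : Fm Ω K) :
    (A.subst (Sub.shiftI 1)).Holds R (Tm.cons d ρ) ↔ A.Holds R ρ := by
  rw [holds_subst]; rfl

theorem Fm.holds_shiftK (ρ : ℕ → Tm Ω) (A : Fm Ω K) :
    (A.subst Sub.shiftK).Holds R ρ ↔ A.Holds R ρ := by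
  rw [holds_subst]; rfl

theorem Fm.holds_instI (ρ : ℕ → Tm Ω) (t : Tm Ω) (A : Fm Ω K) :
    (A.subst (Sub.instI t)).Holds R ρ ↔ A.Holds R (Tm.cons (t.subst ρ) ρ) := by
  rw [holds_subst]
  exact iff_of_eq (congrArg (Fm.Holds R · A) (funext fun n => by cases n <;> rfl))

theorem Fm.holds_instK (ρ : ℕ → Tm Ω) (c : Cl Ω K) (A : Fm Ω K) :
    (A.subst (Sub.instK c)).Holds R ρ ↔ A.Holds R ρ := by
  rw [holds_subst]; rfl

/-- Class quantifiers can be ignored, since membership is empty and truth therefore does not depend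
on the classes. -/
theorem Proves.holds {Γ : List (Fm Ω K)} {a : Pf Ω K} {A : Fm Ω K} (h : Proves Eq Γ a A)
    (ρ : ℕ → Tm Ω) (hΓ : ∀ B ∈ Γ, B.Holds R ρ) : A.Holds R ρ := by
  have cons {Γ : List (Fm Ω K)} {ρ : ℕ → Tm Ω} {A : Fm Ω K} (hA : A.Holds R ρ)
      (hΓ : ∀ B ∈ Γ, B.Holds R ρ) : ∀ B ∈ A :: Γ, B.Holds R ρ :=
    List.forall_mem_cons.2 ⟨hA, hΓ⟩
  have mapI {Γ : List (Fm Ω K)} {ρ : ℕ → Tm Ω} (hΓ : ∀ B ∈ Γ, B.Holds R ρ) (d : Tm Ω) :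
      ∀ B ∈ Γ.map (Fm.subst (Sub.shiftI 1)), B.Holds R (Tm.cons d ρ) :=
    List.forall_mem_map.2 fun B hB => (B.holds_shiftI ρ d).2 (hΓ B hB)
  have mapK {Γ : List (Fm Ω K)} {ρ : ℕ → Tm Ω} (hΓ : ∀ B ∈ Γ, B.Holds R ρ) :
      ∀ B ∈ Γ.map (Fm.subst Sub.shiftK), B.Holds R ρ :=
    List.forall_mem_map.2 fun B hB => (B.holds_shiftK ρ).2 (hΓ B hB)
  induction h generalizing ρ with
  | ax h e => exact e ▸ hΓ _ (List.mem_of_getElem? h)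
  | topI e => exact e ▸ True.intro
  | botE e h ih => exact (e ▸ ih ρ hΓ : Fm.Holds R ρ .bot).elim
  | andI e h₁ h₂ ih₁ ih₂ => exact e ▸ ⟨ih₁ ρ hΓ, ih₂ ρ hΓ⟩
  | andE₁ e h ih => subst e; exact (ih ρ hΓ).1
  | andE₂ e h ih => subst e; exact (ih ρ hΓ).2
  | orI₁ e h ih => subst e; exact .inl (ih ρ hΓ)
  | orI₂ e h ih => subst e; exact .inr (ih ρ hΓ)
  | orE e h₁ _ _ ih₁ ih₂ ih₃ =>
    subst e
    exact (ih₁ ρ hΓ).elim (fun h => ih₂ ρ (cons h hΓ)) fun h => ih₃ ρ (cons h hΓ)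
  | impI e h ih => subst e; exact fun h => ih ρ (cons h hΓ)
  | impE e h₁ h₂ ih₁ ih₂ => subst e; exact ih₁ ρ hΓ (ih₂ ρ hΓ)
  | allI e h ih => subst e; exact fun d => ih _ (mapI hΓ d)
  | allE e e' h ih => subst e e'; exact (Fm.holds_instI _ _ _).2 (ih ρ hΓ _)
  | exI e e' h ih => subst e e'; exact ⟨_, (Fm.holds_instI _ _ _).1 (ih ρ hΓ)⟩
  | exE e h₁ h₂ ih₁ ih₂ =>
    subst e
    obtain ⟨d, hd⟩ := ih₁ ρ hΓ
    exact (Fm.holds_shiftI _ _ _).1 (ih₂ _ (cons hd (mapI hΓ d)))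
  | allKI e h ih => subst e; exact ih ρ (mapK hΓ)
  | allKE e e' h ih => subst e e'; exact (Fm.holds_instK _ _ _).2 (ih ρ hΓ)
  | exKI e e' h ih => subst e e'; have := (Fm.holds_instK _ _ _).1 (ih ρ hΓ); exact this
  | exKE e h₁ h₂ ih₁ ih₂ =>
    subst e
    exact (Fm.holds_shiftK _ _).1 (ih₂ _ (cons (ih₁ ρ hΓ) (mapK hΓ)))

theorem Fm.holds_allI_iterate {A : Fm Ω K} (h : ∀ ρ, A.Holds R ρ) (n : ℕ) (ρ : ℕ → Tm Ω) :
    (Fm.allI^[n] A).Holds R ρ := by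
  induction n generalizing ρ with
  | zero => exact h ρ
  | succ n ih => rw [Function.iterate_succ_apply']; exact fun d => ih _

theorem Fm.holds_foldr_imp (L : List (Fm Ω K)) (B : Fm Ω K) (ρ : ℕ → Tm Ω) :
    (L.foldr Fm.imp B).Holds R ρ ↔ ((∀ A ∈ L, A.Holds R ρ) → B.Holds R ρ) := by
  induction L with
  | nil => simp
  | cons A L ih => simp [Fm.Holds, ih]

theorem EquationAxiom.holds {E : Set (Tm Ω × Tm Ω)} (hR : E ⊆ R) {A : Fm Ω K}
    (h : EquationAxiom E A) (ρ : ℕ → Tm Ω) : A.Holds R ρ := by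
  cases h with
  | mk h n hl hr => refine Fm.holds_allI_iterate (fun ρ => ?_) n ρ; exact TmEq.ax (hR h) ρ

theorem EqualityAxiom.holds {A : Fm Ω K} (h : EqualityAxiom A) (ρ : ℕ → Tm Ω) :
    A.Holds R ρ := by
  cases h with
  | refl => refine Fm.holds_allI_iterate (fun ρ => ?_) _ ρ; exact TmEq.refl _
  | symm => refine Fm.holds_allI_iterate (fun ρ => ?_) _ ρ; exact TmEq.symm
  | trans => refine Fm.holds_allI_iterate (fun ρ => ?_) _ ρ; exact TmEq.trans
  | succ => refine Fm.holds_allI_iterate (fun ρ => ?_) _ ρ; exact TmEq.succ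
  | pred => refine Fm.holds_allI_iterate (fun ρ => ?_) _ ρ; exact TmEq.pred
  | add => refine Fm.holds_allI_iterate (fun ρ => ?_) _ ρ; exact TmEq.add
  | mul => refine Fm.holds_allI_iterate (fun ρ => ?_) _ ρ; exact TmEq.mul
  | fn i =>
    refine Fm.holds_allI_iterate (fun ρ => (Fm.holds_foldr_imp _ _ _).2 fun h => ?_) _ ρ
    exact TmEq.fn i fun j => h _ (List.mem_ofFn.2 ⟨j, rfl⟩)

/-- Provability from the equations becomes congruence, because the term model satisfies the
equations and the equality axioms and reads equality as the congruence. -/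
theorem Specifies.tmEq {E : Set (Tm Ω × Tm Ω)} {f : (Fin (Ω.arity 0) → ℕ) →. ℕ}
    (h : Specifies K E f) (hR : E ⊆ R) {p : Fin (Ω.arity 0) → ℕ} {r : ℕ} (hr : r ∈ f p) :
    TmEq R (num r) (.fn 0 fun i => num (p i)) := by
  obtain ⟨Γ, a, hΓ, ha⟩ := (h p r).2 hr
  have := ha.holds (R := R) .var fun B hB => (hΓ B hB).elim (fun h => h.holds hR _)
    fun h => h.holds _
  simpa only [Fm.Holds, Tm.subst_var] using this

end Tarski

end DeductionModulo

/-! ### The main theorem -/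

open DeductionModulo
theorem mainTheorem6 (Ω : Sig) (𝔠 : Comprehension) (E : Set (Tm Ω × Tm Ω))
    (hE : ∀ t : Tm Ω, ¬ TmEq (HA2 Ω ∪ E) Tm.zero (Tm.succ t))
    (f : (Fin (Ω.arity 0) → ℕ) →. ℕ) (hf : Specifies (skolemSig Ω 𝔠) E f)
    (π : Pf Ω (skolemSig Ω 𝔠))
    (hπ : Proves (FmEq E) [] π (programSpec Ω (skolemSig Ω 𝔠))) :
    Proves (FmEq E) [] (extract (Ω.arity 0) π) (programType (Ω.arity 0)) ∧
    ∀ p : Fin (Ω.arity 0) → ℕ,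
      ∃ (q : ℕ) (t : Tm Ω) (σ τ ν : Pf Ω (skolemSig Ω 𝔠)),
        (applyNums π p).StronglyNormalizing ∧
        (applyNums π p).IsNormalForm (.packI t (.pair σ τ)) ∧
        (applyNums (extract (Ω.arity 0) π) p).StronglyNormalizing ∧
        (applyNums (extract (Ω.arity 0) π) p).IsNormalForm (.packI t σ) ∧
        Proves (FmEq E) [] σ (.nat t) ∧
        Proves (FmEq E) [] τ (.eq t (.fn 0 (fun i => num (p i)))) ∧
        (parigot q).IsNormalForm ν ∧
        σ.TermCongr (HA2 Ω ∪ E) ν ∧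
        TmEq (HA2 Ω ∪ E) t (num q) ∧
        (∃ υ, Proves (FmEq (𝔠 := 𝔠) E) [] υ (.eq (num q) (.fn 0 (fun i => num (p i))))) ∧
        ∀ r ∈ f p, q = r := by
  have hx := proves_extract hπ
  refine ⟨hx, fun p => ?_⟩
  have hp := proves_applyNums_of_programSpec hπ p
  have hsn := hp.stronglyNormalizing
  have hxsn := (proves_applyNums hx p).stronglyNormalizing
  obtain ⟨b, hb, hbn⟩ := hsn.exists_normal
  have hnf := hsn.isNormalForm hb hbn
  have h := hp.reds hE hb
  have hΓ : GoodCtx ([] : List (AFm Ω 𝔠)) := nofun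
  -- Without hypotheses there is no spine, so b is an introduction; its tag leaves only ⟨t, a⟩. The
  -- same argument then splits a into a pair.
  have ha := h.introTag_eq hE ((h.intro_or_spine hE hΓ hbn).resolve_right Spine.not_nil)
  cases h with
  | @exI _ A _ C a t e e' h =>
    have h : Proves (FmEq (𝔠 := 𝔠) E) [] a
        (.and (.nat t) (.eq t (.fn 0 fun i => num (p i)))) := by
      have := h.conv (e'.trans ((e.symm.exI_inv hE).subst _))
      simp only [Fm.subst, Tm.subst, num_subst] at this
      exact this
    have han : a.Normal := fun b hb => hbn _ (.packI hb)
    have ha := h.introTag_eq hE ((h.intro_or_spine hE hΓ han).resolve_right Spine.not_nil)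
    cases h with
    | @andI _ A B _ σ τ e hσ hτ =>
      obtain ⟨e₁, e₂⟩ := e.and_inv hE
      have hσ := hσ.conv e₁.symm
      have hτ := hτ.conv e₂.symm
      have hσn : σ.Normal := fun b hb => han _ (.pairL hb)
      have hτn : τ.Normal := fun b hb => han _ (.pairR hb)
      obtain ⟨q, hq, hσq⟩ := hσ.termCongr_of_nat hE hσn
      -- The normal form of ρ_q is not computed: being a normal proof of N(q), it falls under the
      -- same classification as σ, and `num_inj` identifies its index with q.
      have hρ := proves_parigot (E := E) (𝔠 := 𝔠) [] q
      obtain ⟨ν, hν, hνn⟩ := hρ.stronglyNormalizing.exists_normal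
      obtain ⟨q', hq', hνq⟩ := (hρ.reds hE hν).termCongr_of_nat hE hνn
      obtain rfl := num_inj hE hq'
      refine ⟨q, t, σ, τ, ν, hsn, hnf, hxsn, hxsn.isNormalForm ?_ ?_, hσ, hτ,
        hρ.stronglyNormalizing.isNormalForm hν hνn, hσq.trans hνq.symm, hq,
        ⟨τ, hτ.conv (.eq hq (.refl _))⟩, fun r hr => ?_⟩
      -- The program opens the normal proof ⟨t, ⟨σ, τ⟩⟩ and keeps its first component.
      · refine (applyNums_extract_reds π p).trans ?_
        refine (hb.map (.unpackI · extractBody) .unpackIL).trans ?_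
        exact .tail (.single (.unpackPackI _ _ _)) (.packI (.fstPair _ _))
      · rintro b hb
        cases hb with
        | packI hb => exact hσn _ hb
      -- q ≡ t by σ, t ≡ F₀(p) by τ, and F₀(p) ≡ r by the specification.
      · exact num_inj hE (hq.symm.trans ((hτ.tmEq_of_eq hE hτn).trans
          (hf.tmEq Set.subset_union_right hr).symm))
    | _ => exact nomatch ha
  | _ => exact nomatch ha
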